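/- Let $d\ge 1$, let $\mathbb{T}^d=\mathbb{R}^d/\mathbb{Z}^d$ be the flat unit torus, and let $v:\mathbb{T}^d\to[0,\infty)$ be a bounded measurable function with $v(-x)=v(x)$ and with non-negative Fourier coefficients $\hat v(p)=\int_{\mathbb{T}^d}v(x)e^{-ip\cdot x}\,dx\ge 0$ for all $p\in(2\pi\mathbb{Z})^d$. For $N\ge 2$ let $$H_N=-\sum_{i=1}^N\Delta_i+\frac1{N-1}\sum_{1\le i<j\le N}v(x_i-x_j)$$ act on the permutation-symmetric functions in $L^2(\mathbb{T}^{dN})$. Let $E_0(N)$ be the ground state energy of $H_N$ (the infimum of $\langle\Psi,H_N\Psi\rangle$ over normalized symmetric $\Psi$ in the domain of $H_N$), and for $P\in(2\pi\mathbb{Z})^d$ let $E_P(N)$ be the ground state energy of $H_N$ in the sector of total momentum $P$ (the same infimum over those $\Psi$ with $-i\sum_{j}\nabla_j\Psi=P\Psi$). Put $e_p=\sqrt{|p|^4+2|p|^2\hat v(p)}$. Then the following holds. (i) For every $P\in(2\pi\mathbb{Z})^d$ the minimum $$m(P)=\min\Big\{\sum_{p\ne0}e_p\,n_p\ :\ n_p\in\{0,1,2,\dots\},\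 \text{finitely many nonzero},\ \sum_{p\neq 0}p\,n_p=P\Big\}$$ over occupation numbers indexed by $p\in(2\pi\mathbb{Z})^d\setminus\{0\}$ exists, and for every $K$ there is a constant $C$, depending only on $d$, $v$ and $K$, such that $$\big|E_P(N)-E_0(N)-m(P)\big|\le C\,|P|^{3/2}N^{-1/2}$$ for all $N\ge2$ and all $P\in(2\pi\mathbb{Z})^d$ with $|P|\le KN$. (ii) The minimum $s=\min_{p\in(2\pi\mathbb{Z})^d\setminus\{0\}}\sqrt{2\hat v(p)+|p|^2}$ exists, and there is a constant $C$, depending only on $d$ and $v$, such that $$E_P(N)-E_0(N)\ge s\,|P|-C\,|P|^{3/2}N^{-1/2}$$ for all $N\ge 2$ and all $P\in(2\pi\mathbb{Z})^d$. (iii) In particular the lowest energy grows linearly in $|P|$: there are constants $c_1,\delta>0$ and $c_2$, depending only on $d$ and $v$, such that $c_1|P|\le E_P(N)-E_0(N)\le c_2|P|$ for all $N\ge2$ and all $P\in(2\pi\mathbb{Z})^d$ with $|P|\le\delta N$. -/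

import Mathlib

noncomputable section

namespace BoseGas

open MeasureTheory

/-- The normalised Haar (Lebesgue) measure on the flat unit torus with coordinates indexed by `ι`. -/
abbrev torusMeasure (ι : Type) [Fintype ι] : Measure (UnitAddTorus ι) :=
  Measure.pi fun _ => AddCircle.haarAddCircle

/-- The Hilbert space of complex square integrable functions on the torus. -/
abbrev L2Torus (ι : Type) [Fintype ι] : Type :=
  Lp ℂ 2 (torusMeasure ι)

/-- The Hilbert basis of plane waves `x ↦ exp (2 π i k · x)`, `k ∈ ℤ^ι`. -/
def planeWaves (ι : Type) [Fintype ι] : HilbertBasis (ι → ℤ) ℂ (L2Torus ι) :=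
  UnitAddTorus.mFourierBasis

/-- The wave functions `Ψ` for which the sequence `m k * Ψ̂ k` is square summable. -/
def multiplierDomain {ι : Type} [Fintype ι] (m : (ι → ℤ) → ℝ) : Submodule ℂ (L2Torus ι) where
  carrier := {Ψ | Memℓp (fun k => (m k : ℂ) * (planeWaves ι).repr Ψ k) 2}
  add_mem' := by
    intro Ψ Φ hΨ hΦ
    have h := Memℓp.add hΨ hΦ
    refine cast (congrArg (fun f => Memℓp f 2) (funext fun k => ?_)) h
    rw [map_add, lp.coeFn_add, Pi.add_apply, Pi.add_apply, mul_add]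
  zero_mem' := by
    refine cast (congrArg (fun f => Memℓp f 2) (funext fun k => ?_))
      (zero_memℓp : Memℓp (0 : (ι → ℤ) → ℂ) 2)
    rw [map_zero, lp.coeFn_zero, Pi.zero_apply, mul_zero]
  smul_mem' := by
    intro c Ψ hΨ
    have h := Memℓp.const_smul hΨ c
    refine cast (congrArg (fun f => Memℓp f 2) (funext fun k => ?_)) h
    rw [map_smul, lp.coeFn_smul, Pi.smul_apply, Pi.smul_apply, smul_eq_mul, smul_eq_mul,
      mul_left_comm]

theorem mem_multiplierDomain {ι : Type} [Fintype ι] {m : (ι → ℤ) → ℝ} {Ψ : L2Torus ι} :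
    Ψ ∈ multiplierDomain m ↔ Memℓp (fun k => (m k : ℂ) * (planeWaves ι).repr Ψ k) 2 :=
  Iff.rfl

/-- The sequence of Fourier coefficients `m k * Ψ̂ k`. -/
def multiplierCoeff {ι : Type} [Fintype ι] (m : (ι → ℤ) → ℝ) :
    multiplierDomain m →ₗ[ℂ] lp (fun _ : ι → ℤ => ℂ) 2 where
  toFun Ψ := ⟨fun k => (m k : ℂ) * (planeWaves ι).repr (Ψ : L2Torus ι) k,
    mem_multiplierDomain.1 Ψ.2⟩
  map_add' := by
    intro Ψ Φ
    refine lp.ext (funext fun k => ?_)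
    rw [lp.coeFn_add, Pi.add_apply]
    change (m k : ℂ) * (planeWaves ι).repr ((Ψ : L2Torus ι) + (Φ : L2Torus ι)) k = _
    rw [map_add, lp.coeFn_add, Pi.add_apply, mul_add]
  map_smul' := by
    intro c Ψ
    refine lp.ext (funext fun k => ?_)
    rw [lp.coeFn_smul, Pi.smul_apply]
    change (m k : ℂ) * (planeWaves ι).repr (c • (Ψ : L2Torus ι)) k = _
    rw [map_smul, lp.coeFn_smul, Pi.smul_apply, smul_eq_mul, RingHom.id_apply, smul_eq_mul,
      mul_left_comm]

/-- The operator that multiplies the `k`-th Fourier coefficient by the real number `m k`, on its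
maximal domain. -/
def fourierMultiplier {ι : Type} [Fintype ι] (m : (ι → ℤ) → ℝ) :
    L2Torus ι →ₗ.[ℂ] L2Torus ι where
  domain := multiplierDomain m
  toFun := (planeWaves ι).repr.symm.toLinearEquiv.toLinearMap ∘ₗ multiplierCoeff m

/-- The wave functions `Ψ` for which `V Ψ` is square integrable. -/
def multiplicationDomain {ι : Type} [Fintype ι] (V : UnitAddTorus ι → ℝ) :
    Submodule ℂ (L2Torus ι) where
  carrier := {Ψ | MemLp (fun x => (V x : ℂ) * Ψ x) 2 (torusMeasure ι)}
  add_mem' := by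
    intro Ψ Φ hΨ hΦ
    refine (MemLp.add hΨ hΦ).ae_eq ?_
    filter_upwards [Lp.coeFn_add Ψ Φ] with x hx
    rw [hx, Pi.add_apply, Pi.add_apply, mul_add]
  zero_mem' := by
    refine (MemLp.zero (ε := ℂ)).ae_eq ?_
    filter_upwards [Lp.coeFn_zero ℂ 2 (torusMeasure ι)] with x hx
    rw [hx, Pi.zero_apply, mul_zero]
  smul_mem' := by
    intro c Ψ hΨ
    refine (MemLp.const_smul hΨ c).ae_eq ?_
    filter_upwards [Lp.coeFn_smul c Ψ] with x hx
    rw [hx, Pi.smul_apply, Pi.smul_apply, smul_eq_mul, smul_eq_mul, mul_left_comm]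

theorem mem_multiplicationDomain {ι : Type} [Fintype ι] {V : UnitAddTorus ι → ℝ}
    {Ψ : L2Torus ι} : Ψ ∈ multiplicationDomain V ↔
      MemLp (fun x => (V x : ℂ) * Ψ x) 2 (torusMeasure ι) :=
  Iff.rfl

/-- Multiplication by the real function `V`, on its maximal domain. -/
def multiplication {ι : Type} [Fintype ι] (V : UnitAddTorus ι → ℝ) :
    L2Torus ι →ₗ.[ℂ] L2Torus ι where
  domain := multiplicationDomain V
  toFun :=
    { toFun := fun Ψ => MemLp.toLp (fun x => (V x : ℂ) * (Ψ : L2Torus ι) x)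
        (mem_multiplicationDomain.1 Ψ.2)
      map_add' := by
        intro Ψ Φ
        rw [← MemLp.toLp_add]
        refine MemLp.toLp_congr _ _ ?_
        filter_upwards [Lp.coeFn_add (Ψ : L2Torus ι) (Φ : L2Torus ι)] with x hx
        rw [Submodule.coe_add, hx, Pi.add_apply, Pi.add_apply, mul_add]
      map_smul' := by
        intro c Ψ
        rw [RingHom.id_apply, ← MemLp.toLp_const_smul]
        refine MemLp.toLp_congr _ _ ?_
        filter_upwards [Lp.coeFn_smul c (Ψ : L2Torus ι)] with x hx
        rw [Submodule.coe_smul, hx, Pi.smul_apply, Pi.smul_apply, smul_eq_mul, smul_eq_mul,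
          mul_left_comm] }

/-- The element `2 π k` of the momentum lattice `(2 π ℤ)^d`, with the Euclidean norm. -/
def momentum {d : ℕ} (k : Fin d → ℤ) : EuclideanSpace ℝ (Fin d) :=
  WithLp.toLp 2 fun a => 2 * Real.pi * (k a : ℝ)

/-- The Fourier coefficient `∫ v(x) e^{-i p x} dx` at `p = 2 π k`; it is real for even `v`
(see `vHat_eq`). -/
def vHat {d : ℕ} (v : UnitAddTorus (Fin d) → ℝ) (k : Fin d → ℤ) : ℝ :=
  (UnitAddTorus.mFourierCoeff (fun x => (v x : ℂ)) k).re

/-- The position of particle `i` in the `N`-particle configuration `x`. -/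
def position {N d : ℕ} (x : UnitAddTorus (Fin N × Fin d)) (i : Fin N) : UnitAddTorus (Fin d) :=
  fun a => x (i, a)

/-- The momentum of particle `i` in the plane wave with wave vector `k`. -/
def particleMomentum {N d : ℕ} (k : Fin N × Fin d → ℤ) (i : Fin N) : EuclideanSpace ℝ (Fin d) :=
  momentum fun a => k (i, a)

/-- The kinetic energy `-∑ᵢ Δᵢ`. -/
def kinetic (d N : ℕ) : L2Torus (Fin N × Fin d) →ₗ.[ℂ] L2Torus (Fin N × Fin d) :=
  fourierMultiplier fun k => ∑ i : Fin N, ‖particleMomentum k i‖ ^ 2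

/-- The interaction energy `(N - 1)⁻¹ ∑_{i < j} v(xᵢ - xⱼ)` of a configuration. -/
def interaction {d : ℕ} (v : UnitAddTorus (Fin d) → ℝ) (N : ℕ)
    (x : UnitAddTorus (Fin N × Fin d)) : ℝ :=
  ((N : ℝ) - 1)⁻¹ * ∑ i : Fin N, ∑ j ∈ Finset.Ioi i, v (position x i - position x j)

/-- The Hamiltonian `H_N`. -/
def hamiltonian {d : ℕ} (v : UnitAddTorus (Fin d) → ℝ) (N : ℕ) :
    L2Torus (Fin N × Fin d) →ₗ.[ℂ] L2Torus (Fin N × Fin d) :=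
  kinetic d N + multiplication (interaction v N)

/-- The component in direction `a` of the total momentum operator `-i ∑ⱼ ∇ⱼ`. -/
def totalMomentum (d N : ℕ) (a : Fin d) :
    L2Torus (Fin N × Fin d) →ₗ.[ℂ] L2Torus (Fin N × Fin d) :=
  fourierMultiplier fun k => ∑ i : Fin N, particleMomentum k i a

/-- Bosonic (permutation-symmetric) wave functions. -/
def IsBosonic {d N : ℕ} (Ψ : L2Torus (Fin N × Fin d)) : Prop :=
  ∀ σ : Equiv.Perm (Fin N),
    (fun x : UnitAddTorus (Fin N × Fin d) => Ψ fun ia => x (σ ia.1, ia.2))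
      =ᵐ[torusMeasure (Fin N × Fin d)] Ψ

/-- Wave functions of total momentum `P`: joint eigenfunctions of the components of the total
momentum operator with eigenvalues the components of `P`. -/
def HasTotalMomentum {d N : ℕ} (P : EuclideanSpace ℝ (Fin d)) (Ψ : L2Torus (Fin N × Fin d)) :
    Prop :=
  ∀ a : Fin d, ∃ h : Ψ ∈ (totalMomentum d N a).domain,
    totalMomentum d N a ⟨Ψ, h⟩ = (P a : ℂ) • Ψ

/-- The energy expectation values `⟨Ψ, H_N Ψ⟩` of the normalised bosonic wave functions `Ψ` in the
domain of `H_N` that satisfy the condition `S`. -/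
def energies {d : ℕ} (v : UnitAddTorus (Fin d) → ℝ) (N : ℕ)
    (S : L2Torus (Fin N × Fin d) → Prop) : Set ℝ :=
  {E | ∃ Ψ : (hamiltonian v N).domain, IsBosonic (Ψ : L2Torus (Fin N × Fin d)) ∧
    S (Ψ : L2Torus (Fin N × Fin d)) ∧ ‖(Ψ : L2Torus (Fin N × Fin d))‖ = 1 ∧
    E = (inner ℂ (Ψ : L2Torus (Fin N × Fin d)) (hamiltonian v N Ψ)).re}

/-- The ground state energy `E₀(N)` of `H_N` on the bosonic wave functions. -/
def groundEnergy {d : ℕ} (v : UnitAddTorus (Fin d) → ℝ) (N : ℕ) : ℝ :=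
  sInf (energies v N fun _ => True)

/-- The ground state energy `E_P(N)` of `H_N` in the sector of total momentum `P`. -/
def sectorEnergy {d : ℕ} (v : UnitAddTorus (Fin d) → ℝ) (N : ℕ) (P : EuclideanSpace ℝ (Fin d)) :
    ℝ :=
  sInf (energies v N (HasTotalMomentum P))

/-- The elementary excitation energy `e_p = √(|p|⁴ + 2 |p|² v̂(p))` at `p = 2 π k`. -/
def excitationEnergy {d : ℕ} (v : UnitAddTorus (Fin d) → ℝ) (k : Fin d → ℤ) : ℝ :=
  √(‖momentum k‖ ^ 4 + 2 * ‖momentum k‖ ^ 2 * vHat v k)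

/-- The values `∑_{p ≠ 0} e_p n_p` over all finitely supported occupation numbers `n_p`, `p ≠ 0`,
with `∑_p p n_p = P`. -/
def bogoliubovEnergies {d : ℕ} (v : UnitAddTorus (Fin d) → ℝ) (P : EuclideanSpace ℝ (Fin d)) :
    Set ℝ :=
  {E | ∃ n : {k : Fin d → ℤ // k ≠ 0} →₀ ℕ,
    (n.sum fun k j => (j : ℝ) • momentum k.1) = P ∧
    E = n.sum fun k j => excitationEnergy v k.1 * (j : ℝ)}

/-- The values `√(2 v̂(p) + |p|²)` over all nonzero momenta `p`. -/
def criticalSpeeds {d : ℕ} (v : UnitAddTorus (Fin d) → ℝ) : Set ℝ :=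
  {s | ∃ k : Fin d → ℤ, k ≠ 0 ∧ s = √(2 * vHat v k + ‖momentum k‖ ^ 2)}

/-- For even `v` the Fourier coefficients are real. -/
theorem vHat_eq {d : ℕ} (v : UnitAddTorus (Fin d) → ℝ) (heven : ∀ x, v (-x) = v x)
    (k : Fin d → ℤ) :
    UnitAddTorus.mFourierCoeff (fun x => (v x : ℂ)) k = (vHat v k : ℂ) := by
  have hneg : (AddCircle.haarAddCircle : Measure UnitAddCircle).IsNegInvariant := by
    unfold AddCircle.haarAddCircle
    infer_instance
  have key : (starRingEnd ℂ) (UnitAddTorus.mFourierCoeff (fun x => (v x : ℂ)) k)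
      = UnitAddTorus.mFourierCoeff (fun x => (v x : ℂ)) k := by
    change (starRingEnd ℂ) (∫ t, UnitAddTorus.mFourier (-k) t • (v t : ℂ) ∂torusMeasure (Fin d))
      = ∫ t, UnitAddTorus.mFourier (-k) t • (v t : ℂ) ∂torusMeasure (Fin d)
    rw [← integral_conj, ← integral_neg_eq_self _ (torusMeasure (Fin d))]
    refine integral_congr_ae (Filter.Eventually.of_forall fun t => ?_)
    simp [heven, UnitAddTorus.mFourier, fourier_apply]
  exact (Complex.conj_eq_iff_re.mp key).symm

end BoseGas

end

/-! In the plane wave basis a bosonic wave function is a permutation-symmetric function of the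
particle momenta. With ρ_p = ∑_q a_{q+p}^* a_q the interaction is (N/2) v̂(0) + (2(N-1))⁻¹ ∑_{p≠0}
v̂(p) (ρ_p^* ρ_p - N). At low energy most particles sit in the zero mode. Split ρ_p = a_p^* a_0 +
a_0^* a_{-p} + R_p: together with the kinetic energy the first two terms give Bogoliubov's quadratic
Hamiltonian, and R_p is controlled by the number n₊ of particles outside the zero mode. Since v is
bounded and v̂ ≥ 0, the sum of v̂ is finite (`sum_vHat_le`), which makes all constants uniform in N
and in the momentum cutoff.

The quadratic Hamiltonian is not diagonalised. Its pair terms conserve n_p - n_{-p}, and completing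
a square on each sign of this imbalance bounds the energy of the modes ±p below by e_p |n_p -
n_{-p}| minus a constant (`neg_ev_le_pairing`). The positive parts of the imbalances are occupation
numbers with the same total momentum P, so the sum of these energies is at least m(P)
(`le_imbalance_energy`).

For the lower bound the remaining task is the second moment of n₊. A minimiser of the truncated form
in the momentum sector satisfies an Euler–Lagrange equation; testing it with n₊² c and computing a
double commutator gives ⟨n₊²⟩ ≤ C ξ², where ξ bounds the truncated form (`minimizer_moment`).
Spreading P evenly over the particles shows that ξ = O(|P| + 1) is possible for |P| ≤ K N
(`exists_balanced_config`). Estimating the cubic cross terms with R_p by Young's inequality with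
weight √(ξ/N) then costs ξ^{3/2} N^{-1/2} (`lower_bound`).

The upper bound uses a particle-number conserving Bogoliubov state whose imbalances come from
occupation numbers attaining m(P). Its configurations share the parity of n₊, so the cubic terms
vanish and the error is only of order (m + 1)²/N (`trial_energy`, `sectorEnergy_le`). If m(P) is too
large compared with N for this state to exist, a crude bound of order |P| is already within the
allowed error.

Both bounds contain the same constant (N/2) v̂(0) - `shift v`. Subtracting the case P = 0 removes
it, provided that E_0(N) is the energy of the zero momentum sector. This holds because ψ ↦ |ψ| does
not increase the energy and maps every momentum sector into the one of zero momentum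
(`fullForm_ge_of_momentum`). The result is `exists_gap_constant`; the linear lower bounds follow
from the triangle inequality, since e_p ≥ s |p| (`criticalSpeed_mul_le`). -/

namespace BoseGas
open Finset Function

set_option linter.unusedSectionVars false

/-! ### Configurations of particle momenta and one-particle hops. -/

section Configurations

variable {G : Type} [AddCommGroup G] [DecidableEq G] {N : ℕ}

/-- The number of particles in the mode `p`. -/
def occ (k : Fin N → G) (p : G) : ℕ := #{i | k i = p}

/-- The number of particles outside of the zero mode. -/
def excited (k : Fin N → G) : ℕ := #{i | k i ≠ 0}

/-- The configurations all of whose particles have their mode in `Λ`. -/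
def box (N : ℕ) (Λ : Finset G) : Finset (Fin N → G) := Fintype.piFinset fun _ => Λ

/-- Permutation-symmetric functions of the configuration. -/
def IsSymm {E : Type} (c : (Fin N → G) → E) : Prop :=
  ∀ (σ : Equiv.Perm (Fin N)) (k : Fin N → G), c (k ∘ σ) = c k

/-- The operator `a_p^* a_q`. -/
def hop (p q : G) (c : (Fin N → G) → ℝ) (k : Fin N → G) : ℝ :=
  ∑ i with k i = p, c (update k i q)

/-- The operator `∑_q a_{q+p}^* a_q`. -/
def trans (p : G) (c : (Fin N → G) → ℝ) (k : Fin N → G) : ℝ :=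
  ∑ i, c (update k i (k i - p))

/-- The part of `trans p` that does not involve the zero mode. -/
def transExc (p : G) (c : (Fin N → G) → ℝ) (k : Fin N → G) : ℝ :=
  ∑ i with k i ≠ 0 ∧ k i ≠ p, c (update k i (k i - p))

theorem mem_box {Λ : Finset G} {k : Fin N → G} : k ∈ box N Λ ↔ ∀ i, k i ∈ Λ := by
  simp [box]

theorem update_mem_box {Λ : Finset G} {k : Fin N → G} (hk : k ∈ box N Λ) (i : Fin N) {p : G}
    (hp : p ∈ Λ) : update k i p ∈ box N Λ := by
  rw [mem_box] at hk ⊢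
  intro j
  by_cases h : j = i
  · subst h; simpa
  · simpa [update_of_ne h] using hk j

theorem occ_zero_add_excited (k : Fin N → G) : occ k 0 + excited k = N := by
  simpa [occ, excited] using card_filter_add_card_filter_not (s := (univ : Finset (Fin N)))
    (fun i => k i = 0)

theorem occ_add_occ_le (k : Fin N → G) {p q : G} (hpq : p ≠ q) : occ k p + occ k q ≤ N := by
  rw [occ, occ, ← card_union_of_disjoint]
  · exact (card_le_univ _).trans_eq (Fintype.card_fin N)
  · rw [disjoint_filter]
    intro i _ h1 h2
    exact hpq (h1 ▸ h2)

theorem occ_comp_perm (k : Fin N → G) (σ : Equiv.Perm (Fin N)) (p : G) :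
    occ (k ∘ σ) p = occ k p := by
  refine card_bij (fun i _ => σ i) ?_ ?_ ?_
  · intro i hi; simpa using hi
  · intro i _ j _ h; exact σ.injective h
  · intro j hj; exact ⟨σ.symm j, by simpa using hj, by simp⟩

theorem excited_comp_perm (k : Fin N → G) (σ : Equiv.Perm (Fin N)) :
    excited (k ∘ σ) = excited k := by
  have h1 := occ_zero_add_excited k
  have h2 := occ_zero_add_excited (k ∘ σ)
  rw [occ_comp_perm] at h2
  omega

theorem occ_update_self (k : Fin N → G) (i : Fin N) {p q : G} (hq : k i = q) (hpq : q ≠ p) :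
    occ (update k i p) p = occ k p + 1 := by
  have : (univ.filter fun j => update k i p j = p) = insert i (univ.filter fun j => k j = p) := by
    ext j
    by_cases h : j = i
    · subst h; simp
    · simp [h]
  rw [occ, this, card_insert_of_notMem, occ]
  simp [hq, hpq]

theorem occ_update_old (k : Fin N → G) (i : Fin N) {p q : G} (hq : k i = q) (hpq : q ≠ p) :
    occ (update k i p) q + 1 = occ k q := by
  have h := occ_update_self (update k i p) i (p := q) (q := p) (by simp) hpq.symm
  rw [update_idem, ← hq, update_eq_self] at h
  rw [← hq, h]

theorem occ_update_of_ne (k : Fin N → G) (i : Fin N) {p q r : G} (hq : k i = q) (hr : r ≠ q)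
    (hr' : r ≠ p) : occ (update k i p) r = occ k r := by
  unfold occ
  congr 1
  ext j
  by_cases h : j = i
  · subst h; simp [hq, hr.symm, hr'.symm]
  · simp [h]

theorem excited_update_of_ne (k : Fin N → G) (i : Fin N) {p : G} (hi : k i ≠ 0) (hp : p ≠ 0) :
    excited (update k i p) = excited k := by
  have h1 := occ_zero_add_excited k
  have h2 := occ_zero_add_excited (update k i p)
  rw [occ_update_of_ne k i rfl hi.symm hp.symm] at h2
  omega

theorem excited_update_from_zero (k : Fin N → G) (i : Fin N) {p : G} (hi : k i = 0) (hp : p ≠ 0) :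
    excited (update k i p) = excited k + 1 := by
  have h1 := occ_zero_add_excited k
  have h2 := occ_zero_add_excited (update k i p)
  have h3 := occ_update_old k i hi hp.symm
  omega

theorem excited_update_to_zero (k : Fin N → G) (i : Fin N) (hi : k i ≠ 0) :
    excited (update k i 0) + 1 = excited k := by
  have h1 := occ_zero_add_excited k
  have h2 := occ_zero_add_excited (update k i 0)
  have h3 := occ_update_self k i rfl hi
  omega

theorem excited_eq_sum_occ {Λ : Finset G} {k : Fin N → G} (hk : k ∈ box N Λ) :
    excited k = ∑ p ∈ Λ.erase 0, occ k p := by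
  unfold excited occ
  rw [card_eq_sum_card_fiberwise (f := k) (t := Λ.erase 0)]
  · refine sum_congr rfl fun p hp => ?_
    rw [filter_filter]
    congr 1
    ext i
    have := ne_of_mem_erase hp
    simp only [mem_filter, mem_univ, true_and]
    constructor
    · exact fun h => h.2
    · intro h; exact ⟨by rw [h]; exact this, h⟩
  · intro i hi
    simp only [coe_filter, mem_univ, true_and, Set.mem_ofPred_eq] at hi
    simp [hi, mem_box.1 hk i]

/-- Moving one particle is a bijection between pairs of configurations. -/
theorem sum_box_update (Λ : Finset G) (P P' : G → Prop) [DecidablePred P] [DecidablePred P']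
    (f f' : G → G)
    (h : ∀ p ∈ Λ, P p → f p ∈ Λ ∧ P' (f p) ∧ f' (f p) = p)
    (h' : ∀ p ∈ Λ, P' p → f' p ∈ Λ ∧ P (f' p) ∧ f (f' p) = p)
    (F : (Fin N → G) → (Fin N → G) → ℝ) :
    ∑ k ∈ box N Λ, ∑ i with P (k i), F k (update k i (f (k i))) =
      ∑ k ∈ box N Λ, ∑ i with P' (k i), F (update k i (f' (k i))) k := by
  simp only [sum_filter]
  rw [sum_comm, sum_comm (s := box N Λ)]
  refine sum_congr rfl fun i _ => ?_
  rw [← sum_filter, ← sum_filter]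
  refine sum_nbij' (fun k => update k i (f (k i))) (fun k => update k i (f' (k i))) ?_ ?_ ?_ ?_ ?_
  · intro k hk
    rw [mem_filter] at hk ⊢
    obtain ⟨h1, h2, -⟩ := h _ (mem_box.1 hk.1 i) hk.2
    exact ⟨update_mem_box hk.1 i h1, by simpa using h2⟩
  · intro k hk
    rw [mem_filter] at hk ⊢
    obtain ⟨h1, h2, -⟩ := h' _ (mem_box.1 hk.1 i) hk.2
    exact ⟨update_mem_box hk.1 i h1, by simpa using h2⟩
  · intro k hk
    rw [mem_filter] at hk
    obtain ⟨-, -, h3⟩ := h _ (mem_box.1 hk.1 i) hk.2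
    simp [h3]
  · intro k hk
    rw [mem_filter] at hk
    obtain ⟨-, -, h3⟩ := h' _ (mem_box.1 hk.1 i) hk.2
    simp [h3]
  · intro k hk
    rw [mem_filter] at hk
    obtain ⟨-, -, h3⟩ := h _ (mem_box.1 hk.1 i) hk.2
    simp [h3]

theorem sum_box_hop {Λ : Finset G} {p q : G} (hp : p ∈ Λ) (hq : q ∈ Λ)
    (F : (Fin N → G) → (Fin N → G) → ℝ) :
    ∑ k ∈ box N Λ, ∑ i with k i = p, F k (update k i q) =
      ∑ k ∈ box N Λ, ∑ i with k i = q, F (update k i p) k :=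
  sum_box_update Λ (· = p) (· = q) (fun _ => q) (fun _ => p) (by rintro _ _ rfl; simp [hq])
    (by rintro _ _ rfl; simp [hp]) F

/-- The transposition of `i` and `j` maps one updated configuration to the other, because both
particles start in the same mode. -/
theorem IsSymm.update_eq {E : Type} {c : (Fin N → G) → E} (hc : IsSymm c) {k : Fin N → G}
    {i j : Fin N} (h : k i = k j) (q : G) : c (update k i q) = c (update k j q) := by
  rw [← hc (Equiv.swap i j) (update k j q)]
  congr 1
  ext l
  simp only [comp_apply]
  by_cases hi : l = i
  · subst hi; simp
  by_cases hj : l = j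
  · subst hj
    rw [Equiv.swap_apply_right]
    by_cases hij : l = i
    · exact absurd hij hi
    · simp [hi, Ne.symm hi, h]
  · rw [Equiv.swap_apply_of_ne_of_ne hi hj]; simp [hi, hj]

/-- By symmetry all `occ k p` summands of the hop coincide, so Cauchy–Schwarz is an equality here.
-/
theorem hop_sq {c : (Fin N → G) → ℝ} (hc : IsSymm c) (p q : G) (k : Fin N → G) :
    hop p q c k ^ 2 = ∑ i with k i = p, (occ k p : ℝ) * c (update k i q) ^ 2 := by
  unfold hop occ
  rcases (univ.filter fun i => k i = p).eq_empty_or_nonempty with h | ⟨j, hj⟩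
  · simp [h]
  · have hj' : k j = p := by simpa using hj
    have e : ∀ i ∈ univ.filter (fun i => k i = p), c (update k i q) = c (update k j q) := by
      intro i hi
      exact hc.update_eq (by rw [hj']; simpa using hi) q
    have e' : ∀ i ∈ univ.filter (fun i => k i = p),
        ((#{i | k i = p} : ℕ) : ℝ) * c (update k i q) ^ 2 =
          (#{i | k i = p} : ℕ) * c (update k j q) ^ 2 := fun i hi => by rw [e i hi]
    rw [sum_congr rfl e, sum_congr rfl e']
    simp only [sum_const, nsmul_eq_mul]
    ring

/-- `‖a_p^* a_q c‖² = ⟨c, n_q (n_p + 1) c⟩`. -/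
theorem sum_hop_sq {Λ : Finset G} {p q : G} (hp : p ∈ Λ) (hq : q ∈ Λ) (hpq : p ≠ q)
    {c : (Fin N → G) → ℝ} (hc : IsSymm c) :
    ∑ k ∈ box N Λ, hop p q c k ^ 2 =
      ∑ k ∈ box N Λ, (occ k q : ℝ) * (occ k p + 1) * c k ^ 2 := by
  simp only [hop_sq hc]
  rw [sum_box_hop hp hq fun k k' => (occ k p : ℝ) * c k' ^ 2]
  refine sum_congr rfl fun k _ => ?_
  have : ∀ i ∈ univ.filter (fun i => k i = q),
      (occ (update k i p) p : ℝ) * c k ^ 2 = ((occ k p : ℝ) + 1) * c k ^ 2 := by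
    intro i hi
    rw [occ_update_self k i (by simpa using hi) hpq.symm]
    push_cast; ring
  rw [sum_congr rfl this, sum_const, nsmul_eq_mul, ← occ]
  ring

/-- The moved particle came from the zero mode, went to the zero mode, or did neither. The first two
cases carry the Bogoliubov Hamiltonian; the third is an error term. -/
theorem trans_eq {p : G} (hp : p ≠ 0) (c : (Fin N → G) → ℝ) (k : Fin N → G) :
    trans p c k = hop p 0 c k + hop 0 (-p) c k + transExc p c k := by
  unfold trans hop transExc
  rw [sum_filter, sum_filter, sum_filter, ← sum_add_distrib, ← sum_add_distrib]
  refine sum_congr rfl fun i _ => ?_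
  by_cases h0 : k i = 0
  · simp [h0, hp.symm]
  · by_cases h1 : k i = p
    · simp [h1, hp]
    · simp [h0, h1]

/-- Cauchy–Schwarz over at most `excited k` summands yields one factor `excited`, which the move
preserves. Undoing the move in the sum over configurations hits each configuration at most `excited`
times, which is the second factor. -/
theorem sum_transExc_sq_le {Λ : Finset G} {p : G} {c : (Fin N → G) → ℝ}
    (hs : ∀ k, k ∉ box N Λ → c k = 0) :
    ∑ k ∈ box N Λ, transExc p c k ^ 2 ≤ ∑ k ∈ box N Λ, (excited k : ℝ) ^ 2 * c k ^ 2 := by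
  classical
  have h1 : ∀ k ∈ box N Λ, transExc p c k ^ 2 ≤
      ∑ i with k i ≠ 0 ∧ k i ≠ p ∧ k i - p ∈ Λ,
        (excited (update k i (k i - p)) : ℝ) * c (update k i (k i - p)) ^ 2 := by
    intro k hk
    -- Moves that leave the box are discarded, since `c` vanishes there; the remaining ones are
    -- invertible inside the box.
    have e1 : transExc p c k =
        ∑ i with k i ≠ 0 ∧ k i ≠ p ∧ k i - p ∈ Λ, c (update k i (k i - p)) := by
      unfold transExc
      symm
      refine sum_subset ?_ ?_
      · intro i; simp; tauto
      · intro i hi hi'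
        simp only [mem_filter, mem_univ, true_and] at hi hi'
        apply hs
        rw [mem_box]
        intro hall
        have := hall i
        simp only [update_self] at this
        tauto
    rw [e1]
    refine (sq_sum_le_card_mul_sum_sq).trans ?_
    rw [mul_sum]
    refine sum_le_sum fun i hi => ?_
    simp only [mem_filter, mem_univ, true_and] at hi
    rw [excited_update_of_ne k i hi.1 (sub_ne_zero.2 hi.2.1)]
    refine mul_le_mul_of_nonneg_right ?_ (sq_nonneg _)
    norm_cast
    refine card_le_card fun j => ?_
    simp; tauto
  refine (sum_le_sum h1).trans ?_
  rw [sum_box_update Λ (fun q => q ≠ 0 ∧ q ≠ p ∧ q - p ∈ Λ) (fun q => q ≠ 0 ∧ q + p ≠ 0 ∧ q + p ∈ Λ)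
    (fun q => q - p) (fun q => q + p) ?_ ?_ fun k k' => (excited k' : ℝ) * c k' ^ 2]
  · refine sum_le_sum fun k _ => ?_
    rw [sum_const, nsmul_eq_mul, sq (excited k : ℝ), mul_assoc]
    refine mul_le_mul_of_nonneg_right ?_ (by positivity)
    norm_cast
    refine card_le_card fun j => ?_
    simp; tauto
  · rintro q hq ⟨h1, h2, h3⟩
    exact ⟨h3, ⟨sub_ne_zero.2 h2, by simpa, by simpa⟩, by simp⟩
  · rintro q hq ⟨h1, h2, h3⟩
    exact ⟨h3, ⟨h2, by simpa, by simpa⟩, by simp⟩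

/-- `⟨a_p^* a_0 a, a_0^* a_{-p} b⟩` as a sum over pairs of particles that leave the zero mode. -/
theorem sum_hop_mul_hop {Λ : Finset G} {p : G} (hp : p ∈ Λ) (h0 : (0 : G) ∈ Λ) (hp0 : p ≠ 0)
    (a b : (Fin N → G) → ℝ) :
    ∑ k ∈ box N Λ, hop p 0 a k * hop 0 (-p) b k =
      ∑ k ∈ box N Λ, ∑ i with k i = 0, ∑ j with k j = 0 ∧ j ≠ i,
        a k * b (update (update k i p) j (-p)) := by
  have e : ∀ k : Fin N → G, hop p 0 a k * hop 0 (-p) b k =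
      ∑ i with k i = p, a (update k i 0) * hop 0 (-p) b k := by
    intro k; rw [hop, sum_mul]
  simp only [e]
  rw [sum_box_hop hp h0 fun k k' => a k' * hop 0 (-p) b k]
  refine sum_congr rfl fun k _ => sum_congr rfl fun i hi => ?_
  rw [hop, mul_sum]
  have hi' : k i = 0 := by simpa using hi
  refine sum_congr ?_ fun _ _ => rfl
  ext j
  by_cases h : j = i
  · subst h; simp [hp0]
  · simp [h]

/-- Counting the pairs of particles in the modes `p`, `-p` by the configurations from which they
arise by pair creation. -/
theorem sum_occ_mul_occ {Λ : Finset G} {p : G} (hp : p ∈ Λ) (hp' : -p ∈ Λ) (h0 : (0 : G) ∈ Λ)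
    (hp0 : p ≠ 0) (hpp : p ≠ -p) (b : (Fin N → G) → ℝ) :
    ∑ k ∈ box N Λ, (occ k p : ℝ) * occ k (-p) * b k =
      ∑ k ∈ box N Λ, ∑ i with k i = 0, ∑ j with k j = 0 ∧ j ≠ i,
        b (update (update k i p) j (-p)) := by
  have h := sum_hop_mul_hop hp h0 hp0 (fun _ => 1) b
  simp only [one_mul] at h
  rw [← h]
  have e : ∀ k : Fin N → G, hop p 0 (fun _ => 1) k * hop 0 (-p) b k =
      ∑ i with k i = 0, (occ k p : ℝ) * b (update k i (-p)) := by
    intro k; simp [hop, occ, mul_sum]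
  simp only [e]
  rw [sum_box_hop h0 hp' fun k k' => (occ k p : ℝ) * b k']
  refine sum_congr rfl fun k _ => ?_
  have : ∀ i ∈ univ.filter (fun i => k i = -p),
      (occ (update k i 0) p : ℝ) * b k = (occ k p : ℝ) * b k := by
    intro i hi
    rw [occ_update_of_ne k i (by simpa using hi) hpp hp0]
  rw [sum_congr rfl this, sum_const, nsmul_eq_mul, ← occ]
  ring

/-- Written as a sum over ordered pairs of particles that leave the zero mode, exchanging `p` with
`-p` amounts to exchanging the two particles. -/
theorem sum_hop_mul_hop_neg {Λ : Finset G} {p : G} (hp : p ∈ Λ) (hp' : -p ∈ Λ) (h0 : (0 : G) ∈ Λ)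
    (hp0 : p ≠ 0) (c : (Fin N → G) → ℝ) :
    ∑ k ∈ box N Λ, hop (-p) 0 c k * hop 0 p c k =
      ∑ k ∈ box N Λ, hop p 0 c k * hop 0 (-p) c k := by
  have h := sum_hop_mul_hop hp' h0 (neg_ne_zero.2 hp0) c c
  rw [neg_neg] at h
  rw [h, sum_hop_mul_hop hp h0 hp0]
  refine sum_congr rfl fun k _ => ?_
  simp only [sum_filter]
  have : ∀ (a b : G), ∑ i, (if k i = 0 then ∑ j, if k j = 0 ∧ j ≠ i then
      c k * c (update (update k i a) j b) else 0 else 0) =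
      ∑ i, ∑ j, if k i = 0 ∧ k j = 0 ∧ j ≠ i then c k * c (update (update k i a) j b) else 0 := by
    intro a b
    refine sum_congr rfl fun i _ => ?_
    by_cases hi : k i = 0 <;> simp [hi]
  rw [this, this, sum_comm]
  refine sum_congr rfl fun i _ => sum_congr rfl fun j _ => ?_
  by_cases hij : i = j
  · simp [hij]
  · rw [update_comm (Ne.symm hij)]
    congr 1
    simp only [eq_iff_iff, ne_eq]
    tauto

end Configurations

end BoseGas

namespace BoseGas
open Finset Function

set_option linter.unusedSectionVars false

/-! ### Expectation values and the quadratic form of one pair of modes. -/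

section Forms

variable {G : Type} [AddCommGroup G] [DecidableEq G] {N : ℕ}

/-- The expectation `⟨c, f c⟩` of the diagonal operator `f`. -/
def ev (Λ : Finset G) (f c : (Fin N → G) → ℝ) : ℝ := ∑ k ∈ box N Λ, f k * c k ^ 2

/-- The pair creation expectation `⟨a_p^* a_0 c, a_0^* a_{-p} c⟩`. -/
def pairing (Λ : Finset G) (p : G) (c : (Fin N → G) → ℝ) : ℝ :=
  ∑ k ∈ box N Λ, hop p 0 c k * hop 0 (-p) c k

/-- The kinetic energy of a configuration for the one-particle energies `t`. -/
def kin (t : G → ℝ) (k : Fin N → G) : ℝ := ∑ i, t (k i)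

/-- The Bogoliubov dispersion relation. -/
noncomputable def dispersion (t u : G → ℝ) (p : G) : ℝ := √(t p ^ 2 + 2 * t p * u p)

theorem ev_mono {Λ : Finset G} {f g : (Fin N → G) → ℝ} (h : ∀ k ∈ box N Λ, f k ≤ g k)
    (c : (Fin N → G) → ℝ) : ev Λ f c ≤ ev Λ g c :=
  sum_le_sum fun k hk => mul_le_mul_of_nonneg_right (h k hk) (sq_nonneg _)

theorem ev_congr {Λ : Finset G} {f g : (Fin N → G) → ℝ} (h : ∀ k ∈ box N Λ, f k = g k)
    (c : (Fin N → G) → ℝ) : ev Λ f c = ev Λ g c :=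
  sum_congr rfl fun k hk => by rw [h k hk]

theorem ev_nonneg {Λ : Finset G} {f : (Fin N → G) → ℝ} (h : ∀ k ∈ box N Λ, 0 ≤ f k)
    (c : (Fin N → G) → ℝ) : 0 ≤ ev Λ f c :=
  sum_nonneg fun k hk => mul_nonneg (h k hk) (sq_nonneg _)

theorem ev_add (Λ : Finset G) (f g c : (Fin N → G) → ℝ) :
    ev Λ (fun k => f k + g k) c = ev Λ f c + ev Λ g c := by
  simp only [ev, add_mul, sum_add_distrib]

theorem ev_sub (Λ : Finset G) (f g c : (Fin N → G) → ℝ) :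
    ev Λ (fun k => f k - g k) c = ev Λ f c - ev Λ g c := by
  simp only [ev, sub_mul, sum_sub_distrib]

theorem ev_smul (Λ : Finset G) (a : ℝ) (f c : (Fin N → G) → ℝ) :
    ev Λ (fun k => a * f k) c = a * ev Λ f c := by
  simp only [ev, mul_sum, mul_assoc]

theorem ev_const (Λ : Finset G) (a : ℝ) (c : (Fin N → G) → ℝ) :
    ev Λ (fun _ => a) c = a * ev Λ (fun _ => 1) c := by
  simp only [ev, mul_sum, one_mul]

theorem ev_sum {ι : Type} (Λ : Finset G) (s : Finset ι) (f : ι → (Fin N → G) → ℝ)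
    (c : (Fin N → G) → ℝ) :
    ev Λ (fun k => ∑ p ∈ s, f p k) c = ∑ p ∈ s, ev Λ (f p) c := by
  simp only [ev, sum_mul]
  rw [sum_comm]

theorem sum_comp_eq_sum_occ {Λ : Finset G} {k : Fin N → G} (hk : k ∈ box N Λ) (f : G → ℝ) :
    ∑ i, f (k i) = ∑ p ∈ Λ, f p * occ k p := by
  rw [← sum_fiberwise_of_maps_to (s := univ) (t := Λ) (g := k) fun i _ => mem_box.1 hk i]
  refine sum_congr rfl fun p _ => ?_
  rw [sum_congr rfl (g := fun _ => f p) (by intro i hi; rw [(mem_filter.1 hi).2]), sum_const,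
    nsmul_eq_mul, occ, mul_comm]

theorem kin_eq {Λ : Finset G} {k : Fin N → G} (hk : k ∈ box N Λ) {t : G → ℝ} (ht : t 0 = 0) :
    kin t k = ∑ p ∈ Λ.erase 0, t p * occ k p := by
  rw [kin, sum_comp_eq_sum_occ hk, sum_erase _ (by simp [ht])]

theorem excited_le_kin {k : Fin N → G} {t : G → ℝ} (ht : t 0 = 0) (ht1 : ∀ p, p ≠ 0 → 1 ≤ t p) :
    (excited k : ℝ) ≤ kin t k := by
  rw [excited, card_eq_sum_ones, sum_filter, kin]
  push_cast
  refine sum_le_sum fun i _ => ?_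
  by_cases h : k i = 0
  · simp [h, ht]
  · simpa [h] using ht1 _ h

theorem occ_le_excited {k : Fin N → G} {p : G} (hp : p ≠ 0) : occ k p ≤ excited k :=
  card_le_card fun i hi => by
    simp only [mem_filter, mem_univ, true_and] at hi ⊢
    rwa [hi]

theorem excited_le (k : Fin N → G) : excited k ≤ N := by
  have := occ_zero_add_excited k; omega

theorem mul_occ_zero_add_one_le (k : Fin N → G) {p : G} (hp : p ≠ 0) :
    (occ k p : ℝ) * (occ k 0 + 1) ≤ N * occ k p := by
  have h := occ_add_occ_le k hp
  rcases Nat.eq_zero_or_pos (occ k p) with h0 | h0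
  · simp [h0]
  · have : (occ k 0 : ℝ) + 1 ≤ N := by norm_cast; omega
    nlinarith [(Nat.cast_nonneg (occ k p) : (0 : ℝ) ≤ _)]

theorem occ_zero_mul_le (k : Fin N → G) (p : G) :
    (occ k 0 : ℝ) * (occ k p + 1) ≤ N * (occ k p + 1) := by
  have h : (occ k 0 : ℝ) ≤ N := by
    have := occ_zero_add_excited k
    exact_mod_cast (by omega : occ k 0 ≤ N)
  exact mul_le_mul_of_nonneg_right h (by positivity)

theorem sum_create_sq {Λ : Finset G} {p : G} (hp : p ∈ Λ) (h0 : (0 : G) ∈ Λ) (hp0 : p ≠ 0)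
    {c : (Fin N → G) → ℝ} (hc : IsSymm c) :
    ∑ k ∈ box N Λ, hop p 0 c k ^ 2 = ev Λ (fun k => (occ k 0 : ℝ) * (occ k p + 1)) c :=
  sum_hop_sq hp h0 hp0 hc

theorem sum_annihilate_sq {Λ : Finset G} {p : G} (hp : p ∈ Λ) (h0 : (0 : G) ∈ Λ) (hp0 : p ≠ 0)
    {c : (Fin N → G) → ℝ} (hc : IsSymm c) :
    ∑ k ∈ box N Λ, hop 0 p c k ^ 2 = ev Λ (fun k => (occ k p : ℝ) * (occ k 0 + 1)) c :=
  sum_hop_sq h0 hp hp0.symm hc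

/-- Expand ‖(a_0^* a_{-p} + α a_p^* a_0) c‖² ≥ 0. The diagonal terms are n_{-p}(n_0 + 1) ≤ N n_{-p}
and n_0(n_p + 1) ≤ N(n_p + 1). -/
theorem neg_le_pairing {Λ : Finset G} {p : G} (hp : p ∈ Λ) (hp' : -p ∈ Λ) (h0 : (0 : G) ∈ Λ)
    (hp0 : p ≠ 0) {c : (Fin N → G) → ℝ} (hc : IsSymm c) (α : ℝ) :
    -(N * (ev Λ (fun k => (occ k (-p) : ℝ)) c + α ^ 2 * ev Λ (fun k => (occ k p : ℝ) + 1) c)) ≤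
      2 * α * pairing Λ p c := by
  have h : 0 ≤ ∑ k ∈ box N Λ, (hop 0 (-p) c k + α * hop p 0 c k) ^ 2 :=
    sum_nonneg fun _ _ => sq_nonneg _
  have e : ∑ k ∈ box N Λ, (hop 0 (-p) c k + α * hop p 0 c k) ^ 2 =
      ∑ k ∈ box N Λ, hop 0 (-p) c k ^ 2 + α ^ 2 * ∑ k ∈ box N Λ, hop p 0 c k ^ 2
        + 2 * α * pairing Λ p c := by
    rw [pairing, mul_sum, mul_sum, ← sum_add_distrib, ← sum_add_distrib]
    exact sum_congr rfl fun _ _ => by ring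
  rw [e, sum_annihilate_sq hp' h0 (neg_ne_zero.2 hp0) hc, sum_create_sq hp h0 hp0 hc] at h
  have h1 : ev Λ (fun k => (occ k (-p) : ℝ) * (occ k 0 + 1)) c ≤
      N * ev Λ (fun k => (occ k (-p) : ℝ)) c := by
    rw [← ev_smul]
    exact ev_mono (fun k _ => mul_occ_zero_add_one_le k (neg_ne_zero.2 hp0)) c
  have h2 : ev Λ (fun k => (occ k 0 : ℝ) * (occ k p + 1)) c ≤
      N * ev Λ (fun k => (occ k p : ℝ) + 1) c := by
    rw [← ev_smul]
    exact ev_mono (fun k _ => occ_zero_mul_le k p) c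
  nlinarith [mul_le_mul_of_nonneg_left h2 (sq_nonneg α)]

/-- Take α = (a - e)/b in the completed square and multiply by a + e: since (a + e)(a - e) = b², the
factor (a + e)α becomes b and (a + e)α² becomes a - e. For b = 0 only a sign is claimed. -/
theorem neg_le_mul_pairing {Λ : Finset G} {p : G} (hp : p ∈ Λ) (hp' : -p ∈ Λ) (h0 : (0 : G) ∈ Λ)
    (hp0 : p ≠ 0) {c : (Fin N → G) → ℝ} (hc : IsSymm c) {a b e : ℝ} (hb : 0 ≤ b) (he : 0 ≤ e)
    (hea : e ≤ a) (h : a ^ 2 - e ^ 2 = b ^ 2) :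
    -(N * ((a + e) * ev Λ (fun k => (occ k (-p) : ℝ)) c
        + (a - e) * ev Λ (fun k => (occ k p : ℝ) + 1) c)) ≤ 2 * b * pairing Λ p c := by
  rcases hb.eq_or_lt with rfl | hb
  · have h1 : 0 ≤ ev Λ (fun k => (occ k (-p) : ℝ)) c := ev_nonneg (fun k _ => by positivity) c
    have h2 : 0 ≤ ev Λ (fun k => (occ k p : ℝ) + 1) c := ev_nonneg (fun k _ => by positivity) c
    have : 0 ≤ (N : ℝ) * ((a + e) * ev Λ (fun k => (occ k (-p) : ℝ)) c
        + (a - e) * ev Λ (fun k => (occ k p : ℝ) + 1) c) :=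
      mul_nonneg (by positivity)
        (add_nonneg (mul_nonneg (by linarith) h1) (mul_nonneg (by linarith) h2))
    linarith
  · have h1 := mul_le_mul_of_nonneg_left (neg_le_pairing hp hp' h0 hp0 hc ((a - e) / b))
      (by linarith : 0 ≤ a + e)
    have e1 : (a + e) * ((a - e) / b) = b := by
      field_simp; linarith
    have e2 : (a + e) * ((a - e) / b) ^ 2 = a - e := by
      rw [sq, ← mul_assoc, e1]; field_simp
    calc _ = (a + e) * -(N * (ev Λ (fun k => (occ k (-p) : ℝ)) c
          + ((a - e) / b) ^ 2 * ev Λ (fun k => (occ k p : ℝ) + 1) c)) := by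
            linear_combination (N * ev Λ (fun k => (occ k p : ℝ) + 1) c) * e2
      _ ≤ _ := h1
      _ = _ := by linear_combination (2 * pairing Λ p c) * e1

theorem occ_sub_of_create {k : Fin N → G} {i : Fin N} {p : G} (hp0 : p ≠ 0) (hpp : p ≠ -p)
    (h : k i = p) :
    (occ (update k i 0) p : ℤ) - occ (update k i 0) (-p) = occ k p - occ k (-p) - 1 := by
  have h1 := occ_update_old k i h hp0
  have h2 := occ_update_of_ne k i h hpp.symm (neg_ne_zero.2 hp0)
  omega

theorem occ_sub_of_annihilate {k : Fin N → G} {i : Fin N} {p : G} (hp0 : p ≠ 0) (hpp : p ≠ -p)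
    (h : k i = 0) :
    (occ (update k i (-p)) p : ℤ) - occ (update k i (-p)) (-p) = occ k p - occ k (-p) - 1 := by
  have h1 := occ_update_self k i h (neg_ne_zero.2 hp0).symm
  have h2 := occ_update_of_ne k i h hp0 hpp
  omega

/-- Both factors evaluate `c` at configurations whose imbalance n_p - n_{-p} is that of `k` minus
one. Hence the two signs of the imbalance do not mix. -/
theorem pairing_split {Λ : Finset G} {p : G} (hp0 : p ≠ 0) (hpp : p ≠ -p)
    (c : (Fin N → G) → ℝ) :
    pairing Λ p c = pairing Λ p (fun k => if occ k (-p) ≤ occ k p then c k else 0)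
      + pairing Λ p (fun k => if occ k (-p) ≤ occ k p then 0 else c k) := by
  unfold pairing
  rw [← sum_add_distrib]
  refine sum_congr rfl fun k _ => ?_
  by_cases hk : (occ k p : ℤ) - occ k (-p) - 1 < 0
  · have h1 : ∀ i, k i = p → ¬ occ (update k i 0) (-p) ≤ occ (update k i 0) p := by
      intro i hi; have := occ_sub_of_create hp0 hpp hi; omega
    have h2 : ∀ i, k i = 0 → ¬ occ (update k i (-p)) (-p) ≤ occ (update k i (-p)) p := by
      intro i hi; have := occ_sub_of_annihilate hp0 hpp hi; omega
    simp only [hop]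
    rw [sum_congr (s₁ := univ.filter fun i => k i = p) rfl fun i hi => if_neg (h1 i (by simpa using hi)),
      sum_congr (s₁ := univ.filter fun i => k i = p) rfl fun i hi => if_neg (h1 i (by simpa using hi)),
      sum_congr (s₁ := univ.filter fun i => k i = 0) rfl fun i hi => if_neg (h2 i (by simpa using hi)),
      sum_congr (s₁ := univ.filter fun i => k i = 0) rfl fun i hi => if_neg (h2 i (by simpa using hi))]
    simp
  · have h1 : ∀ i, k i = p → occ (update k i 0) (-p) ≤ occ (update k i 0) p := by
      intro i hi; have := occ_sub_of_create hp0 hpp hi; omega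
    have h2 : ∀ i, k i = 0 → occ (update k i (-p)) (-p) ≤ occ (update k i (-p)) p := by
      intro i hi; have := occ_sub_of_annihilate hp0 hpp hi; omega
    simp only [hop]
    rw [sum_congr (s₁ := univ.filter fun i => k i = p) rfl fun i hi => if_pos (h1 i (by simpa using hi)),
      sum_congr (s₁ := univ.filter fun i => k i = p) rfl fun i hi => if_pos (h1 i (by simpa using hi)),
      sum_congr (s₁ := univ.filter fun i => k i = 0) rfl fun i hi => if_pos (h2 i (by simpa using hi)),
      sum_congr (s₁ := univ.filter fun i => k i = 0) rfl fun i hi => if_pos (h2 i (by simpa using hi))]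
    simp

/-- The contribution of one pair of modes `±p` to the Bogoliubov Hamiltonian is bounded below by
the energy of `|n_p - n_{-p}|` quasi-particles. -/
theorem neg_ev_le_pairing {Λ : Finset G} {p : G} (hp : p ∈ Λ) (hp' : -p ∈ Λ) (h0 : (0 : G) ∈ Λ)
    (hp0 : p ≠ 0) (hpp : p ≠ -p) {c : (Fin N → G) → ℝ} (hc : IsSymm c) {a b e : ℝ} (hb : 0 ≤ b)
    (he : 0 ≤ e) (hea : e ≤ a) (h : a ^ 2 - e ^ 2 = b ^ 2) :
    -(N * ev Λ (fun k => a * (occ k p + occ k (-p)) - e * |(occ k p : ℝ) - occ k (-p)| + (a - e)) c)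
      ≤ 2 * b * pairing Λ p c := by
  -- The completed square weighs n_{-p} with a + e and n_p with a - e, so it is efficient where `p`
  -- is the more occupied mode. Using it for `p` on `c₁` and for `-p` on `c₂` produces -e |n_p -
  -- n_{-p}|.
  set c₁ : (Fin N → G) → ℝ := fun k => if occ k (-p) ≤ occ k p then c k else 0 with hc₁
  set c₂ : (Fin N → G) → ℝ := fun k => if occ k (-p) ≤ occ k p then 0 else c k with hc₂
  have s1 : IsSymm c₁ := fun σ k => by simp only [hc₁, occ_comp_perm, hc σ k]
  have s2 : IsSymm c₂ := fun σ k => by simp only [hc₂, occ_comp_perm, hc σ k]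
  have k1 := neg_le_mul_pairing hp hp' h0 hp0 s1 hb he hea h
  have k2 := neg_le_mul_pairing hp' (by simpa using hp) h0 (neg_ne_zero.2 hp0) s2 hb he hea h
  have k3 : pairing Λ (-p) c₂ = pairing Λ p c₂ := by
    unfold pairing
    rw [neg_neg, sum_hop_mul_hop_neg hp hp' h0 hp0]
  rw [k3, neg_neg] at k2
  rw [pairing_split hp0 hpp c]
  have k4 : ev Λ (fun k => a * (occ k p + occ k (-p)) - e * |(occ k p : ℝ) - occ k (-p)|
      + (a - e)) c = ((a + e) * ev Λ (fun k => (occ k (-p) : ℝ)) c₁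
        + (a - e) * ev Λ (fun k => (occ k p : ℝ) + 1) c₁)
      + ((a + e) * ev Λ (fun k => (occ k p : ℝ)) c₂
        + (a - e) * ev Λ (fun k => (occ k (-p) : ℝ) + 1) c₂) := by
    simp only [← ev_smul, ← ev_add]
    unfold ev
    rw [← sum_add_distrib]
    refine sum_congr rfl fun k _ => ?_
    beta_reduce
    by_cases hk : occ k (-p) ≤ occ k p
    · have : (occ k (-p) : ℝ) ≤ occ k p := by exact_mod_cast hk
      rw [abs_of_nonneg (by linarith)]
      simp only [hc₁, hc₂, if_pos hk]
      ring
    · have : (occ k p : ℝ) ≤ occ k (-p) := by exact_mod_cast (not_le.1 hk).le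
      rw [abs_of_nonpos (by linarith)]
      simp only [hc₁, hc₂, if_neg hk]
      ring
  rw [k4]
  linarith

theorem dispersion_nonneg (t u : G → ℝ) (p : G) : 0 ≤ dispersion t u p := Real.sqrt_nonneg _

theorem dispersion_sq {t u : G → ℝ} {p : G} (ht : 0 ≤ t p) (hu : 0 ≤ u p) :
    dispersion t u p ^ 2 = t p ^ 2 + 2 * t p * u p :=
  Real.sq_sqrt (by positivity)

theorem dispersion_le {t u : G → ℝ} {p : G} (ht : 0 ≤ t p) (hu : 0 ≤ u p) :
    dispersion t u p ≤ t p + u p := by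
  refine Real.sqrt_le_iff.2 ⟨by positivity, ?_⟩
  nlinarith

theorem le_dispersion {t u : G → ℝ} {p : G} (ht : 0 ≤ t p) (hu : 0 ≤ u p) :
    t p ≤ dispersion t u p :=
  Real.le_sqrt_of_sq_le (by nlinarith [mul_nonneg ht hu])

end Forms

end BoseGas

namespace BoseGas
open Finset Function

set_option linter.unusedSectionVars false

/-! ### Lower bound on the truncated energy in terms of moments of n₊. -/

section LowerBound

variable {G : Type} [AddCommGroup G] [DecidableEq G] {N : ℕ}

/-- The energy form of the configurations in the box, without the constant terms. -/
noncomputable def lowForm (t u : G → ℝ) (Λ : Finset G) (c : (Fin N → G) → ℝ) : ℝ :=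
  ev Λ (kin t) c +
    (2 * ((N : ℝ) - 1))⁻¹ * ∑ p ∈ Λ.erase 0, u p * ∑ k ∈ box N Λ, trans p c k ^ 2

theorem weight_bounds (hN : 2 ≤ N) : 0 < (2 * ((N : ℝ) - 1))⁻¹ ∧
    (2 * ((N : ℝ) - 1))⁻¹ ≤ 1 / N ∧ (2 * ((N : ℝ) - 1))⁻¹ * N = 1 / 2 + (2 * ((N : ℝ) - 1))⁻¹ ∧
    (2 * ((N : ℝ) - 1))⁻¹ * N ≤ 1 := by
  have h : (2 : ℝ) ≤ N := by exact_mod_cast hN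
  have h1 : 0 < (N : ℝ) - 1 := by linarith
  have hw : (2 * ((N : ℝ) - 1))⁻¹ ≤ 1 / N := by
    rw [inv_eq_one_div]
    exact one_div_le_one_div_of_le (by linarith) (by linarith)
  refine ⟨by positivity, hw, by field_simp; ring, ?_⟩
  calc (2 * ((N : ℝ) - 1))⁻¹ * N ≤ 1 / N * N := by gcongr
    _ = 1 := by field_simp

theorem sum_create_add_annihilate_le {Λ : Finset G} {p : G} (hp : p ∈ Λ) (hp' : -p ∈ Λ)
    (h0 : (0 : G) ∈ Λ) (hp0 : p ≠ 0) {c : (Fin N → G) → ℝ} (hc : IsSymm c) :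
    ∑ k ∈ box N Λ, hop p 0 c k ^ 2 + ∑ k ∈ box N Λ, hop 0 (-p) c k ^ 2 ≤
      N * (ev Λ (fun k => (occ k p : ℝ) + occ k (-p)) c + ev Λ (fun _ => 1) c) := by
  rw [sum_create_sq hp h0 hp0 hc, sum_annihilate_sq hp' h0 (neg_ne_zero.2 hp0) hc, ← ev_add,
    ← ev_add, ← ev_smul]
  refine ev_mono (fun k _ => ?_) c
  have h1 := mul_occ_zero_add_one_le k (neg_ne_zero.2 hp0)
  have h2 := occ_zero_mul_le k p
  linarith

theorem sum_occ_add_occ_neg {Λ : Finset G} (hneg : ∀ p ∈ Λ, -p ∈ Λ) {f : G → ℝ}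
    (hf : ∀ p, f (-p) = f p) (k : Fin N → G) :
    ∑ p ∈ Λ.erase 0, f p * ((occ k p : ℝ) + occ k (-p)) =
      2 * ∑ p ∈ Λ.erase 0, f p * (occ k p : ℝ) := by
  have : ∑ p ∈ Λ.erase 0, f p * (occ k (-p) : ℝ) = ∑ p ∈ Λ.erase 0, f p * (occ k p : ℝ) := by
    refine sum_nbij' (fun p => -p) (fun p => -p) ?_ ?_ ?_ ?_ ?_
    · intro p hp
      rw [mem_erase] at hp ⊢
      exact ⟨neg_ne_zero.2 hp.1, hneg p hp.2⟩
    · intro p hp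
      rw [mem_erase] at hp ⊢
      exact ⟨neg_ne_zero.2 hp.1, hneg p hp.2⟩
    · intro p _; simp
    · intro p _; simp
    · intro p _; rw [hf]
  simp only [mul_add, sum_add_distrib, this]
  ring

theorem sum_ev_occ_le {Λ : Finset G} (hneg : ∀ p ∈ Λ, -p ∈ Λ) {u : G → ℝ} {U : ℝ}
    (hu0 : ∀ p, 0 ≤ u p) (hU : ∑ p ∈ Λ.erase 0, u p ≤ U) (g : (Fin N → G) → ℝ)
    (hg : ∀ k, 0 ≤ g k) (c : (Fin N → G) → ℝ) :
    ∑ p ∈ Λ.erase 0, u p * ev Λ (fun k => g k * ((occ k p : ℝ) + occ k (-p))) c ≤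
      2 * U * ev Λ (fun k => g k * (excited k : ℝ)) c := by
  have hle : ∀ p ∈ Λ.erase 0, u p ≤ U := fun p hp =>
    (single_le_sum (f := u) (fun q _ => hu0 q) hp).trans hU
  have h1 : ∀ p ∈ Λ.erase 0, u p * ev Λ (fun k => g k * ((occ k p : ℝ) + occ k (-p))) c ≤
      U * ev Λ (fun k => g k * ((occ k p : ℝ) + occ k (-p))) c := fun p hp =>
    mul_le_mul_of_nonneg_right (hle p hp)
      (ev_nonneg (fun k _ => mul_nonneg (hg k) (by positivity)) c)
  refine (sum_le_sum h1).trans (le_of_eq ?_)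
  rw [← mul_sum, ← ev_sum, mul_comm 2 U, mul_assoc, ← ev_smul Λ 2]
  congr 1
  refine ev_congr (fun k hk => ?_) c
  rw [← mul_sum]
  have := sum_occ_add_occ_neg hneg (f := fun _ => 1) (fun _ => rfl) k
  simp only [one_mul] at this
  rw [this, excited_eq_sum_occ hk]
  push_cast
  ring

/-- The cross terms between the zero-mode part of ρ_p and `transExc` are cubic. Young's inequality
with weight `l` splits them into `l` times quadratic terms and l⁻¹⟨n₊²⟩; the weight is fixed only in
`lower_bound`. -/
theorem le_sum_trans_sq {Λ : Finset G} {p : G} (hp : p ∈ Λ) (hp' : -p ∈ Λ)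
    (h0 : (0 : G) ∈ Λ) (hp0 : p ≠ 0) {c : (Fin N → G) → ℝ} (hc : IsSymm c)
    (hs : ∀ k, k ∉ box N Λ → c k = 0) {l : ℝ} (hl : 0 < l) :
    ev Λ (fun k => (occ k 0 : ℝ) * (occ k p + 1)) c
      + ev Λ (fun k => (occ k (-p) : ℝ) * (occ k 0 + 1)) c + 2 * pairing Λ p c
      - 2 * l * N * (ev Λ (fun k => (occ k p : ℝ) + occ k (-p)) c + ev Λ (fun _ => 1) c)
      - l⁻¹ * ev Λ (fun k => (excited k : ℝ) ^ 2) c ≤ ∑ k ∈ box N Λ, trans p c k ^ 2 := by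
  have h1 : ∑ k ∈ box N Λ, (hop p 0 c k ^ 2 + hop 0 (-p) c k ^ 2
      + 2 * (hop p 0 c k * hop 0 (-p) c k) - 2 * l * (hop p 0 c k ^ 2 + hop 0 (-p) c k ^ 2)
      - l⁻¹ * transExc p c k ^ 2) ≤ ∑ k ∈ box N Λ, trans p c k ^ 2 := by
    refine sum_le_sum fun k _ => ?_
    rw [trans_eq hp0]
    set a := hop p 0 c k
    set b := hop 0 (-p) c k
    set r := transExc p c k
    have e : l * ((a + b) + l⁻¹ * r) ^ 2 = l * (a + b) ^ 2 + 2 * (a + b) * r + l⁻¹ * r ^ 2 := by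
      field_simp
      ring
    have h2 : 0 ≤ l * ((a + b) + l⁻¹ * r) ^ 2 := by positivity
    nlinarith [sq_nonneg r, mul_nonneg hl.le (sq_nonneg (a - b))]
  have h2 := sum_transExc_sq_le (p := p) hs
  have h3 := sum_create_add_annihilate_le hp hp' h0 hp0 hc
  rw [← sum_create_sq hp h0 hp0 hc, ← sum_annihilate_sq hp' h0 (neg_ne_zero.2 hp0) hc]
  simp only [sum_sub_distrib, sum_add_distrib, ← mul_sum] at h1
  have h4 := mul_le_mul_of_nonneg_left h2 (inv_pos.2 hl).le
  have h5 := mul_le_mul_of_nonneg_left h3 (by linarith : 0 ≤ 2 * l)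
  unfold pairing ev at *
  linarith

theorem sum_trans_sq_le {Λ : Finset G} {p : G} (hp : p ∈ Λ) (hp' : -p ∈ Λ)
    (h0 : (0 : G) ∈ Λ) (hp0 : p ≠ 0) {c : (Fin N → G) → ℝ} (hc : IsSymm c)
    (hs : ∀ k, k ∉ box N Λ → c k = 0) :
    ∑ k ∈ box N Λ, trans p c k ^ 2 ≤
      3 * N * (ev Λ (fun k => (occ k p : ℝ) + occ k (-p)) c + ev Λ (fun _ => 1) c)
      + 3 * ev Λ (fun k => (excited k : ℝ) ^ 2) c := by
  have h1 : ∑ k ∈ box N Λ, trans p c k ^ 2 ≤ ∑ k ∈ box N Λ, (3 * (hop p 0 c k ^ 2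
      + hop 0 (-p) c k ^ 2) + 3 * transExc p c k ^ 2) := by
    refine sum_le_sum fun k _ => ?_
    rw [trans_eq hp0]
    set a := hop p 0 c k
    set b := hop 0 (-p) c k
    set r := transExc p c k
    nlinarith [sq_nonneg (a - b), sq_nonneg (a - r), sq_nonneg (b - r)]
  have h2 := sum_transExc_sq_le (p := p) hs
  have h3 := sum_create_add_annihilate_le hp hp' h0 hp0 hc
  simp only [sum_add_distrib, ← mul_sum] at h1
  unfold ev at *
  linarith

/-- This is half of the Bogoliubov bound for the modes ±p, the other half being attributed to `-p`.
With a = t + u and b = u the condition a² - e² = b² is the dispersion relation. Replacing n_0 by N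
and N/(N-1) by 1 causes the errors with prefactor (2(N-1))⁻¹. -/
theorem mode_lower_bound {Λ : Finset G} {p : G} (hN : 2 ≤ N) (hp : p ∈ Λ) (hp' : -p ∈ Λ)
    (h0 : (0 : G) ∈ Λ) (hp0 : p ≠ 0) (hpp : p ≠ -p) {c : (Fin N → G) → ℝ} (hc : IsSymm c)
    (hs : ∀ k, k ∉ box N Λ → c k = 0) (hn : ev Λ (fun _ => 1) c = 1) {l : ℝ} (hl : 0 < l)
    {t u : G → ℝ} (ht : 0 ≤ t p) (hu : 0 ≤ u p) :
    -(1 / 2) * (t p * ev Λ (fun k => (occ k p : ℝ) + occ k (-p)) c)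
      + 1 / 2 * (dispersion t u p * ev Λ (fun k => |(occ k p : ℝ) - occ k (-p)|) c)
      - 1 / 2 * (t p + u p - dispersion t u p)
      - (2 * ((N : ℝ) - 1))⁻¹ * ((t p + u p) * ev Λ (fun k => (occ k p : ℝ) + occ k (-p)) c + u p
        + u p * ev Λ (fun k => (excited k : ℝ) * ((occ k p : ℝ) + occ k (-p))) c
        + u p * ev Λ (fun k => (excited k : ℝ)) c
        + 2 * l * N * (u p * ev Λ (fun k => (occ k p : ℝ) + occ k (-p)) c + u p)
        + l⁻¹ * u p * ev Λ (fun k => (excited k : ℝ) ^ 2) c)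
      ≤ (2 * ((N : ℝ) - 1))⁻¹ * (u p * (∑ k ∈ box N Λ, trans p c k ^ 2 - N)) := by
  obtain ⟨hw, -, hwN, -⟩ := weight_bounds hN
  set w := (2 * ((N : ℝ) - 1))⁻¹
  have hedef := dispersion_nonneg t u p
  have hele := dispersion_le ht hu
  have hele' := le_dispersion ht hu
  have hesq := dispersion_sq ht hu
  set e := dispersion t u p
  have k1 := le_sum_trans_sq hp hp' h0 hp0 hc hs hl
  have k2 := neg_ev_le_pairing hp hp' h0 hp0 hpp hc hu hedef hele
    (by rw [hesq]; ring)
  rw [hn] at k1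
  have k3 : ev Λ (fun k => (occ k 0 : ℝ) * (occ k p + 1)) c
      + ev Λ (fun k => (occ k (-p) : ℝ) * (occ k 0 + 1)) c - N ≥
      N * ev Λ (fun k => (occ k p : ℝ) + occ k (-p)) c
        - ev Λ (fun k => (excited k : ℝ) * ((occ k p : ℝ) + occ k (-p))) c
        - ev Λ (fun k => (excited k : ℝ)) c := by
    have hN1 : (N : ℝ) = ev Λ (fun _ => (N : ℝ)) c := by rw [ev_const, hn, mul_one]
    rw [← ev_add, ← ev_smul, ← ev_sub, ← ev_sub]
    nth_rw 1 [hN1]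
    rw [← ev_sub]
    refine ev_mono (fun k _ => ?_) c
    have hk : (occ k 0 : ℝ) = N - excited k := by
      rw [eq_sub_iff_add_eq]; exact_mod_cast occ_zero_add_excited k
    rw [hk]
    have : (0 : ℝ) ≤ occ k (-p) := by positivity
    nlinarith
  set a := t p + u p
  have k4 : ev Λ (fun k => a * (occ k p + occ k (-p)) - e * |(occ k p : ℝ) - occ k (-p)| + (a - e)) c
      = a * ev Λ (fun k => (occ k p : ℝ) + occ k (-p)) c
        - e * ev Λ (fun k => |(occ k p : ℝ) - occ k (-p)|) c + (a - e) := by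
    rw [ev_add, ev_sub, ev_smul, ev_smul, ev_const Λ (a - e), hn, mul_one]
  rw [k4] at k2
  have k5 : 0 ≤ ev Λ (fun k => |(occ k p : ℝ) - occ k (-p)|) c :=
    ev_nonneg (fun k _ => abs_nonneg _) c
  set s := ev Λ (fun k => (occ k p : ℝ) + occ k (-p)) c
  set D := ev Λ (fun k => |(occ k p : ℝ) - occ k (-p)|) c
  set X := pairing Λ p c
  set S := ∑ k ∈ box N Λ, trans p c k ^ 2
  set ν := ev Λ (fun k => (excited k : ℝ)) c
  set ν₂ := ev Λ (fun k => (excited k : ℝ) ^ 2) c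
  set μ := ev Λ (fun k => (excited k : ℝ) * ((occ k p : ℝ) + occ k (-p))) c
  have k6 : N * s - μ - ν + 2 * X - 2 * l * N * (s + 1) - l⁻¹ * ν₂ ≤ S - N := by linarith
  have k7 := mul_le_mul_of_nonneg_left k6 (mul_nonneg hw.le hu)
  have k8 := mul_le_mul_of_nonneg_left k2 hw.le
  have k9 : 0 ≤ w * (e * D) := by positivity
  have k10 : w * (a - e) ≤ w * u p := by
    refine mul_le_mul_of_nonneg_left ?_ hw.le
    show t p + u p - e ≤ u p
    linarith
  have k11 : w * -(N * (a * s - e * D + (a - e))) =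
    -(1 / 2 + w) * (a * s - e * D + (a - e)) := by rw [← hwN]; ring
  have k12 : w * u p * (N * s - μ - ν + 2 * X - 2 * l * N * (s + 1) - l⁻¹ * ν₂) =
    u p * s * (1 / 2 + w) + w * (2 * u p * X)
      - w * (u p * μ + u p * ν + 2 * l * N * (u p * s + u p) + l⁻¹ * u p * ν₂) := by
    rw [← hwN]; ring
  have k13 : 0 ≤ w * (u p * s) := by
    have : 0 ≤ s := ev_nonneg (fun k _ => by positivity) c
    positivity
  have ha : a = t p + u p := rfl
  rw [k12] at k7
  rw [k11] at k8
  have : a * s = t p * s + u p * s := by rw [ha]; ring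
  nlinarith

/-- Summed over the modes, the terms -t_p (n_p + n_{-p})/2 use up the kinetic energy exactly. The
errors show what has to be controlled next: the first and second moments of n₊, the latter both over
N and over lN. -/
theorem lowForm_ge {Λ : Finset G} (hN : 2 ≤ N) (h0 : (0 : G) ∈ Λ) (hneg : ∀ p ∈ Λ, -p ∈ Λ)
    (hpp : ∀ p : G, p ≠ 0 → p ≠ -p) {t u : G → ℝ} (ht0 : t 0 = 0) (ht1 : ∀ p, p ≠ 0 → 1 ≤ t p)
    (hte : ∀ p, t (-p) = t p) (hu0 : ∀ p, 0 ≤ u p) {U : ℝ}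
    (hU : ∑ p ∈ Λ.erase 0, u p ≤ U) {c : (Fin N → G) → ℝ} (hc : IsSymm c)
    (hs : ∀ k, k ∉ box N Λ → c k = 0) (hn : ev Λ (fun _ => 1) c = 1) {l : ℝ} (hl : 0 < l) :
    1 / 2 * ∑ p ∈ Λ.erase 0, dispersion t u p * ev Λ (fun k => |(occ k p : ℝ) - occ k (-p)|) c
      - 1 / 2 * ∑ p ∈ Λ.erase 0, (t p + u p - dispersion t u p)
      - ((2 * ev Λ (kin t) c + 3 * U * ev Λ (fun k => (excited k : ℝ)) c + U
          + 2 * U * ev Λ (fun k => (excited k : ℝ) ^ 2) c) / N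
        + 2 * l * U * (2 * ev Λ (fun k => (excited k : ℝ)) c + 1)
        + U * ev Λ (fun k => (excited k : ℝ) ^ 2) c / (l * N))
      ≤ lowForm t u Λ c - (2 * ((N : ℝ) - 1))⁻¹ * N * ∑ p ∈ Λ.erase 0, u p := by
  obtain ⟨hw, hw1, -, hwN⟩ := weight_bounds hN
  rw [lowForm]
  have hmode := sum_le_sum fun p (hp : p ∈ Λ.erase 0) =>
    mode_lower_bound (t := t) (u := u) hN (mem_of_mem_erase hp) (hneg p (mem_of_mem_erase hp)) h0
      (ne_of_mem_erase hp) (hpp p (ne_of_mem_erase hp)) hc hs hn hl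
      (zero_le_one.trans (ht1 p (ne_of_mem_erase hp))) (hu0 p)
  generalize (2 * ((N : ℝ) - 1))⁻¹ = w at hw hw1 hwN hmode ⊢
  -- This expectation is made opaque so that the distributive laws below do not expand the product
  -- inside it.
  obtain ⟨S, hS⟩ : ∃ S : G → ℝ,
      ∀ p, ev Λ (fun k => (excited k : ℝ) * ((occ k p : ℝ) + occ k (-p))) c = S p :=
    ⟨_, fun _ => rfl⟩
  simp only [hS] at hmode
  simp only [sum_add_distrib, sum_sub_distrib, ← mul_sum, ← sum_mul, add_mul, mul_sub, mul_add]
    at hmode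
  have hT : ∑ p ∈ Λ.erase 0, t p * ev Λ (fun k => (occ k p : ℝ) + occ k (-p)) c =
      2 * ev Λ (kin t) c := by
    simp only [← ev_smul]
    rw [← ev_sum]
    refine ev_congr (fun k hk => ?_) c
    rw [sum_occ_add_occ_neg hneg hte, kin_eq hk ht0]
  have h1 := sum_ev_occ_le hneg hu0 hU (fun _ => 1) (fun _ => zero_le_one) c
  have h2 := sum_ev_occ_le hneg hu0 hU (fun k => (excited k : ℝ)) (fun k => by positivity) c
  simp only [one_mul, ← sq, hS] at h1 h2
  rw [hT] at hmode
  have hν : 0 ≤ ev Λ (fun k => (excited k : ℝ)) c := ev_nonneg (fun k _ => by positivity) c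
  have hν2 : 0 ≤ ev Λ (fun k => (excited k : ℝ) ^ 2) c := ev_nonneg (fun k _ => by positivity) c
  have hτ : 0 ≤ ev Λ (kin t) c :=
    ev_nonneg (fun k _ => le_trans (by positivity) (excited_le_kin ht0 ht1)) c
  have hu : 0 ≤ ∑ p ∈ Λ.erase 0, u p := sum_nonneg fun p _ => hu0 p
  set τ := ev Λ (kin t) c
  set ν := ev Λ (fun k => (excited k : ℝ)) c
  set ν₂ := ev Λ (fun k => (excited k : ℝ) ^ 2) c
  set υ := ∑ p ∈ Λ.erase 0, u p
  set s := ∑ p ∈ Λ.erase 0, u p * ev Λ (fun k => (occ k p : ℝ) + occ k (-p)) c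
  set r := ∑ p ∈ Λ.erase 0, u p * S p
  have hUnn : 0 ≤ U := hu.trans hU
  have b1 : w * (2 * τ + s + υ + r + υ * ν) ≤
      (2 * τ + 3 * U * ν + U + 2 * U * ν₂) / N := by
    rw [div_eq_mul_one_div, mul_comm]
    have : υ * ν ≤ U * ν := mul_le_mul_of_nonneg_right hU hν
    have hs0 : 0 ≤ 2 * τ + 3 * U * ν + U + 2 * U * ν₂ := by positivity
    calc _ ≤ (2 * τ + 3 * U * ν + U + 2 * U * ν₂) * w :=
          mul_le_mul_of_nonneg_right (by linarith) hw.le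
      _ ≤ _ := mul_le_mul_of_nonneg_left hw1 hs0
  have b2 : w * (2 * l * N * s + 2 * l * N * υ) ≤ 2 * l * U * (2 * ν + 1) := by
    have : s + υ ≤ U * (2 * ν + 1) := by linarith
    have h3 : 0 ≤ U * (2 * ν + 1) := by positivity
    calc w * (2 * l * N * s + 2 * l * N * υ) = 2 * l * ((w * N) * (s + υ)) := by ring
      _ ≤ 2 * l * ((w * N) * (U * (2 * ν + 1))) := by gcongr
      _ ≤ 2 * l * (1 * (U * (2 * ν + 1))) := by gcongr
      _ = _ := by ring
  have b3 : w * (l⁻¹ * υ * ν₂) ≤ U * ν₂ / (l * N) := by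
    calc w * (l⁻¹ * υ * ν₂) ≤ 1 / N * (l⁻¹ * U * ν₂) := by gcongr
      _ = _ := by field_simp
  simp only [sum_add_distrib, sum_sub_distrib]
  linarith

end LowerBound

end BoseGas

namespace BoseGas
open Finset Function

set_option linter.unusedSectionVars false

/-! ### The truncated minimiser, its second moment, and the lower bound. -/

section Minimizer

variable {G : Type} [AddCommGroup G] [DecidableEq G] {N : ℕ}

/-- Symmetric functions supported on the configurations in the box that satisfy `S`. -/
structure Admissible (Λ : Finset G) (S : (Fin N → G) → Prop) (c : (Fin N → G) → ℝ) : Prop where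
  symm : IsSymm c
  box : ∀ k, k ∉ box N Λ → c k = 0
  supp : ∀ k, ¬ S k → c k = 0

/-- The symmetric bilinear form of `lowForm`. -/
noncomputable def lowBilin (t u : G → ℝ) (Λ : Finset G) (c φ : (Fin N → G) → ℝ) : ℝ :=
  ∑ k ∈ box N Λ, kin t k * (c k * φ k) +
    (2 * ((N : ℝ) - 1))⁻¹ * ∑ p ∈ Λ.erase 0, u p * ∑ k ∈ box N Λ, trans p c k * trans p φ k

theorem Admissible.add_smul {Λ : Finset G} {S : (Fin N → G) → Prop} {c φ : (Fin N → G) → ℝ}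
    (hc : Admissible Λ S c) (hφ : Admissible Λ S φ) (s : ℝ) :
    Admissible Λ S (fun k => c k + s * φ k) where
  symm σ k := by simp only [hc.symm σ k, hφ.symm σ k]
  box k hk := by simp [hc.box k hk, hφ.box k hk]
  supp k hk := by simp [hc.supp k hk, hφ.supp k hk]

theorem Admissible.mul {Λ : Finset G} {S : (Fin N → G) → Prop} {c g : (Fin N → G) → ℝ}
    (hc : Admissible Λ S c) (hg : IsSymm g) : Admissible Λ S (fun k => g k * c k) where
  symm σ k := by simp only [hc.symm σ k, hg σ k]
  box k hk := by simp [hc.box k hk]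
  supp k hk := by simp [hc.supp k hk]

theorem trans_add_smul (p : G) (c φ : (Fin N → G) → ℝ) (s : ℝ) (k : Fin N → G) :
    trans p (fun k => c k + s * φ k) k = trans p c k + s * trans p φ k := by
  simp only [trans, sum_add_distrib, mul_sum]

theorem lowForm_add_smul (t u : G → ℝ) (Λ : Finset G) (c φ : (Fin N → G) → ℝ) (s : ℝ) :
    lowForm t u Λ (fun k => c k + s * φ k) =
      lowForm t u Λ c + 2 * s * lowBilin t u Λ c φ + s ^ 2 * lowForm t u Λ φ := by
  have h1 : ev Λ (kin t) (fun k => c k + s * φ k) = ev Λ (kin t) c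
      + 2 * s * ∑ k ∈ box N Λ, kin t k * (c k * φ k) + s ^ 2 * ev Λ (kin t) φ := by
    simp only [ev, mul_sum, ← sum_add_distrib]
    exact sum_congr rfl fun k _ => by ring
  have h2 : ∀ p, ∑ k ∈ box N Λ, trans p (fun k => c k + s * φ k) k ^ 2 =
      ∑ k ∈ box N Λ, trans p c k ^ 2 + 2 * s * ∑ k ∈ box N Λ, trans p c k * trans p φ k
        + s ^ 2 * ∑ k ∈ box N Λ, trans p φ k ^ 2 := by
    intro p
    simp only [trans_add_smul, mul_sum, ← sum_add_distrib]
    exact sum_congr rfl fun k _ => by ring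
  have h3 : ∑ p ∈ Λ.erase 0, u p * ∑ k ∈ box N Λ, trans p (fun k => c k + s * φ k) k ^ 2 =
      ∑ p ∈ Λ.erase 0, u p * ∑ k ∈ box N Λ, trans p c k ^ 2
      + 2 * s * ∑ p ∈ Λ.erase 0, u p * ∑ k ∈ box N Λ, trans p c k * trans p φ k
      + s ^ 2 * ∑ p ∈ Λ.erase 0, u p * ∑ k ∈ box N Λ, trans p φ k ^ 2 := by
    simp only [h2]
    rw [mul_sum, mul_sum, ← sum_add_distrib, ← sum_add_distrib]
    exact sum_congr rfl fun p _ => by ring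
  rw [lowForm, lowForm, lowForm, lowBilin, h1, h3]
  ring

theorem ev_one_add_smul (Λ : Finset G) (c φ : (Fin N → G) → ℝ) (s : ℝ) :
    ev Λ (fun _ => 1) (fun k => c k + s * φ k) =
      ev Λ (fun _ => 1) c + 2 * s * ∑ k ∈ box N Λ, c k * φ k + s ^ 2 * ev Λ (fun _ => 1) φ := by
  simp only [ev, mul_sum, ← sum_add_distrib]
  exact sum_congr rfl fun k _ => by ring

theorem lowForm_smul (t u : G → ℝ) (Λ : Finset G) (c : (Fin N → G) → ℝ) (s : ℝ) :
    lowForm t u Λ (fun k => s * c k) = s ^ 2 * lowForm t u Λ c := by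
  have h0 : lowForm t u Λ (fun _ : Fin N → G => (0 : ℝ)) = 0 := by simp [lowForm, ev, trans]
  have h1 : lowBilin t u Λ (fun _ => 0) c = 0 := by simp [lowBilin, trans]
  have := lowForm_add_smul t u Λ (fun _ => 0) c s
  simpa [h0, h1] using this

theorem ev_one_smul (Λ : Finset G) (c : (Fin N → G) → ℝ) (s : ℝ) :
    ev Λ (fun _ => 1) (fun k => s * c k) = s ^ 2 * ev Λ (fun _ => 1) c := by
  simp only [ev, mul_sum]
  exact sum_congr rfl fun k _ => by ring

theorem continuous_lowForm (t u : G → ℝ) (Λ : Finset G) :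
    Continuous (lowForm (N := N) t u Λ) := by
  unfold lowForm ev trans
  fun_prop

/-- Normalisation bounds the finitely many coefficients in the box by one and all others vanish, so
a product of compact intervals contains the set. -/
theorem isCompact_admissible (Λ : Finset G) (S : (Fin N → G) → Prop) :
    IsCompact {c : (Fin N → G) → ℝ | Admissible Λ S c ∧ ev Λ (fun _ => 1) c = 1} := by
  have hK : IsCompact (Set.univ.pi fun k : Fin N → G =>
      Set.Icc (if k ∈ box N Λ then (-1 : ℝ) else 0) (if k ∈ box N Λ then 1 else 0)) :=
    isCompact_univ_pi fun k => isCompact_Icc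
  refine hK.of_isClosed_subset ?_ ?_
  · have e : {c : (Fin N → G) → ℝ | Admissible Λ S c ∧ ev Λ (fun _ => 1) c = 1} =
        ((⋂ σ : Equiv.Perm (Fin N), ⋂ k : Fin N → G, {c | c (k ∘ σ) = c k}) ∩
        (⋂ k : Fin N → G, ⋂ _ : k ∉ box N Λ, {c | c k = 0}) ∩
        (⋂ k : Fin N → G, ⋂ _ : ¬ S k, {c | c k = 0})) ∩ {c | ev Λ (fun _ => 1) c = 1} := by
      ext c
      simp only [Set.mem_inter_iff, Set.mem_iInter, Set.mem_ofPred_eq]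
      exact ⟨fun h => ⟨⟨⟨h.1.symm, h.1.box⟩, h.1.supp⟩, h.2⟩,
        fun h => ⟨⟨h.1.1.1, h.1.1.2, h.1.2⟩, h.2⟩⟩
    rw [e]
    refine IsClosed.inter (IsClosed.inter (IsClosed.inter ?_ ?_) ?_) ?_
    · exact isClosed_iInter fun σ => isClosed_iInter fun k =>
        isClosed_eq (continuous_apply _) (continuous_apply _)
    · exact isClosed_iInter fun k => isClosed_iInter fun _ =>
        isClosed_eq (continuous_apply _) continuous_const
    · exact isClosed_iInter fun k => isClosed_iInter fun _ =>
        isClosed_eq (continuous_apply _) continuous_const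
    · refine isClosed_eq ?_ continuous_const
      unfold ev
      fun_prop
  · rintro c ⟨hc, hn⟩ k -
    by_cases hk : k ∈ box N Λ
    · simp only [hk, if_true]
      rw [Set.mem_Icc, ← abs_le, ← sq_le_one_iff_abs_le_one, ← hn, ev]
      simp only [one_mul]
      exact single_le_sum (f := fun k => c k ^ 2) (fun _ _ => sq_nonneg _) hk
    · simp [hk, hc.box k hk]

/-- An exact minimiser exists because only finitely many coefficients are free. It is needed for the
Euler–Lagrange equation: a state of merely small energy need not have a small second moment of n₊.
-/
theorem exists_minimizer (t u : G → ℝ) (Λ : Finset G) (S : (Fin N → G) → Prop)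
    {c₀ : (Fin N → G) → ℝ} (h₀ : Admissible Λ S c₀) (hn₀ : ev Λ (fun _ => 1) c₀ = 1) :
    ∃ c : (Fin N → G) → ℝ, Admissible Λ S c ∧ ev Λ (fun _ => 1) c = 1 ∧
      ∀ φ, Admissible Λ S φ → lowForm t u Λ c * ev Λ (fun _ => 1) φ ≤ lowForm t u Λ φ := by
  obtain ⟨c, ⟨hc, hn⟩, hmin⟩ := (isCompact_admissible (N := N) Λ S).exists_isMinOn
    ⟨c₀, h₀, hn₀⟩ (continuous_lowForm t u Λ).continuousOn
  refine ⟨c, hc, hn, fun φ hφ => ?_⟩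
  have hnn : 0 ≤ ev Λ (fun _ => 1) φ := ev_nonneg (fun _ _ => zero_le_one) φ
  rcases hnn.eq_or_lt with h | h
  · have hz : ∀ k, φ k = 0 := by
      intro k
      by_cases hk : k ∈ box N Λ
      · have := (sum_eq_zero_iff_of_nonneg (fun k _ => by positivity)).1 h.symm k hk
        simpa using this
      · exact hφ.box k hk
    have : φ = fun k => 0 * φ k := by ext k; simp [hz k]
    rw [this, lowForm_smul, ev_one_smul]; simp
  · set s := (√(ev Λ (fun _ => 1) φ))⁻¹
    have hs : s ^ 2 * ev Λ (fun _ => 1) φ = 1 := by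
      rw [inv_pow, Real.sq_sqrt h.le, inv_mul_cancel₀ h.ne']
    have hφ' : Admissible Λ S (fun k => s * φ k) := hφ.mul (g := fun _ => s) fun _ _ => rfl
    have := hmin (show (fun k => s * φ k) ∈ {c : (Fin N → G) → ℝ |
      Admissible Λ S c ∧ ev Λ (fun _ => 1) c = 1} from ⟨hφ', by rw [ev_one_smul, hs]⟩)
    rw [Set.mem_ofPred_eq, lowForm_smul] at this
    have h2 := mul_le_mul_of_nonneg_right this h.le
    calc _ ≤ _ := h2
      _ = (s ^ 2 * ev Λ (fun _ => 1) φ) * lowForm t u Λ φ := by ring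
      _ = _ := by rw [hs, one_mul]

theorem eq_zero_of_forall_nonneg {b q : ℝ} (h : ∀ s : ℝ, 0 ≤ 2 * s * b + s ^ 2 * q) : b = 0 := by
  have hq : 0 < |q| + 1 := by positivity
  -- This step size makes the linear term win whatever the sign of `q`, since q < 2(|q| + 1).
  have h1 := h (-b / (|q| + 1))
  have h2 : 2 * (-b / (|q| + 1)) * b + (-b / (|q| + 1)) ^ 2 * q =
      b ^ 2 * (q - 2 * (|q| + 1)) / (|q| + 1) ^ 2 := by
    field_simp
    ring
  rw [h2] at h1
  have h3 : 0 ≤ b ^ 2 * (q - 2 * (|q| + 1)) := by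
    by_contra hneg
    exact absurd h1 (not_le.2 (div_neg_of_neg_of_pos (not_le.1 hneg) (by positivity)))
  have h4 : q - 2 * (|q| + 1) < 0 := by linarith [le_abs_self q, abs_nonneg q]
  by_contra hb
  exact absurd h3 (not_le.2 (mul_neg_of_pos_of_neg (by positivity) h4))

theorem euler_lagrange {t u : G → ℝ} {Λ : Finset G} {S : (Fin N → G) → Prop}
    {c : (Fin N → G) → ℝ} (hc : Admissible Λ S c) (hn : ev Λ (fun _ => 1) c = 1)
    (hmin : ∀ φ, Admissible Λ S φ → lowForm t u Λ c * ev Λ (fun _ => 1) φ ≤ lowForm t u Λ φ)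
    {φ : (Fin N → G) → ℝ} (hφ : Admissible Λ S φ) :
    lowBilin t u Λ c φ = lowForm t u Λ c * ∑ k ∈ box N Λ, c k * φ k := by
  rw [← sub_eq_zero]
  refine eq_zero_of_forall_nonneg
    (q := lowForm t u Λ φ - lowForm t u Λ c * ev Λ (fun _ => 1) φ) fun s => ?_
  have h := hmin _ (hc.add_smul hφ s)
  rw [lowForm_add_smul, ev_one_add_smul, hn] at h
  linarith

/-- The three parts of ρ_p evaluate their argument at configurations with one excited particle
fewer, one more, and equally many. -/
theorem trans_excited_mul {p : G} (hp : p ≠ 0) (c : (Fin N → G) → ℝ) (k : Fin N → G) (n : ℕ) :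
    trans p (fun k => (excited k : ℝ) ^ n * c k) k =
      ((excited k : ℝ) - 1) ^ n * hop p 0 c k + ((excited k : ℝ) + 1) ^ n * hop 0 (-p) c k
        + (excited k : ℝ) ^ n * transExc p c k := by
  rw [trans_eq hp, hop, hop, transExc, hop, hop, transExc, mul_sum, mul_sum, mul_sum]
  congr 1
  · congr 1
    · refine sum_congr rfl fun i hi => ?_
      have hi' : k i = p := by simpa using hi
      have := excited_update_to_zero k i (by rwa [hi'])
      rw [← this]; push_cast; ring
    · refine sum_congr rfl fun i hi => ?_
      have hi' : k i = 0 := by simpa using hi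
      rw [excited_update_from_zero k i hi' (neg_ne_zero.2 hp)]
      push_cast; ring
  · refine sum_congr rfl fun i hi => ?_
    simp only [mem_filter, mem_univ, true_and] at hi
    rw [excited_update_of_ne k i hi.1 (sub_ne_zero.2 hi.2)]

/-- The double commutator of the energy with the number of excited particles. -/
theorem lowForm_excited_sub_le {Λ : Finset G} (hN : 2 ≤ N) (h0 : (0 : G) ∈ Λ)
    (hneg : ∀ p ∈ Λ, -p ∈ Λ) {t u : G → ℝ} (hu0 : ∀ p, 0 ≤ u p) {U : ℝ}
    (hU : ∑ p ∈ Λ.erase 0, u p ≤ U) {c : (Fin N → G) → ℝ} (hc : IsSymm c)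
    (hs : ∀ k, k ∉ box N Λ → c k = 0) (hn : ev Λ (fun _ => 1) c = 1) :
    lowForm t u Λ (fun k => (excited k : ℝ) * c k)
        - lowBilin t u Λ c (fun k => (excited k : ℝ) ^ 2 * c k) ≤
      7 * U * ev Λ (fun k => (excited k : ℝ)) c + 3 * U := by
  obtain ⟨hw, hw1, -, hwN⟩ := weight_bounds hN
  have hν : 0 ≤ ev Λ (fun k => (excited k : ℝ)) c := ev_nonneg (fun k _ => by positivity) c
  have h2 : ev Λ (fun k => (excited k : ℝ) ^ 2) c ≤ N * ev Λ (fun k => (excited k : ℝ)) c := by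
    rw [← ev_smul]
    refine ev_mono (fun k _ => ?_) c
    have : (excited k : ℝ) ≤ N := by exact_mod_cast excited_le k
    nlinarith [(Nat.cast_nonneg (excited k) : (0 : ℝ) ≤ _)]
  have hkin : ev Λ (kin t) (fun k => (excited k : ℝ) * c k) =
      ∑ k ∈ box N Λ, kin t k * (c k * ((excited k : ℝ) ^ 2 * c k)) :=
    sum_congr rfl fun k _ => by ring
  have hp : ∀ p ∈ Λ.erase 0, u p * ∑ k ∈ box N Λ, trans p (fun k => (excited k : ℝ) * c k) k ^ 2 -
      u p * ∑ k ∈ box N Λ, trans p c k * trans p (fun k => (excited k : ℝ) ^ 2 * c k) k ≤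
      N * (3 * (u p * ev Λ (fun k => (occ k p : ℝ) + occ k (-p)) c) + 3 * u p
        + 1 / 2 * u p * ev Λ (fun k => (excited k : ℝ)) c) := by
    intro p hp
    have hp0 := ne_of_mem_erase hp
    have hpΛ := mem_of_mem_erase hp
    have k1 : ∑ k ∈ box N Λ, trans p (fun k => (excited k : ℝ) * c k) k ^ 2 -
        ∑ k ∈ box N Λ, trans p c k * trans p (fun k => (excited k : ℝ) ^ 2 * c k) k ≤
        ∑ k ∈ box N Λ, (3 * (hop p 0 c k ^ 2 + hop 0 (-p) c k ^ 2)
          + 1 / 2 * transExc p c k ^ 2) := by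
      rw [← sum_sub_distrib]
      refine sum_le_sum fun k _ => ?_
      have e1 := trans_excited_mul hp0 c k 1
      have e2 := trans_excited_mul hp0 c k 2
      simp only [pow_one] at e1
      rw [e1, e2, trans_eq hp0]
      set a := hop p 0 c k
      set b := hop 0 (-p) c k
      set r := transExc p c k
      -- All powers of `excited k` cancel: the difference equals -4ab - (a + b)r, since only parts
      -- of ρ_p that change n₊ fail to commute with it.
      nlinarith [sq_nonneg (a + b), sq_nonneg (a - b), sq_nonneg (r + a + b)]
    have k2 := sum_transExc_sq_le (p := p) hs
    have k3 := sum_create_add_annihilate_le hpΛ (hneg p hpΛ) h0 hp0 hc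
    rw [hn] at k3
    simp only [sum_add_distrib, ← mul_sum] at k1
    have k2' : ∑ k ∈ box N Λ, transExc p c k ^ 2 ≤ N * ev Λ (fun k => (excited k : ℝ)) c :=
      k2.trans h2
    have k4 := mul_le_mul_of_nonneg_left (k1.trans (add_le_add
      (mul_le_mul_of_nonneg_left k3 (by norm_num : (0 : ℝ) ≤ 3))
      (mul_le_mul_of_nonneg_left k2' (by norm_num : (0 : ℝ) ≤ 1 / 2)))) (hu0 p)
    linarith
  have hsum := sum_le_sum hp
  rw [sum_sub_distrib] at hsum
  simp only [← mul_sum, sum_add_distrib, ← sum_mul] at hsum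
  have h1 := sum_ev_occ_le hneg hu0 hU (fun _ => 1) (fun _ => zero_le_one) c
  simp only [one_mul] at h1
  rw [lowForm, lowBilin, hkin]
  generalize (2 * ((N : ℝ) - 1))⁻¹ = w at *
  set ν := ev Λ (fun k => (excited k : ℝ)) c
  have hu : 0 ≤ ∑ p ∈ Λ.erase 0, u p := sum_nonneg fun p _ => hu0 p
  have h3 : (∑ p ∈ Λ.erase 0, u p) * ν ≤ U * ν := mul_le_mul_of_nonneg_right hU hν
  have hUnn : 0 ≤ U := hu.trans hU
  have hUν : 0 ≤ U * ν := mul_nonneg hUnn hν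
  have h4 := mul_le_mul_of_nonneg_left (hsum.trans (mul_le_mul_of_nonneg_left
    (by linarith : _ ≤ 7 * U * ν + 3 * U) (Nat.cast_nonneg N))) hw.le
  have h5 : w * (N * (7 * U * ν + 3 * U)) ≤ 7 * U * ν + 3 * U := by
    rw [← mul_assoc]
    exact mul_le_of_le_one_left (by positivity) hwN
  linarith

theorem kin_le_lowForm {Λ : Finset G} (hN : 2 ≤ N) {t u : G → ℝ} (hu0 : ∀ p, 0 ≤ u p)
    (c : (Fin N → G) → ℝ) : ev Λ (kin t) c ≤ lowForm t u Λ c := by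
  rw [lowForm, le_add_iff_nonneg_right]
  refine mul_nonneg (weight_bounds hN).1.le (sum_nonneg fun p _ => mul_nonneg (hu0 p) ?_)
  exact sum_nonneg fun k _ => sq_nonneg _

/-- Testing the Euler–Lagrange equation with n₊² c bounds the energy form at n₊ c by E⟨n₊²⟩ plus the
double commutator, which is O(⟨n₊⟩ + 1). That form dominates the kinetic energy and hence ⟨n₊³⟩,
because each excited particle costs at least 1. So ⟨n₊³⟩ ≤ ξ⟨n₊²⟩ + O(ξ), which forces ⟨n₊²⟩ =
O(ξ²). -/
theorem minimizer_moment {Λ : Finset G} (hN : 2 ≤ N) (h0 : (0 : G) ∈ Λ)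
    (hneg : ∀ p ∈ Λ, -p ∈ Λ) {t u : G → ℝ} (ht0 : t 0 = 0) (ht1 : ∀ p, p ≠ 0 → 1 ≤ t p)
    (hu0 : ∀ p, 0 ≤ u p) {U : ℝ} (hU : ∑ p ∈ Λ.erase 0, u p ≤ U) {S : (Fin N → G) → Prop}
    {c : (Fin N → G) → ℝ} (hc : Admissible Λ S c) (hn : ev Λ (fun _ => 1) c = 1)
    (hmin : ∀ φ, Admissible Λ S φ → lowForm t u Λ c * ev Λ (fun _ => 1) φ ≤ lowForm t u Λ φ)
    {ξ : ℝ} (hξ : 1 ≤ ξ) (hle : lowForm t u Λ c ≤ ξ) :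
    ev Λ (kin t) c ≤ ξ ∧ ev Λ (fun k => (excited k : ℝ)) c ≤ ξ ∧
      ev Λ (fun k => (excited k : ℝ) ^ 2) c ≤ (1 + 10 * U) * ξ ^ 2 := by
  have hUnn : 0 ≤ U := (sum_nonneg fun p _ => hu0 p).trans hU
  have hτ : ev Λ (kin t) c ≤ ξ := (kin_le_lowForm hN hu0 c).trans hle
  have hν : ev Λ (fun k => (excited k : ℝ)) c ≤ ξ :=
    (ev_mono (fun k _ => excited_le_kin ht0 ht1) c).trans hτ
  refine ⟨hτ, hν, ?_⟩
  have h1 := lowForm_excited_sub_le (t := t) hN h0 hneg hu0 hU hc.symm hc.box hn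
  have hadm : Admissible Λ S (fun k => (excited k : ℝ) ^ 2 * c k) :=
    hc.mul fun σ k => by simp only [excited_comp_perm]
  rw [euler_lagrange hc hn hmin hadm] at h1
  have e1 : ∑ k ∈ box N Λ, c k * ((excited k : ℝ) ^ 2 * c k) =
      ev Λ (fun k => (excited k : ℝ) ^ 2) c := sum_congr rfl fun k _ => by ring
  rw [e1] at h1
  have h2 := kin_le_lowForm (t := t) (Λ := Λ) hN hu0 (fun k => (excited k : ℝ) * c k)
  have h3 : ev Λ (fun k => (excited k : ℝ) ^ 3) c ≤
      ev Λ (kin t) (fun k => (excited k : ℝ) * c k) := by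
    refine sum_le_sum fun k _ => ?_
    have := excited_le_kin (k := k) ht0 ht1
    calc (excited k : ℝ) ^ 3 * c k ^ 2 = excited k * ((excited k : ℝ) * c k) ^ 2 := by ring
      _ ≤ kin t k * ((excited k : ℝ) * c k) ^ 2 := by gcongr
  -- Integrated form of n(n - ξ)² ≥ 0. The factor 2ξ leaves one ξ⟨n₊²⟩ over after E⟨n₊²⟩ is
  -- absorbed.
  have h4 : 2 * ξ * ev Λ (fun k => (excited k : ℝ) ^ 2) c ≤
      ev Λ (fun k => (excited k : ℝ) ^ 3) c + ξ ^ 2 * ev Λ (fun k => (excited k : ℝ)) c := by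
    rw [← ev_smul, ← ev_smul, ← ev_add]
    refine ev_mono (fun k _ => ?_) c
    have : (0 : ℝ) ≤ excited k := by positivity
    nlinarith [mul_nonneg this (sq_nonneg ((excited k : ℝ) - ξ))]
  have hν0 : 0 ≤ ev Λ (fun k => (excited k : ℝ)) c := ev_nonneg (fun k _ => by positivity) c
  have hν2 : 0 ≤ ev Λ (fun k => (excited k : ℝ) ^ 2) c := ev_nonneg (fun k _ => by positivity) c
  set ν := ev Λ (fun k => (excited k : ℝ)) c
  set ν₂ := ev Λ (fun k => (excited k : ℝ) ^ 2) c
  set ν₃ := ev Λ (fun k => (excited k : ℝ) ^ 3) c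
  have h5 : lowForm t u Λ c * ν₂ ≤ ξ * ν₂ := mul_le_mul_of_nonneg_right hle hν2
  have h6 : U * ν ≤ U * ξ := mul_le_mul_of_nonneg_left hν hUnn
  have h7 : ξ ^ 2 * ν ≤ ξ ^ 2 * ξ := mul_le_mul_of_nonneg_left hν (sq_nonneg _)
  have h8 : U ≤ U * ξ := le_mul_of_one_le_right hUnn hξ
  have h9 : ξ * ν₂ ≤ ξ * (ξ ^ 2 + 10 * U) := by linarith
  have h10 : ν₂ ≤ ξ ^ 2 + 10 * U := le_of_mul_le_mul_left h9 (by linarith)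
  have h11 : U ≤ U * ξ ^ 2 := le_mul_of_one_le_right hUnn (one_le_pow₀ hξ)
  linarith

/-- The lower bound on the energy in the sector of the configurations that satisfy `S`. -/
theorem lower_bound {Λ : Finset G} (hN : 2 ≤ N) (h0 : (0 : G) ∈ Λ)
    (hneg : ∀ p ∈ Λ, -p ∈ Λ) (hpp : ∀ p : G, p ≠ 0 → p ≠ -p) {t u : G → ℝ} (ht0 : t 0 = 0)
    (ht1 : ∀ p, p ≠ 0 → 1 ≤ t p) (hte : ∀ p, t (-p) = t p) (hu0 : ∀ p, 0 ≤ u p) {U : ℝ}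
    (hU : ∑ p ∈ Λ.erase 0, u p ≤ U) {S : (Fin N → G) → Prop} {m : ℝ}
    (hm : ∀ k ∈ box N Λ, S k →
      m ≤ 1 / 2 * ∑ p ∈ Λ.erase 0, dispersion t u p * |(occ k p : ℝ) - occ k (-p)|)
    {c₀ : (Fin N → G) → ℝ} (h₀ : Admissible Λ S c₀) (hn₀ : ev Λ (fun _ => 1) c₀ = 1)
    {ξ κ : ℝ} (hξ : 1 ≤ ξ) (hκ : 1 ≤ κ) (hξκ : ξ ≤ κ * N) (hle : lowForm t u Λ c₀ ≤ ξ)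
    {c : (Fin N → G) → ℝ} (hc : Admissible Λ S c) :
    (m - 1 / 2 * ∑ p ∈ Λ.erase 0, (t p + u p - dispersion t u p)
        + (2 * ((N : ℝ) - 1))⁻¹ * N * ∑ p ∈ Λ.erase 0, u p
        - (κ * (2 + 4 * U + 2 * U * (1 + 10 * U)) + 6 * U + U * (1 + 10 * U)) * (ξ * √(ξ / N)))
      * ev Λ (fun _ => 1) c ≤ lowForm t u Λ c := by
  have hUnn : 0 ≤ U := (sum_nonneg fun p _ => hu0 p).trans hU
  obtain ⟨d, hd, hdn, hmin⟩ := exists_minimizer t u Λ S h₀ hn₀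
  refine le_trans (mul_le_mul_of_nonneg_right ?_ (ev_nonneg (fun _ _ => zero_le_one) c)) (hmin c hc)
  have hled : lowForm t u Λ d ≤ ξ := by
    have := hmin c₀ h₀
    rw [hn₀, mul_one] at this
    exact this.trans hle
  obtain ⟨hτ, hν, hν2⟩ := minimizer_moment hN h0 hneg ht0 ht1 hu0 hU hd hdn hmin hξ hled
  have hNpos : (0 : ℝ) < N := by positivity
  have hξ0 : 0 < ξ := by linarith
  -- This weight balances the error terms lξ and ξ²/(lN); both become ξ √(ξ/N). The terms of order
  -- ξ²/N are smaller by a further factor l ≤ κ.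
  set l := √(ξ / N) with hl
  have hlpos : 0 < l := Real.sqrt_pos.2 (by positivity)
  have hl2 : l ^ 2 = ξ / N := Real.sq_sqrt (by positivity)
  have hlκ : l ≤ κ := by
    refine Real.sqrt_le_iff.2 ⟨by linarith, ?_⟩
    rw [div_le_iff₀ hNpos]
    nlinarith [mul_le_mul_of_nonneg_right hκ (by positivity : 0 ≤ κ * N)]
  have hmain := lowForm_ge hN h0 hneg hpp ht0 ht1 hte hu0 hU hd.symm hd.box hdn hlpos
  have hmd : m ≤ 1 / 2 * ∑ p ∈ Λ.erase 0,
      dispersion t u p * ev Λ (fun k => |(occ k p : ℝ) - occ k (-p)|) d := by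
    have e : 1 / 2 * ∑ p ∈ Λ.erase 0,
        dispersion t u p * ev Λ (fun k => |(occ k p : ℝ) - occ k (-p)|) d =
        ev Λ (fun k => 1 / 2 * ∑ p ∈ Λ.erase 0,
          dispersion t u p * |(occ k p : ℝ) - occ k (-p)|) d := by
      rw [ev_smul, ev_sum]
      simp only [ev_smul]
    rw [e]
    calc m = ev Λ (fun _ => m) d := by rw [ev_const, hdn, mul_one]
      _ ≤ _ := by
        refine sum_le_sum fun k hk => ?_
        by_cases hS : S k
        · exact mul_le_mul_of_nonneg_right (hm k hk hS) (sq_nonneg _)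
        · simp [hd.supp k hS]
  have hν0 : 0 ≤ ev Λ (fun k => (excited k : ℝ)) d := ev_nonneg (fun k _ => by positivity) d
  have hν20 : 0 ≤ ev Λ (fun k => (excited k : ℝ) ^ 2) d := ev_nonneg (fun k _ => by positivity) d
  set τ := ev Λ (kin t) d
  set ν := ev Λ (fun k => (excited k : ℝ)) d
  set ν₂ := ev Λ (fun k => (excited k : ℝ) ^ 2) d
  have hξsq : ξ ≤ ξ ^ 2 := le_self_pow₀ hξ two_ne_zero
  have b1 : (2 * τ + 3 * U * ν + U + 2 * U * ν₂) / N ≤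
      κ * (2 + 4 * U + 2 * U * (1 + 10 * U)) * (ξ * l) := by
    have h1 : 2 * τ + 3 * U * ν + U + 2 * U * ν₂ ≤
        (2 + 4 * U + 2 * U * (1 + 10 * U)) * ξ ^ 2 := by
      have a1 : U * ν ≤ U * ξ ^ 2 := mul_le_mul_of_nonneg_left (hν.trans hξsq) hUnn
      have a2 : U * 1 ≤ U * ξ ^ 2 := mul_le_mul_of_nonneg_left (one_le_pow₀ hξ) hUnn
      have a3 : U * ν₂ ≤ U * ((1 + 10 * U) * ξ ^ 2) := mul_le_mul_of_nonneg_left hν2 hUnn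
      nlinarith
    calc _ ≤ (2 + 4 * U + 2 * U * (1 + 10 * U)) * ξ ^ 2 / N := by gcongr
      _ = (2 + 4 * U + 2 * U * (1 + 10 * U)) * (ξ * l ^ 2) := by rw [hl2]; ring
      _ = (2 + 4 * U + 2 * U * (1 + 10 * U)) * (ξ * l) * l := by ring
      _ ≤ (2 + 4 * U + 2 * U * (1 + 10 * U)) * (ξ * l) * κ := by gcongr
      _ = _ := by ring
  have b2 : 2 * l * U * (2 * ν + 1) ≤ 6 * U * (ξ * l) := by
    calc 2 * l * U * (2 * ν + 1) ≤ 2 * l * U * (3 * ξ) := by gcongr; linarith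
      _ = _ := by ring
  have b3 : U * ν₂ / (l * N) ≤ U * (1 + 10 * U) * (ξ * l) := by
    calc U * ν₂ / (l * N) ≤ U * ((1 + 10 * U) * ξ ^ 2) / (l * N) := by gcongr
      _ = U * (1 + 10 * U) * ξ * (ξ / N) / l := by field_simp
      _ = U * (1 + 10 * U) * ξ * l ^ 2 / l := by rw [hl2]
      _ = _ := by field_simp
  linarith

/-- The upper bound of the energy by the kinetic energy. -/
theorem lowForm_le {Λ : Finset G} (hN : 2 ≤ N) (h0 : (0 : G) ∈ Λ)
    (hneg : ∀ p ∈ Λ, -p ∈ Λ) {t u : G → ℝ} (ht0 : t 0 = 0) (ht1 : ∀ p, p ≠ 0 → 1 ≤ t p)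
    (hu0 : ∀ p, 0 ≤ u p) {U : ℝ} (hU : ∑ p ∈ Λ.erase 0, u p ≤ U)
    {c : (Fin N → G) → ℝ} (hc : IsSymm c)
    (hs : ∀ k, k ∉ box N Λ → c k = 0) (hn : ev Λ (fun _ => 1) c = 1) :
    lowForm t u Λ c ≤ (1 + 9 * U) * ev Λ (kin t) c + 3 * U := by
  obtain ⟨hw, hw1, -, hwN⟩ := weight_bounds hN
  have hν : 0 ≤ ev Λ (fun k => (excited k : ℝ)) c := ev_nonneg (fun k _ => by positivity) c
  have hτ := ev_mono (Λ := Λ) (fun k _ => excited_le_kin (k := k) ht0 ht1) c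
  have h2 : ev Λ (fun k => (excited k : ℝ) ^ 2) c ≤ N * ev Λ (fun k => (excited k : ℝ)) c := by
    rw [← ev_smul]
    refine ev_mono (fun k _ => ?_) c
    have : (excited k : ℝ) ≤ N := by exact_mod_cast excited_le k
    nlinarith [(Nat.cast_nonneg (excited k) : (0 : ℝ) ≤ _)]
  have hp : ∀ p ∈ Λ.erase 0, u p * ∑ k ∈ box N Λ, trans p c k ^ 2 ≤
      N * (3 * (u p * ev Λ (fun k => (occ k p : ℝ) + occ k (-p)) c) + 3 * u p
        + 3 * u p * ev Λ (fun k => (excited k : ℝ)) c) := by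
    intro p hp
    have hpΛ := mem_of_mem_erase hp
    have k1 := sum_trans_sq_le hpΛ (hneg p hpΛ) h0 (ne_of_mem_erase hp) hc hs
    rw [hn] at k1
    have k2 := mul_le_mul_of_nonneg_left (k1.trans (add_le_add_right
      (mul_le_mul_of_nonneg_left h2 (by norm_num : (0 : ℝ) ≤ 3)) _)) (hu0 p)
    linarith
  have hsum := sum_le_sum hp
  simp only [← mul_sum, sum_add_distrib, ← sum_mul] at hsum
  have h1 := sum_ev_occ_le hneg hu0 hU (fun _ => 1) (fun _ => zero_le_one) c
  simp only [one_mul] at h1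
  rw [lowForm]
  generalize (2 * ((N : ℝ) - 1))⁻¹ = w at *
  set ν := ev Λ (fun k => (excited k : ℝ)) c
  have hu : 0 ≤ ∑ p ∈ Λ.erase 0, u p := sum_nonneg fun p _ => hu0 p
  have h3 : (∑ p ∈ Λ.erase 0, u p) * ν ≤ U * ν := mul_le_mul_of_nonneg_right hU hν
  have hUnn : 0 ≤ U := hu.trans hU
  have h4 := mul_le_mul_of_nonneg_left (hsum.trans (mul_le_mul_of_nonneg_left
    (by linarith : _ ≤ 9 * U * ν + 3 * U) (Nat.cast_nonneg N))) hw.le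
  have h5 : w * (N * (9 * U * ν + 3 * U)) ≤ 9 * U * ν + 3 * U := by
    rw [← mul_assoc]
    exact mul_le_of_le_one_left (by positivity) hwN
  nlinarith [mul_le_mul_of_nonneg_left hτ hUnn]

end Minimizer

end BoseGas

namespace BoseGas
open Finset Function

set_option linter.unusedSectionVars false

/-! ### The number-conserving Bogoliubov trial state and its recursion. -/

section Trial

variable {G : Type} [AddCommGroup G] [DecidableEq G] {N : ℕ}

/-- The number of pairs in the modes `±p`. -/
def pairs (k : Fin N → G) (p : G) : ℕ := min (occ k p) (occ k (-p))

/-- The larger of the occupation numbers of the modes `±p`. -/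
def larger (k : Fin N → G) (p : G) : ℕ := max (occ k p) (occ k (-p))

/-- The squared coefficients of the trial state. -/
def trialWeight (Λ : Finset G) (α : G → ℝ) (k : Fin N → G) : ℝ :=
  (occ k 0).factorial * ∏ p ∈ Λ.erase 0, α p ^ pairs k p * (larger k p).factorial

/-- The configurations in the box with prescribed differences `n_p - n_{-p}`. -/
def HasImbalance (Λ : Finset G) (D : G → ℤ) (k : Fin N → G) : Prop :=
  k ∈ box N Λ ∧ ∀ p ∈ Λ.erase 0, (occ k p : ℤ) - occ k (-p) = D p

open Classical in
/-- The Bogoliubov trial state with quasi-particle numbers given by `D`. -/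
noncomputable def trial (Λ : Finset G) (α : G → ℝ) (D : G → ℤ) (k : Fin N → G) : ℝ :=
  if HasImbalance Λ D k then (-1) ^ (excited k / 2) * √(trialWeight Λ α k) else 0

theorem mem_box_comp_perm {Λ : Finset G} (k : Fin N → G) (σ : Equiv.Perm (Fin N)) :
    k ∘ σ ∈ box N Λ ↔ k ∈ box N Λ := by
  rw [mem_box, mem_box]
  exact ⟨fun h i => by simpa using h (σ.symm i), fun h i => h (σ i)⟩

theorem hasImbalance_comp_perm {Λ : Finset G} {D : G → ℤ} (k : Fin N → G)
    (σ : Equiv.Perm (Fin N)) : HasImbalance Λ D (k ∘ σ) ↔ HasImbalance Λ D k := by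
  simp only [HasImbalance, mem_box_comp_perm, occ_comp_perm]

theorem isSymm_trial (Λ : Finset G) (α : G → ℝ) (D : G → ℤ) :
    IsSymm (trial (N := N) Λ α D) := fun σ k => by
  have hw : trialWeight Λ α (k ∘ σ) = trialWeight Λ α k := by
    simp only [trialWeight, pairs, larger, occ_comp_perm]
  by_cases hk : HasImbalance Λ D k
  · rw [trial, trial, if_pos hk, if_pos ((hasImbalance_comp_perm k σ).2 hk), excited_comp_perm, hw]
  · rw [trial, trial, if_neg hk, if_neg (mt (hasImbalance_comp_perm k σ).1 hk)]

theorem trialWeight_nonneg {Λ : Finset G} {α : G → ℝ} (hα : ∀ p, 0 ≤ α p) (k : Fin N → G) :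
    0 ≤ trialWeight Λ α k :=
  mul_nonneg (by positivity) (prod_nonneg fun p _ => mul_nonneg (pow_nonneg (hα p) _)
    (by positivity))

theorem trial_sq {Λ : Finset G} {α : G → ℝ} (hα : ∀ p, 0 ≤ α p) {D : G → ℤ} {k : Fin N → G}
    (hk : HasImbalance Λ D k) : trial Λ α D k ^ 2 = trialWeight Λ α k := by
  rw [trial, if_pos hk, mul_pow, Real.sq_sqrt (trialWeight_nonneg hα k), ← pow_mul, mul_comm _ 2,
    pow_mul]
  simp

theorem hasImbalance_of_trial_ne_zero {Λ : Finset G} {α : G → ℝ} {D : G → ℤ} {k : Fin N → G}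
    (h : trial Λ α D k ≠ 0) : HasImbalance Λ D k := by
  by_contra hk
  exact h (if_neg hk)

section PairCreation

variable {k : Fin N → G} {i j : Fin N} {p : G}

theorem occ_create_self (hi : k i = 0) (hj : k j = 0) (hij : j ≠ i) (hp0 : p ≠ 0)
    (hpp : p ≠ -p) : occ (update (update k i p) j (-p)) p = occ k p + 1 := by
  rw [occ_update_of_ne _ j (q := 0) (by simp [hij, hj]) hp0 hpp, occ_update_self k i hi hp0.symm]

theorem occ_create_neg (hi : k i = 0) (hj : k j = 0) (hij : j ≠ i) (hp0 : p ≠ 0)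
    (hpp : p ≠ -p) : occ (update (update k i p) j (-p)) (-p) = occ k (-p) + 1 := by
  rw [occ_update_self _ j (q := 0) (by simp [hij, hj]) (neg_ne_zero.2 hp0).symm,
    occ_update_of_ne k i hi (neg_ne_zero.2 hp0) hpp.symm]

theorem occ_create_zero (hi : k i = 0) (hj : k j = 0) (hij : j ≠ i) (hp0 : p ≠ 0) :
    occ (update (update k i p) j (-p)) 0 + 2 = occ k 0 := by
  have h1 := occ_update_old (update k i p) j (q := 0) (p := -p) (by simp [hij, hj])
    (neg_ne_zero.2 hp0).symm
  have h2 := occ_update_old k i hi hp0.symm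
  omega

theorem occ_create_of_ne (hi : k i = 0) (hj : k j = 0) (hij : j ≠ i) {q : G} (hq : q ≠ 0)
    (hqp : q ≠ p) (hqp' : q ≠ -p) : occ (update (update k i p) j (-p)) q = occ k q := by
  rw [occ_update_of_ne _ j (q := 0) (by simp [hij, hj]) hq hqp', occ_update_of_ne k i hi hq hqp]

theorem excited_create (hi : k i = 0) (hj : k j = 0) (hij : j ≠ i) (hp0 : p ≠ 0) :
    excited (update (update k i p) j (-p)) = excited k + 2 := by
  have h1 := occ_create_zero (p := p) hi hj hij hp0
  have h2 := occ_zero_add_excited k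
  have h3 := occ_zero_add_excited (update (update k i p) j (-p))
  omega

theorem pairs_create (hi : k i = 0) (hj : k j = 0) (hij : j ≠ i) (hp0 : p ≠ 0) (hpp : p ≠ -p)
    {q : G} (hq : q ≠ 0) : pairs (update (update k i p) j (-p)) q =
      pairs k q + ((if q = p then 1 else 0) + if q = -p then 1 else 0) := by
  unfold pairs
  by_cases h1 : q = p
  · subst h1
    rw [occ_create_self hi hj hij hp0 hpp, occ_create_neg hi hj hij hp0 hpp]
    simp [hpp]
  by_cases h2 : q = -p
  · subst h2
    rw [neg_neg, occ_create_self hi hj hij hp0 hpp, occ_create_neg hi hj hij hp0 hpp]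
    simp [hpp.symm]
  · rw [occ_create_of_ne hi hj hij hq h1 h2, occ_create_of_ne hi hj hij (neg_ne_zero.2 hq)
      (fun h => h2 (by rw [← h, neg_neg])) (fun h => h1 (neg_injective h))]
    simp [h1, h2]

theorem larger_create (hi : k i = 0) (hj : k j = 0) (hij : j ≠ i) (hp0 : p ≠ 0) (hpp : p ≠ -p)
    {q : G} (hq : q ≠ 0) : larger (update (update k i p) j (-p)) q =
      larger k q + ((if q = p then 1 else 0) + if q = -p then 1 else 0) := by
  unfold larger
  by_cases h1 : q = p
  · subst h1
    rw [occ_create_self hi hj hij hp0 hpp, occ_create_neg hi hj hij hp0 hpp]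
    simp [hpp]
  by_cases h2 : q = -p
  · subst h2
    rw [neg_neg, occ_create_self hi hj hij hp0 hpp, occ_create_neg hi hj hij hp0 hpp]
    simp [hpp.symm]
  · rw [occ_create_of_ne hi hj hij hq h1 h2, occ_create_of_ne hi hj hij (neg_ne_zero.2 hq)
      (fun h => h2 (by rw [← h, neg_neg])) (fun h => h1 (neg_injective h))]
    simp [h1, h2]

theorem hasImbalance_create {Λ : Finset G} (hp : p ∈ Λ) (hp' : -p ∈ Λ) {D : G → ℤ}
    (hi : k i = 0) (hj : k j = 0) (hij : j ≠ i) (hp0 : p ≠ 0) (hpp : p ≠ -p)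
    (hk : HasImbalance Λ D k) : HasImbalance Λ D (update (update k i p) j (-p)) := by
  refine ⟨update_mem_box (update_mem_box hk.1 i hp) j hp', fun q hq => ?_⟩
  have hq0 := ne_of_mem_erase hq
  rw [← hk.2 q hq]
  by_cases h1 : q = p
  · subst h1
    rw [occ_create_self hi hj hij hp0 hpp, occ_create_neg hi hj hij hp0 hpp]
    push_cast; ring
  by_cases h2 : q = -p
  · subst h2
    rw [neg_neg, occ_create_self hi hj hij hp0 hpp, occ_create_neg hi hj hij hp0 hpp]
    push_cast; ring
  · rw [occ_create_of_ne hi hj hij hq0 h1 h2, occ_create_of_ne hi hj hij (neg_ne_zero.2 hq0)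
      (fun h => h2 (by rw [← h, neg_neg])) (fun h => h1 (neg_injective h))]

theorem hasImbalance_of_create {Λ : Finset G} (h0 : (0 : G) ∈ Λ) {D : G → ℤ} (hi : k i = 0)
    (hj : k j = 0) (hij : j ≠ i) (hp0 : p ≠ 0) (hpp : p ≠ -p)
    (hk : HasImbalance Λ D (update (update k i p) j (-p))) : HasImbalance Λ D k := by
  refine ⟨?_, fun q hq => ?_⟩
  · rw [mem_box]
    intro l
    by_cases h1 : l = i
    · rw [h1, hi]; exact h0
    by_cases h2 : l = j
    · rw [h2, hj]; exact h0
    · simpa [h1, h2] using mem_box.1 hk.1 l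
  · have hq0 := ne_of_mem_erase hq
    rw [← hk.2 q hq]
    by_cases h1 : q = p
    · subst h1
      rw [occ_create_self hi hj hij hp0 hpp, occ_create_neg hi hj hij hp0 hpp]
      push_cast; ring
    by_cases h2 : q = -p
    · subst h2
      rw [neg_neg, occ_create_self hi hj hij hp0 hpp, occ_create_neg hi hj hij hp0 hpp]
      push_cast; ring
    · rw [occ_create_of_ne hi hj hij hq0 h1 h2, occ_create_of_ne hi hj hij (neg_ne_zero.2 hq0)
        (fun h => h2 (by rw [← h, neg_neg])) (fun h => h1 (neg_injective h))]

theorem larger_neg (k : Fin N → G) (p : G) : larger k (-p) = larger k p := by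
  rw [larger, larger, neg_neg, max_comm]

/-- The weights are designed for this recursion. Multiplied by the number N!/∏ n_q! of
configurations with the same occupations, the factor n_0! cancels and the modes ±p contribute α^{2m}
M!/m!, with m pairs and larger occupation M. This is the pair statistics of a Bogoliubov state with
M - m quasi-particles, cut off only by n_0 ≥ 0. -/
theorem trialWeight_create {Λ : Finset G} (hp : p ∈ Λ) (hp' : -p ∈ Λ) {α : G → ℝ}
    (hαe : ∀ q, α (-q) = α q) (hi : k i = 0) (hj : k j = 0) (hij : j ≠ i) (hp0 : p ≠ 0)
    (hpp : p ≠ -p) :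
    (occ k 0 : ℝ) * (occ k 0 - 1) * trialWeight Λ α (update (update k i p) j (-p)) =
      (α p * (larger k p + 1)) ^ 2 * trialWeight Λ α k := by
  have h0 := occ_create_zero (p := p) hi hj hij hp0
  unfold trialWeight
  have e1 : ((occ k 0).factorial : ℝ) = (occ k 0 : ℝ) * (occ k 0 - 1) *
      (occ (update (update k i p) j (-p)) 0).factorial := by
    rw [← h0, Nat.factorial_succ, Nat.factorial_succ]
    push_cast; ring
  -- The product in the weight runs over both `p` and `-p`; each of these two factors gains α_p (M +
  -- 1), hence the square in the result.
  have e2 : ∀ q ∈ Λ.erase 0, α q ^ pairs (update (update k i p) j (-p)) q *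
      ((larger (update (update k i p) j (-p)) q).factorial : ℝ) =
      (α q ^ pairs k q * (larger k q).factorial) *
        ((if q = p then α p * (larger k p + 1) else 1) *
          (if q = -p then α p * (larger k p + 1) else 1)) := by
    intro q hq
    rw [pairs_create hi hj hij hp0 hpp (ne_of_mem_erase hq),
      larger_create hi hj hij hp0 hpp (ne_of_mem_erase hq)]
    by_cases h1 : q = p
    · subst h1
      simp only [if_true, if_neg hpp, Nat.add_zero, pow_succ, Nat.factorial_succ]
      push_cast; ring
    by_cases h2 : q = -p
    · subst h2
      simp only [if_true, if_neg hpp.symm, Nat.zero_add, pow_succ, Nat.factorial_succ, hαe,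
        larger_neg]
      push_cast; ring
    · simp [h1, h2]
  rw [prod_congr rfl e2, prod_mul_distrib,
    prod_mul_distrib (f := fun q => if q = p then α p * ((larger k p : ℝ) + 1) else 1),
    prod_ite_eq', prod_ite_eq', if_pos (mem_erase.2 ⟨hp0, hp⟩), if_pos (mem_erase.2 ⟨neg_ne_zero.2 hp0, hp'⟩), e1]
  ring

theorem two_le_occ_zero (hi : k i = 0) (hj : k j = 0) (hij : j ≠ i) : 2 ≤ occ k 0 := by
  rw [occ, ← card_pair hij]
  refine card_le_card fun l hl => ?_
  simp only [mem_insert, mem_singleton] at hl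
  rcases hl with rfl | rfl <;> simpa

theorem trial_create_sq {Λ : Finset G} (hp : p ∈ Λ) (hp' : -p ∈ Λ) (h0 : (0 : G) ∈ Λ)
    {α : G → ℝ} (hα : ∀ q, 0 ≤ α q) (hαe : ∀ q, α (-q) = α q) (D : G → ℤ) (hi : k i = 0)
    (hj : k j = 0) (hij : j ≠ i) (hp0 : p ≠ 0) (hpp : p ≠ -p) :
    (occ k 0 : ℝ) * (occ k 0 - 1) * trial Λ α D (update (update k i p) j (-p)) ^ 2 =
      (α p * (larger k p + 1)) ^ 2 * trial Λ α D k ^ 2 := by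
  by_cases hk : HasImbalance Λ D k
  · rw [trial_sq hα hk, trial_sq hα (hasImbalance_create hp hp' hi hj hij hp0 hpp hk),
      trialWeight_create hp hp' hαe hi hj hij hp0 hpp]
  · rw [trial, trial, if_neg hk,
      if_neg fun h => hk (hasImbalance_of_create h0 hi hj hij hp0 hpp h)]
    simp

/-- Pair creation raises `excited k / 2` by one, so neighbouring coefficients have opposite signs.
The weight recursion expresses their product through a single squared coefficient, so that pairing
expectations become diagonal. -/
theorem trial_mul_create {Λ : Finset G} (hp : p ∈ Λ) (hp' : -p ∈ Λ)
    {α : G → ℝ} (hα : ∀ q, 0 ≤ α q) (hαe : ∀ q, α (-q) = α q) (D : G → ℤ) (hi : k i = 0)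
    (hj : k j = 0) (hij : j ≠ i) (hp0 : p ≠ 0) (hpp : p ≠ -p) :
    (occ k 0 : ℝ) * (occ k 0 - 1) *
        (trial Λ α D k * trial Λ α D (update (update k i p) j (-p))) =
      -(√((occ k 0 : ℝ) * (occ k 0 - 1)) * (α p * (larger k p + 1)) * trial Λ α D k ^ 2) := by
  by_cases hk : HasImbalance Λ D k
  · have hk' := hasImbalance_create hp hp' hi hj hij hp0 hpp hk
    have hw := trialWeight_create (Λ := Λ) (α := α) hp hp' hαe hi hj hij hp0 hpp
    rw [trial_sq hα hk, trial, trial, if_pos hk, if_pos hk', excited_create hi hj hij hp0]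
    set W := trialWeight Λ α k
    set W' := trialWeight Λ α (update (update k i p) j (-p))
    have hW : 0 ≤ W := trialWeight_nonneg hα k
    have hW' : 0 ≤ W' := trialWeight_nonneg hα _
    have h2 : (2 : ℝ) ≤ occ k 0 := by exact_mod_cast two_le_occ_zero hi hj hij
    set b := (occ k 0 : ℝ) * (occ k 0 - 1)
    have hb : 0 ≤ b := mul_nonneg (by linarith) (by linarith)
    have hx : 0 ≤ α p * (larger k p + 1) := mul_nonneg (hα p) (by positivity)
    have h3 : √b * √W' = α p * (larger k p + 1) * √W := by
      rw [← Real.sqrt_mul hb, hw, Real.sqrt_mul (sq_nonneg _), Real.sqrt_sq hx]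
    have h4 : ((-1 : ℝ) ^ (excited k / 2)) * (-1) ^ (excited k / 2) = 1 := by
      rw [← mul_pow]; simp
    have h5 : (excited k + 2) / 2 = excited k / 2 + 1 := by omega
    rw [h5, pow_succ]
    have h6 := Real.mul_self_sqrt hb
    have h7 := Real.mul_self_sqrt hW
    calc b * ((-1) ^ (excited k / 2) * √W * ((-1) ^ (excited k / 2) * -1 * √W'))
        = -(b * (((-1 : ℝ) ^ (excited k / 2)) * (-1) ^ (excited k / 2)) * √W * √W') := by ring
      _ = -(√b * √b * √W * √W') := by rw [h4, h6]; ring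
      _ = -(√b * √W * (√b * √W')) := by ring
      _ = -(√b * (α p * (larger k p + 1)) * (√W * √W)) := by rw [h3]; ring
      _ = _ := by rw [h7]
  · rw [trial, if_neg hk]
    simp

end PairCreation

theorem sum_pairs_const (k : Fin N → G) (x : ℝ) :
    ∑ i with k i = (0 : G), ∑ j with k j = 0 ∧ j ≠ i, x = (occ k 0 : ℝ) * (occ k 0 - 1) * x := by
  have : ∀ i ∈ univ.filter (fun i => k i = (0 : G)), ∑ j with k j = 0 ∧ j ≠ i, x =
      ((occ k 0 : ℝ) - 1) * x := by
    intro i hi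
    have e : (univ.filter fun j => k j = 0 ∧ j ≠ i) = (univ.filter fun j => k j = 0).erase i := by
      ext j; simp [and_comm]
    rw [sum_const, nsmul_eq_mul, e, card_erase_of_mem hi, Nat.cast_sub (card_pos.2 ⟨i, hi⟩), occ]
    simp
  rw [sum_congr rfl this, sum_const, nsmul_eq_mul, ← occ, mul_assoc]

theorem pairing_trial {Λ : Finset G} {p : G} (hp : p ∈ Λ) (hp' : -p ∈ Λ) (h0 : (0 : G) ∈ Λ)
    {α : G → ℝ} (hα : ∀ q, 0 ≤ α q) (hαe : ∀ q, α (-q) = α q) (D : G → ℤ) (hp0 : p ≠ 0)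
    (hpp : p ≠ -p) :
    pairing Λ p (trial (N := N) Λ α D) =
      -ev Λ (fun k : Fin N → G => √((occ k 0 : ℝ) * (occ k 0 - 1)) * (α p * (larger k p + 1)))
        (trial Λ α D) := by
  rw [pairing, sum_hop_mul_hop hp h0 hp0, ev, ← sum_neg_distrib]
  refine sum_congr rfl fun k _ => ?_
  by_cases h2 : 2 ≤ occ k 0
  · have h2' : (2 : ℝ) ≤ occ k 0 := by exact_mod_cast h2
    have hb : 0 < (occ k 0 : ℝ) * (occ k 0 - 1) := mul_pos (by linarith) (by linarith)
    have hb1 : (occ k 0 : ℝ) - 1 ≠ 0 := by linarith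
    rw [sum_congr rfl (g := fun i => ∑ j with k j = 0 ∧ j ≠ i,
        -(√((occ k 0 : ℝ) * (occ k 0 - 1)) * (α p * (larger k p + 1)) * trial Λ α D k ^ 2)
          / ((occ k 0 : ℝ) * (occ k 0 - 1))), sum_pairs_const]
    · field_simp
    · intro i hi
      refine sum_congr rfl fun j hj => ?_
      simp only [mem_filter, mem_univ, true_and] at hi hj
      rw [eq_div_iff hb.ne', mul_comm]
      exact trial_mul_create hp hp' hα hαe D hi hj.1 hj.2 hp0 hpp
  · have e0 : √((occ k 0 : ℝ) * (occ k 0 - 1)) = 0 := by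
      have : occ k 0 = 0 ∨ occ k 0 = 1 := by omega
      rcases this with h | h <;> simp [h]
    rw [e0]
    simp only [zero_mul, neg_zero]
    refine sum_eq_zero fun i hi => sum_eq_zero fun j hj => ?_
    simp only [mem_filter, mem_univ, true_and] at hi hj
    exact absurd (two_le_occ_zero hi hj.1 hj.2) h2

/-- Recursion inequality for the moments of the number of pairs in the trial state. -/
theorem ev_pairs_mul_le {Λ : Finset G} {p : G} (hp : p ∈ Λ) (hp' : -p ∈ Λ) (h0 : (0 : G) ∈ Λ)
    {α : G → ℝ} (hα : ∀ q, 0 ≤ α q) (hαe : ∀ q, α (-q) = α q) (D : G → ℤ) (hp0 : p ≠ 0)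
    (hpp : p ≠ -p) {h h' : (Fin N → G) → ℝ} (hh' : ∀ k, 0 ≤ h' k)
    (hh : ∀ k i j, k i = 0 → k j = 0 → j ≠ i → h (update (update k i p) j (-p)) = h' k) :
    ev Λ (fun k => pairs k p * h k) (trial Λ α D) ≤
      α p ^ 2 * ev Λ (fun k => (larger k p + 1) * h' k) (trial Λ α D) := by
  -- Since `pairs` times `larger` is n_p n_{-p}, dividing by `larger` brings the expectation into
  -- the form that pair creation counts.
  have e1 : ev Λ (fun k => pairs k p * h k) (trial Λ α D) = ∑ k ∈ box N Λ,
      (occ k p : ℝ) * occ k (-p) * (h k * trial Λ α D k ^ 2 / larger k p) := by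
    refine sum_congr rfl fun k _ => ?_
    have : (occ k p : ℝ) * occ k (-p) = pairs k p * larger k p := by
      rw [pairs, larger]; exact_mod_cast (min_mul_max _ _).symm
    rw [this]
    by_cases hl : larger k p = 0
    · have : pairs k p = 0 := by
        have : pairs k p ≤ larger k p := min_le_max
        omega
      simp [hl, this]
    · have : (larger k p : ℝ) ≠ 0 := by exact_mod_cast hl
      field_simp
  rw [e1, sum_occ_mul_occ hp hp' h0 hp0 hpp, ← ev_smul]
  refine sum_le_sum fun k _ => ?_
  by_cases h2 : 2 ≤ occ k 0
  · have h2' : (2 : ℝ) ≤ occ k 0 := by exact_mod_cast h2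
    have hb : 0 < (occ k 0 : ℝ) * (occ k 0 - 1) := mul_pos (by linarith) (by linarith)
    have hb1 : (occ k 0 : ℝ) - 1 ≠ 0 := by linarith
    rw [sum_congr rfl (g := fun i => ∑ j with k j = 0 ∧ j ≠ i,
        h' k * ((α p * (larger k p + 1)) ^ 2 * trial Λ α D k ^ 2 /
          ((occ k 0 : ℝ) * (occ k 0 - 1))) / (larger k p + 1)), sum_pairs_const]
    · refine le_of_eq ?_
      have : (larger k p : ℝ) + 1 ≠ 0 := by positivity
      field_simp
    · intro i hi
      refine sum_congr rfl fun j hj => ?_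
      simp only [mem_filter, mem_univ, true_and] at hi hj
      rw [hh k i j hi hj.1 hj.2, larger_create hi hj.1 hj.2 hp0 hpp hp0, if_pos rfl, if_neg hpp,
        ← trial_create_sq hp hp' h0 hα hαe D hi hj.1 hj.2 hp0 hpp]
      push_cast
      field_simp
  -- Configurations from which no pair can be created contribute nothing on the left. They are the
  -- only source of inequality.
  · rw [sum_eq_zero]
    · have := hh' k
      positivity
    · intro i hi
      refine sum_eq_zero fun j hj => ?_
      simp only [mem_filter, mem_univ, true_and] at hi hj
      exact absurd (two_le_occ_zero hi hj.1 hj.2) h2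

end Trial

end BoseGas

namespace BoseGas
open Finset Function

set_option linter.unusedSectionVars false

/-! ### Bogoliubov coefficients, parity of n₊, and momentum transfers in the trial state. -/

section TrialEnergy

variable {G : Type} [AddCommGroup G] [DecidableEq G] {N : ℕ}

/-- The coefficient of the Bogoliubov transformation. -/
noncomputable def bogCoeff (t u : G → ℝ) (p : G) : ℝ := (t p + u p - dispersion t u p) / u p

/-- The energy form of a function supported in the box, without the constant term; the sum is over
the momentum transfers in `M`. -/
noncomputable def upForm (t u : G → ℝ) (Λ M : Finset G) (c : (Fin N → G) → ℝ) : ℝ :=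
  ev Λ (kin t) c + (2 * ((N : ℝ) - 1))⁻¹ * ∑ p ∈ M, u p * (∑ k ∈ box N Λ, trans p c k ^ 2
    - ev Λ (fun k => (#{i | k i + p ∈ Λ} : ℝ)) c)

theorem bogCoeff_nonneg {t u : G → ℝ} {p : G} (ht : 0 ≤ t p) (hu : 0 ≤ u p) :
    0 ≤ bogCoeff t u p :=
  div_nonneg (by linarith [dispersion_le ht hu]) hu

theorem mul_bogCoeff {t u : G → ℝ} {p : G} (ht : 0 ≤ t p) (hu : 0 ≤ u p) :
    u p * bogCoeff t u p = t p + u p - dispersion t u p := by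
  rcases hu.eq_or_lt with h | h
  · have h1 := dispersion_le ht hu
    have h2 := le_dispersion ht hu
    rw [← h] at h1 ⊢
    linarith
  · rw [bogCoeff]; field_simp

theorem bogCoeff_le_one {t u : G → ℝ} {p : G} (ht : 0 ≤ t p) (hu : 0 ≤ u p) :
    bogCoeff t u p ≤ 1 :=
  div_le_one_of_le₀ (by linarith [le_dispersion ht hu]) hu

/-- This is (t + u)² - e² = u² divided by u². For u = 0 the convention x / 0 = 0 gives the
coefficient zero, which is consistent because then e = t. -/
theorem bogCoeff_sq_mul {t u : G → ℝ} {p : G} (ht : 0 ≤ t p) (hu : 0 ≤ u p) :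
    bogCoeff t u p ^ 2 * (t p + u p + dispersion t u p) = t p + u p - dispersion t u p := by
  rcases hu.eq_or_lt with h | h
  · have h1 := dispersion_le ht hu
    have h2 := le_dispersion ht hu
    rw [bogCoeff, ← h] at *
    simp
    linarith
  · rw [bogCoeff, div_pow, div_mul_eq_mul_div, div_eq_iff (by positivity)]
    have := dispersion_sq ht hu
    have e : (t p + u p) ^ 2 - dispersion t u p ^ 2 = u p ^ 2 := by rw [this]; ring
    linear_combination (t p + u p - dispersion t u p) * e

theorem ev_mono_supp {Λ : Finset G} {f g c : (Fin N → G) → ℝ}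
    (h : ∀ k, c k ≠ 0 → f k ≤ g k) : ev Λ f c ≤ ev Λ g c := by
  refine sum_le_sum fun k _ => ?_
  by_cases hk : c k = 0
  · simp [hk]
  · exact mul_le_mul_of_nonneg_right (h k hk) (sq_nonneg _)

theorem ev_congr_supp {Λ : Finset G} {f g c : (Fin N → G) → ℝ}
    (h : ∀ k, c k ≠ 0 → f k = g k) : ev Λ f c = ev Λ g c :=
  le_antisymm (ev_mono_supp fun k hk => (h k hk).le) (ev_mono_supp fun k hk => (h k hk).ge)

theorem HasImbalance.larger_eq {Λ : Finset G} {D : G → ℤ} {k : Fin N → G}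
    (hk : HasImbalance Λ D k) {p : G} (hp : p ∈ Λ.erase 0) :
    (larger k p : ℝ) = |(D p : ℝ)| + pairs k p := by
  have h : (larger k p : ℤ) = |D p| + pairs k p := by
    rw [← hk.2 p hp, larger, pairs]
    rcases le_total (occ k p) (occ k (-p)) with h | h
    · rw [max_eq_right h, min_eq_left h, abs_of_nonpos (by omega)]; omega
    · rw [max_eq_left h, min_eq_right h, abs_of_nonneg (by omega)]; omega
  exact_mod_cast h

theorem HasImbalance.occ_add_occ {Λ : Finset G} {D : G → ℤ} {k : Fin N → G}
    (hk : HasImbalance Λ D k) {p : G} (hp : p ∈ Λ.erase 0) :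
    (occ k p : ℝ) + occ k (-p) = |(D p : ℝ)| + 2 * pairs k p := by
  have h : (occ k p : ℝ) + occ k (-p) = pairs k p + larger k p := by
    rw [pairs, larger]; exact_mod_cast (min_add_max _ _).symm
  rw [h, hk.larger_eq hp]; ring

theorem HasImbalance.excited_eq {Λ : Finset G} (hneg : ∀ p ∈ Λ, -p ∈ Λ) {D : G → ℤ}
    {k : Fin N → G} (hk : HasImbalance Λ D k) :
    (excited k : ℝ) = 1 / 2 * ∑ p ∈ Λ.erase 0, |(D p : ℝ)| + ∑ p ∈ Λ.erase 0, (pairs k p : ℝ) := by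
  have h1 := sum_occ_add_occ_neg hneg (f := fun _ => 1) (fun _ => rfl) k
  simp only [one_mul] at h1
  rw [sum_congr rfl fun p hp => hk.occ_add_occ hp, sum_add_distrib, ← mul_sum] at h1
  rw [excited_eq_sum_occ hk.1]
  push_cast
  linarith

/-- Equal imbalances mean that the occupations of the two configurations differ by the same amount
at `p` and at `-p`. The differences therefore cancel in pairs modulo two. -/
theorem HasImbalance.excited_mod_two {Λ : Finset G} (hneg : ∀ p ∈ Λ, -p ∈ Λ)
    (hpp : ∀ p : G, p ≠ 0 → p ≠ -p) {D : G → ℤ} {k l : Fin N → G} (hk : HasImbalance Λ D k)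
    (hl : HasImbalance Λ D l) : excited k % 2 = excited l % 2 := by
  have h : ∑ p ∈ Λ.erase 0, ((occ k p : ZMod 2) - occ l p) = 0 := by
    refine sum_involution (fun p _ => -p) ?_ ?_ ?_ ?_
    · intro p hp
      have e : (occ k p : ℤ) - occ l p = occ k (-p) - occ l (-p) := by
        linarith [hk.2 p hp, hl.2 p hp]
      have e' : (occ k p : ZMod 2) - occ l p = occ k (-p) - occ l (-p) := by
        exact_mod_cast congrArg (Int.cast : ℤ → ZMod 2) e
      rw [e', CharTwo.add_self_eq_zero]
    · intro p hp _
      exact (hpp p (ne_of_mem_erase hp)).symm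
    · intro p hp
      exact mem_erase.2 ⟨neg_ne_zero.2 (ne_of_mem_erase hp), hneg p (mem_of_mem_erase hp)⟩
    · intro p _; exact neg_neg p
  rw [sum_sub_distrib, sub_eq_zero] at h
  have h2 : ((excited k : ℕ) : ZMod 2) = (excited l : ℕ) := by
    rw [excited_eq_sum_occ hk.1, excited_eq_sum_occ hl.1]
    exact_mod_cast h
  exact (ZMod.natCast_eq_natCast_iff' _ _ _).1 h2

/-- For functions supported on configurations with a fixed parity of the number of excited
particles, the terms of third order vanish. -/
theorem trans_sq_of_parity {p : G} (hp : p ≠ 0) {c : (Fin N → G) → ℝ} {π : ℕ}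
    (hc : ∀ k, c k ≠ 0 → excited k % 2 = π) (k : Fin N → G) :
    trans p c k ^ 2 = (hop p 0 c k + hop 0 (-p) c k) ^ 2 + transExc p c k ^ 2 := by
  rw [trans_eq hp]
  by_cases hk : excited k % 2 = π
  · have h1 : hop p 0 c k = 0 := by
      refine sum_eq_zero fun i hi => ?_
      simp only [mem_filter, mem_univ, true_and] at hi
      by_contra h
      have := hc _ h
      have := excited_update_to_zero k i (by rwa [hi])
      omega
    have h2 : hop 0 (-p) c k = 0 := by
      refine sum_eq_zero fun i hi => ?_
      simp only [mem_filter, mem_univ, true_and] at hi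
      by_contra h
      have := hc _ h
      have := excited_update_from_zero k i hi (neg_ne_zero.2 hp)
      omega
    rw [h1, h2]; ring
  · have h1 : transExc p c k = 0 := by
      refine sum_eq_zero fun i hi => ?_
      simp only [mem_filter, mem_univ, true_and] at hi
      by_contra h
      have h2 := hc _ h
      rw [excited_update_of_ne k i hi.1 (sub_ne_zero.2 hi.2)] at h2
      exact hk h2
    rw [h1]; ring

/-- Parity removes the cubic cross terms. The subtracted count includes all particles in the zero
mode, because p ∈ Λ, and so cancels the n_0 from n_0(n_p + 1). -/
theorem sum_trans_sq_trial_le {Λ : Finset G} {p : G} (hp : p ∈ Λ) (hp' : -p ∈ Λ)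
    (h0 : (0 : G) ∈ Λ) (hp0 : p ≠ 0) {c : (Fin N → G) → ℝ} (hc : IsSymm c)
    (hs : ∀ k, k ∉ box N Λ → c k = 0) {π : ℕ} (hπ : ∀ k, c k ≠ 0 → excited k % 2 = π) :
    ∑ k ∈ box N Λ, trans p c k ^ 2 - ev Λ (fun k => (#{i | k i + p ∈ Λ} : ℝ)) c ≤
      ev Λ (fun k => (occ k 0 : ℝ) * (occ k p + occ k (-p)) + occ k (-p)) c
        + 2 * pairing Λ p c + ev Λ (fun k => (excited k : ℝ) ^ 2) c := by
  have e1 : ∑ k ∈ box N Λ, trans p c k ^ 2 = ∑ k ∈ box N Λ, hop p 0 c k ^ 2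
      + ∑ k ∈ box N Λ, hop 0 (-p) c k ^ 2 + 2 * pairing Λ p c
      + ∑ k ∈ box N Λ, transExc p c k ^ 2 := by
    rw [pairing, mul_sum, ← sum_add_distrib, ← sum_add_distrib, ← sum_add_distrib]
    refine sum_congr rfl fun k _ => ?_
    rw [trans_sq_of_parity hp0 hπ]; ring
  rw [e1, sum_create_sq hp h0 hp0 hc, sum_annihilate_sq hp' h0 (neg_ne_zero.2 hp0) hc]
  have h2 : ∑ k ∈ box N Λ, transExc p c k ^ 2 ≤ ev Λ (fun k => (excited k : ℝ) ^ 2) c :=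
    sum_transExc_sq_le (p := p) hs
  have h3 : ev Λ (fun k => (occ k 0 : ℝ)) c ≤ ev Λ (fun k => (#{i | k i + p ∈ Λ} : ℝ)) c := by
    refine ev_mono (fun k _ => ?_) c
    norm_cast
    refine card_le_card fun i hi => ?_
    simp only [mem_filter, mem_univ, true_and] at hi ⊢
    rw [hi, zero_add]; exact hp
  have e2 : ev Λ (fun k => (occ k 0 : ℝ) * (occ k p + 1)) c
      + ev Λ (fun k => (occ k (-p) : ℝ) * (occ k 0 + 1)) c =
      ev Λ (fun k => (occ k 0 : ℝ) * (occ k p + occ k (-p)) + occ k (-p)) c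
        + ev Λ (fun k => (occ k 0 : ℝ)) c := by
    rw [← ev_add, ← ev_add]
    exact ev_congr (fun k _ => by ring) c
  linarith

/-- A transfer `p` outside Λ cannot involve the zero mode, as one of the modes ±p outside Λ would
have to be occupied. Only `transExc` remains. -/
theorem sum_trans_sq_le_of_notMem {Λ : Finset G} {p : G} (hp : p ∉ Λ)
    (hneg : ∀ p ∈ Λ, -p ∈ Λ) (hp0 : p ≠ 0) {c : (Fin N → G) → ℝ}
    (hs : ∀ k, k ∉ box N Λ → c k = 0) :
    ∑ k ∈ box N Λ, trans p c k ^ 2 - ev Λ (fun k => (#{i | k i + p ∈ Λ} : ℝ)) c ≤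
      ev Λ (fun k => (excited k : ℝ) ^ 2) c := by
  have e1 : ∑ k ∈ box N Λ, trans p c k ^ 2 = ∑ k ∈ box N Λ, transExc p c k ^ 2 := by
    refine sum_congr rfl fun k hk => ?_
    have h1 : hop p 0 c k = 0 := by
      refine sum_eq_zero fun i hi => ?_
      simp only [mem_filter, mem_univ, true_and] at hi
      exact absurd (hi ▸ mem_box.1 hk i) hp
    have h2 : hop 0 (-p) c k = 0 := by
      refine sum_eq_zero fun i hi => hs _ fun h => hp ?_
      have := mem_box.1 h i
      rw [update_self] at this
      simpa using hneg _ this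
    rw [trans_eq hp0, h1, h2, zero_add, zero_add]
  have h2 : ∑ k ∈ box N Λ, transExc p c k ^ 2 ≤ ev Λ (fun k => (excited k : ℝ) ^ 2) c :=
    sum_transExc_sq_le (p := p) hs
  have h3 : 0 ≤ ev Λ (fun k => (#{i | k i + p ∈ Λ} : ℝ)) c := ev_nonneg (fun k _ => by positivity) c
  linarith

/-- The hypothesis on `g` closes the recursion to x ≤ α²(x + y). Multiplying by t + u + e turns this
into the claim without any division by 1 - α². -/
theorem ev_pairs_le {Λ : Finset G} {p : G} (hp : p ∈ Λ) (hp' : -p ∈ Λ) (h0 : (0 : G) ∈ Λ)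
    {t u : G → ℝ} (ht : ∀ p, 0 ≤ t p) (hu : ∀ p, 0 ≤ u p) (hte : ∀ p, t (-p) = t p)
    (hue : ∀ p, u (-p) = u p) (D : G → ℤ) (hp0 : p ≠ 0) (hpp : p ≠ -p)
    {h h' g : (Fin N → G) → ℝ} (hh' : ∀ k, 0 ≤ h' k)
    (hh : ∀ k i j, k i = 0 → k j = 0 → j ≠ i → h (update (update k i p) j (-p)) = h' k)
    (hg : ∀ k, HasImbalance Λ D k → (larger k p + 1) * h' k = pairs k p * h k + g k) :
    2 * dispersion t u p * ev Λ (fun k => pairs k p * h k) (trial Λ (bogCoeff t u) D) ≤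
      (t p + u p - dispersion t u p) * ev Λ g (trial Λ (bogCoeff t u) D) := by
  have hαe : ∀ q, bogCoeff t u (-q) = bogCoeff t u q := by
    intro q; simp only [bogCoeff, dispersion, hte, hue]
  have h1 := ev_pairs_mul_le hp hp' h0 (fun q => bogCoeff_nonneg (ht q) (hu q)) hαe D hp0 hpp hh' hh
  rw [ev_congr_supp (f := fun k => (larger k p + 1) * h' k)
    (g := fun k => pairs k p * h k + g k)
    (fun k hk => hg k (hasImbalance_of_trial_ne_zero hk)), ev_add] at h1
  have h2 := bogCoeff_sq_mul (ht p) (hu p)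
  have h3 : 0 ≤ t p + u p + dispersion t u p :=
    add_nonneg (add_nonneg (ht p) (hu p)) (dispersion_nonneg _ _ _)
  have h4 := mul_le_mul_of_nonneg_left h1 h3
  set x := ev Λ (fun k => pairs k p * h k) (trial Λ (bogCoeff t u) D)
  set y := ev Λ g (trial Λ (bogCoeff t u) D)
  have h5 : (t p + u p + dispersion t u p) * (bogCoeff t u p ^ 2 * (x + y)) =
    (t p + u p - dispersion t u p) * (x + y) := by rw [← h2]; ring
  linarith

end TrialEnergy

end BoseGas

namespace BoseGas
open Finset Function

set_option linter.unusedSectionVars false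

/-! ### Moments, energy and norm of the trial state. -/

section TrialBound

variable {G : Type} [AddCommGroup G] [DecidableEq G] {N : ℕ}

theorem two_mul_le_of_dispersion {t u : G → ℝ} {p : G} (ht : 1 ≤ t p) (hu : 0 ≤ u p) {x y : ℝ}
    (hx : 0 ≤ x) (hy : 0 ≤ y)
    (h : 2 * dispersion t u p * x ≤ (t p + u p - dispersion t u p) * y) : 2 * x ≤ u p * y := by
  have h1 := le_dispersion (zero_le_one.trans ht) hu
  have h2 : (t p + u p - dispersion t u p) * y ≤ u p * y :=
    mul_le_mul_of_nonneg_right (by linarith) hy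
  have h3 : 2 * x ≤ 2 * dispersion t u p * x := mul_le_mul_of_nonneg_right (by linarith) hx
  linarith

/-- The recursion with h = 1: the mean number of pairs is at most (|D_p| + 1) α²/(1 - α²), the value
in the untruncated Bogoliubov state. -/
theorem ev_pairs_trial_le {Λ : Finset G} {p : G} (hp : p ∈ Λ.erase 0) (hp' : -p ∈ Λ)
    (h0 : (0 : G) ∈ Λ) {t u : G → ℝ} (ht : ∀ p, 0 ≤ t p) (hu : ∀ p, 0 ≤ u p)
    (hte : ∀ p, t (-p) = t p) (hue : ∀ p, u (-p) = u p) (D : G → ℤ) (hpp : p ≠ -p) :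
    2 * dispersion t u p *
        ev Λ (fun k : Fin N → G => (pairs k p : ℝ)) (trial Λ (bogCoeff t u) D) ≤
      (t p + u p - dispersion t u p) *
        ((|(D p : ℝ)| + 1) * ev Λ (fun _ : Fin N → G => 1) (trial Λ (bogCoeff t u) D)) := by
  have h := ev_pairs_le (N := N) (mem_of_mem_erase hp) hp' h0 ht hu hte hue D (ne_of_mem_erase hp)
    hpp (h := fun _ => 1) (h' := fun _ => 1) (g := fun _ => |(D p : ℝ)| + 1)
    (fun _ => zero_le_one) (fun _ _ _ _ _ _ => rfl)
    (fun k hk => by rw [hk.larger_eq hp]; ring)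
  rw [ev_const Λ (|(D p : ℝ)| + 1)] at h
  simpa using h

theorem sum_mul_abs_le {Λ : Finset G} {u : G → ℝ} (hu : ∀ p, 0 ≤ u p) {U : ℝ}
    (hU : ∑ p ∈ Λ, u p ≤ U) {x : G → ℝ} (hx : ∀ p, 0 ≤ x p) :
    ∑ p ∈ Λ, u p * x p ≤ U * ∑ p ∈ Λ, x p := by
  rw [mul_sum]
  exact sum_le_sum fun p hp => mul_le_mul_of_nonneg_right
    ((single_le_sum (fun q _ => hu q) hp).trans hU) (hx p)

/-- The second moment of the number of excited particles in the trial state. -/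
theorem trial_moment {Λ : Finset G} (h0 : (0 : G) ∈ Λ) (hneg : ∀ p ∈ Λ, -p ∈ Λ)
    (hpp : ∀ p : G, p ≠ 0 → p ≠ -p) {t u : G → ℝ} (ht0 : t 0 = 0) (ht1 : ∀ p, p ≠ 0 → 1 ≤ t p)
    (hte : ∀ p, t (-p) = t p) (hu : ∀ p, 0 ≤ u p) (hue : ∀ p, u (-p) = u p) {U : ℝ}
    (hU : ∑ p ∈ Λ.erase 0, u p ≤ U) (D : G → ℤ) :
    ev Λ (fun k : Fin N → G => (excited k : ℝ) ^ 2) (trial Λ (bogCoeff t u) D) ≤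
      (2 + 4 * U * (U + 1)) * (1 / 2 * ∑ p ∈ Λ.erase 0, |(D p : ℝ)| + 1) ^ 2 *
        ev Λ (fun _ : Fin N → G => 1) (trial Λ (bogCoeff t u) D) := by
  have ht : ∀ p, 0 ≤ t p := fun p => by
    by_cases hp : p = 0
    · rw [hp, ht0]
    · exact zero_le_one.trans (ht1 p hp)
  have hUnn : 0 ≤ U := (sum_nonneg fun p _ => hu p).trans hU
  set c := trial (N := N) Λ (bogCoeff t u) D with hc
  set Z := ev Λ (fun _ : Fin N → G => 1) c
  have hZ : 0 ≤ Z := ev_nonneg (fun _ _ => zero_le_one) c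
  set n := 1 / 2 * ∑ p ∈ Λ.erase 0, |(D p : ℝ)| with hn
  have hn0 : 0 ≤ n := by positivity
  set J : (Fin N → G) → ℝ := fun k => ∑ p ∈ Λ.erase 0, (pairs k p : ℝ) with hJ
  have hJ0 : ∀ k, 0 ≤ J k := fun k => sum_nonneg fun p _ => by positivity
  have hx0 : ∀ p, 0 ≤ ev Λ (fun k : Fin N → G => (pairs k p : ℝ)) c := fun p =>
    ev_nonneg (fun k _ => by positivity) c
  have hJsum : ev Λ J c = ∑ p ∈ Λ.erase 0, ev Λ (fun k : Fin N → G => (pairs k p : ℝ)) c := by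
    rw [hJ, ev_sum]
  have hJ0' : 0 ≤ ev Λ J c := ev_nonneg (fun k _ => hJ0 k) c
  have hD2 : ∑ p ∈ Λ.erase 0, u p * (|(D p : ℝ)| + 1) ≤ 2 * U * (n + 1) := by
    have := sum_mul_abs_le hu hU (x := fun p => |(D p : ℝ)|) fun p => abs_nonneg _
    simp only [mul_add, mul_one, sum_add_distrib]
    rw [hn]
    linarith
  have hJ1 : ev Λ J c ≤ U * (n + 1) * Z := by
    have h1 : ∀ p ∈ Λ.erase 0, 2 * ev Λ (fun k : Fin N → G => (pairs k p : ℝ)) c ≤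
        u p * (|(D p : ℝ)| + 1) * Z := by
      intro p hp
      have h2 := ev_pairs_trial_le (N := N) hp (hneg p (mem_of_mem_erase hp)) h0 ht hu hte hue D
        (hpp p (ne_of_mem_erase hp))
      rw [mul_assoc]
      exact two_mul_le_of_dispersion (ht1 p (ne_of_mem_erase hp)) (hu p) (hx0 p)
        (mul_nonneg (by positivity) hZ) h2
    have h2 := sum_le_sum h1
    rw [← mul_sum, ← hJsum, ← sum_mul] at h2
    have h3 := mul_le_mul_of_nonneg_right hD2 hZ
    linarith
  -- The recursion with h = J, then summed over `p`. Creating one pair raises `J` by two, because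
  -- `J` counts it at `p` and at `-p`.
  have hJ2 : ev Λ (fun k => J k ^ 2) c ≤ 2 * U * (U + 1) * (n + 1) ^ 2 * Z := by
    have h1 : ∀ p ∈ Λ.erase 0, 2 * ev Λ (fun k => (pairs k p : ℝ) * J k) c ≤
        u p * (2 * ev Λ (fun k : Fin N → G => (pairs k p : ℝ)) c
          + (|(D p : ℝ)| + 1) * (ev Λ J c + 2 * Z)) := by
      intro p hp
      have hp0 := ne_of_mem_erase hp
      have h2 := ev_pairs_le (N := N) (mem_of_mem_erase hp) (hneg p (mem_of_mem_erase hp)) h0 ht hu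
        hte hue D hp0 (hpp p hp0) (h := J) (h' := fun k => J k + 2)
        (g := fun k => 2 * (pairs k p : ℝ) + (|(D p : ℝ)| + 1) * (J k + 2))
        (fun k => add_nonneg (hJ0 k) zero_le_two) ?_
        (fun k hk => by rw [hk.larger_eq hp]; ring)
      · have e : ev Λ (fun k => 2 * (pairs k p : ℝ) + (|(D p : ℝ)| + 1) * (J k + 2)) c =
            2 * ev Λ (fun k : Fin N → G => (pairs k p : ℝ)) c
              + (|(D p : ℝ)| + 1) * (ev Λ J c + 2 * Z) := by
          rw [ev_add, ev_smul, ev_smul, ev_add, ev_const Λ 2]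
        rw [e] at h2
        refine two_mul_le_of_dispersion (ht1 p hp0) (hu p)
          (ev_nonneg (fun k _ => mul_nonneg (by positivity) (hJ0 k)) c) ?_ h2
        have := hx0 p
        positivity
      · intro k i j hi hj hij
        simp only [hJ]
        rw [sum_congr rfl fun q hq => by
          rw [pairs_create hi hj hij hp0 (hpp p hp0) (ne_of_mem_erase hq)]]
        push_cast
        rw [sum_add_distrib, sum_add_distrib, sum_ite_eq', sum_ite_eq', if_pos hp,
          if_pos (mem_erase.2 ⟨neg_ne_zero.2 hp0, hneg p (mem_of_mem_erase hp)⟩)]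
        norm_num
    have h2 := sum_le_sum h1
    simp only [mul_add (u _), ← mul_assoc (u _), sum_add_distrib] at h2
    rw [← mul_sum, ← ev_sum, ← sum_mul] at h2
    have e1 : ev Λ (fun k => ∑ p ∈ Λ.erase 0, (pairs k p : ℝ) * J k) c =
        ev Λ (fun k => J k ^ 2) c := ev_congr (fun k _ => by rw [← sum_mul, sq]) c
    rw [e1] at h2
    have h3 : ∑ p ∈ Λ.erase 0, u p * 2 * ev Λ (fun k : Fin N → G => (pairs k p : ℝ)) c ≤
        2 * U * ev Λ J c := by
      have := sum_mul_abs_le hu hU hx0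
      rw [← hJsum] at this
      calc _ = 2 * ∑ p ∈ Λ.erase 0, u p * ev Λ (fun k : Fin N → G => (pairs k p : ℝ)) c := by
            rw [mul_sum]; exact sum_congr rfl fun p _ => by ring
        _ ≤ _ := by linarith
    have h4 := mul_le_mul_of_nonneg_right hD2 (by positivity : 0 ≤ ev Λ J c + 2 * Z)
    have h5 : ev Λ (fun k => J k ^ 2) c ≤ U * ev Λ J c + U * (n + 1) * (ev Λ J c + 2 * Z) := by
      have e2 : ∑ x ∈ Λ.erase 0, u x * (|(D x : ℝ)| + 1) =
        ∑ x ∈ Λ.erase 0, (u x * |(D x : ℝ)| + u x * 1) := sum_congr rfl fun x _ => by ring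
      rw [e2] at h4
      linarith
    have h6 : U * ev Λ J c ≤ U * (U * (n + 1) * Z) := mul_le_mul_of_nonneg_left hJ1 hUnn
    have h7 : U * (n + 1) * (ev Λ J c + 2 * Z) ≤ U * (n + 1) * (U * (n + 1) * Z + 2 * Z) :=
      mul_le_mul_of_nonneg_left (by linarith) (by positivity)
    have h8 : 0 ≤ U * Z * n := by positivity
    have h9 : 0 ≤ U * Z * n * n := by positivity
    have h10 : 0 ≤ U * U * Z * n := by positivity
    have h11 : 0 ≤ U * U * Z * n * n := by positivity
    nlinarith
  have h1 : ev Λ (fun k : Fin N → G => (excited k : ℝ) ^ 2) c ≤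
      ev Λ (fun k => 2 * n ^ 2 + 2 * J k ^ 2) c := by
    refine ev_mono_supp fun k hk => ?_
    have e : (excited k : ℝ) = n + J k := (hasImbalance_of_trial_ne_zero hk).excited_eq hneg
    rw [e]
    nlinarith [sq_nonneg (n - J k)]
  rw [ev_add, ev_const Λ (2 * n ^ 2), ev_smul] at h1
  have h2 : n ^ 2 * Z ≤ (n + 1) ^ 2 * Z := by gcongr; linarith
  linarith

/-- The pair number bound and the pairing identity together give e_p |D_p|/2 - (t_p + u_p - e_p)/2
per mode. Every correction is a multiple of ⟨n₊²⟩/N; no term of order N^{-1/2} occurs because the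
cubic terms vanish by parity. -/
theorem trial_energy {Λ M : Finset G} (hN : 2 ≤ N) (h0 : (0 : G) ∈ Λ) (hneg : ∀ p ∈ Λ, -p ∈ Λ)
    (hM : Λ.erase 0 ⊆ M) (hM0 : (0 : G) ∉ M)
    (hpp : ∀ p : G, p ≠ 0 → p ≠ -p) {t u : G → ℝ} (ht0 : t 0 = 0) (ht1 : ∀ p, p ≠ 0 → 1 ≤ t p)
    (hte : ∀ p, t (-p) = t p) (hu : ∀ p, 0 ≤ u p) (hue : ∀ p, u (-p) = u p) {U : ℝ}
    (hU : ∑ p ∈ M, u p ≤ U) (D : G → ℤ) :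
    upForm t u Λ M (trial (N := N) Λ (bogCoeff t u) D) ≤
      (1 / 2 * ∑ p ∈ Λ.erase 0, dispersion t u p * |(D p : ℝ)|
        - 1 / 2 * ∑ p ∈ Λ.erase 0, (t p + u p - dispersion t u p)
        + 6 * U * (2 + 4 * U * (U + 1)) * (1 / 2 * ∑ p ∈ Λ.erase 0, |(D p : ℝ)| + 1) ^ 2 / N) *
        ev Λ (fun _ : Fin N → G => 1) (trial Λ (bogCoeff t u) D) := by
  have ht : ∀ p, 0 ≤ t p := fun p => by
    by_cases hp : p = 0
    · rw [hp, ht0]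
    · exact zero_le_one.trans (ht1 p hp)
  have hUnn : 0 ≤ U := (sum_nonneg fun p _ => hu p).trans hU
  have hUΛ : ∑ p ∈ Λ.erase 0, u p ≤ U :=
    (sum_le_sum_of_subset_of_nonneg hM fun p _ _ => hu p).trans hU
  obtain ⟨hw, hw1, hw2, hwN⟩ := weight_bounds hN
  have hmom := trial_moment (N := N) h0 hneg hpp ht0 ht1 hte hu hue hUΛ D
  have hpair := fun p (hp : p ∈ Λ.erase 0) => ev_pairs_trial_le (N := N) hp
    (hneg p (mem_of_mem_erase hp)) h0 ht hu hte hue D (hpp p (ne_of_mem_erase hp))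
  have hX := fun p (hp : p ∈ Λ.erase 0) => pairing_trial (N := N) (mem_of_mem_erase hp)
    (hneg p (mem_of_mem_erase hp)) h0 (fun q => bogCoeff_nonneg (ht q) (hu q))
    (fun q => by simp only [bogCoeff, dispersion, hte, hue]) D (ne_of_mem_erase hp)
    (hpp p (ne_of_mem_erase hp))
  have hsymm := isSymm_trial (N := N) Λ (bogCoeff t u) D
  have hs : ∀ k, k ∉ box N Λ → trial Λ (bogCoeff t u) D k = 0 := fun k hk => by
    by_contra h
    exact hk (hasImbalance_of_trial_ne_zero h).1
  have hsupp : ∀ k, trial (N := N) Λ (bogCoeff t u) D k ≠ 0 → HasImbalance Λ D k :=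
    fun k hk => hasImbalance_of_trial_ne_zero hk
  -- The common parity is read off any configuration in the support. At this stage the trial state
  -- may still vanish, and then any value serves.
  obtain ⟨π, hπ⟩ : ∃ π, ∀ k, trial (N := N) Λ (bogCoeff t u) D k ≠ 0 → excited k % 2 = π := by
    by_cases h : ∃ k, trial (N := N) Λ (bogCoeff t u) D k ≠ 0
    · obtain ⟨l, hl⟩ := h
      exact ⟨excited l % 2, fun k hk => (hsupp k hk).excited_mod_two hneg hpp (hsupp l hl)⟩
    · exact ⟨0, fun k hk => absurd ⟨k, hk⟩ h⟩
  set c := trial (N := N) Λ (bogCoeff t u) D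
  have hZ : 0 ≤ ev Λ (fun _ : Fin N → G => 1) c := ev_nonneg (fun _ _ => zero_le_one) c
  have hν20 : 0 ≤ ev Λ (fun k : Fin N → G => (excited k : ℝ) ^ 2) c :=
    ev_nonneg (fun k _ => by positivity) c
  have hmode : ∀ p ∈ Λ.erase 0, (2 * ((N : ℝ) - 1))⁻¹ * (u p *
      (ev Λ (fun k => (occ k 0 : ℝ) * (occ k p + occ k (-p)) + occ k (-p)) c
        + 2 * pairing Λ p c)) + 1 / 2 * (t p * ev Λ (fun k => (occ k p : ℝ) + occ k (-p)) c) ≤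
      (1 / 2 * (dispersion t u p * |(D p : ℝ)|) - 1 / 2 * (t p + u p - dispersion t u p)) *
        ev Λ (fun _ => 1) c
      + (2 * ((N : ℝ) - 1))⁻¹ * (u p * (5 * ev Λ (fun k => (excited k : ℝ) ^ 2) c)) := by
    intro p hp
    have hp0 := ne_of_mem_erase hp
    have k1 : ev Λ (fun k => (occ k 0 : ℝ) * (occ k p + occ k (-p)) + occ k (-p)) c ≤
        ((N : ℝ) - 1) * ev Λ (fun k => (occ k p : ℝ) + occ k (-p)) c
          + ev Λ (fun k : Fin N → G => (excited k : ℝ) ^ 2) c := by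
      rw [← ev_smul, ← ev_add]
      refine ev_mono (fun k _ => ?_) c
      have a1 := mul_occ_zero_add_one_le k hp0
      have a2 := mul_occ_zero_add_one_le k (neg_ne_zero.2 hp0)
      have a3 : (occ k (-p) : ℝ) ≤ (excited k : ℝ) ^ 2 := by
        exact_mod_cast (occ_le_excited (neg_ne_zero.2 hp0)).trans (Nat.le_self_pow two_ne_zero _)
      linarith
    have k2 : pairing Λ p c ≤ -(((N : ℝ) - 1) * (bogCoeff t u p *
        ev Λ (fun k => (larger k p : ℝ) + 1) c))
        + 2 * ev Λ (fun k : Fin N → G => (excited k : ℝ) ^ 2) c := by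
      rw [hX p hp]
      have a1 : ev Λ (fun k => (((N : ℝ) - 1) * (bogCoeff t u p * ((larger k p : ℝ) + 1))
          - 2 * (excited k : ℝ) ^ 2)) c ≤
          ev Λ (fun k => √((occ k 0 : ℝ) * (occ k 0 - 1)) *
            (bogCoeff t u p * (larger k p + 1))) c := by
        refine ev_mono (fun k _ => ?_) c
        -- The left side is n_0 - 1. The maximum with zero below covers n_0 = 0.
        have b1 : (N : ℝ) - 1 - excited k ≤ √((occ k 0 : ℝ) * (occ k 0 - 1)) := by
          have : (N : ℝ) = occ k 0 + excited k := by exact_mod_cast (occ_zero_add_excited k).symm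
          rw [this]
          refine le_trans (le_max_left _ 0) (Real.le_sqrt_of_sq_le ?_)
          · rw [show (occ k 0 : ℝ) + excited k - 1 - excited k = occ k 0 - 1 by ring]
            rcases Nat.eq_zero_or_pos (occ k 0) with h | h
            · simp [h]
            · have h' : (1 : ℝ) ≤ occ k 0 := by exact_mod_cast h
              rw [max_eq_left (by linarith)]
              nlinarith
        have b2 : 0 ≤ bogCoeff t u p * ((larger k p : ℝ) + 1) :=
          mul_nonneg (bogCoeff_nonneg (ht p) (hu p)) (by positivity)
        have b3 := mul_le_mul_of_nonneg_right b1 b2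
        have b4 : (excited k : ℝ) * (bogCoeff t u p * ((larger k p : ℝ) + 1)) ≤
            2 * (excited k : ℝ) ^ 2 := by
          have c1 : (larger k p : ℝ) ≤ excited k := by
            exact_mod_cast max_le (occ_le_excited hp0) (occ_le_excited (neg_ne_zero.2 hp0))
          have c2 : bogCoeff t u p * ((larger k p : ℝ) + 1) ≤ excited k + 1 :=
            (mul_le_of_le_one_left (by positivity) (bogCoeff_le_one (ht p) (hu p))).trans
              (by linarith)
          have c3 : (excited k : ℝ) ≤ (excited k : ℝ) ^ 2 := by
            exact_mod_cast Nat.le_self_pow two_ne_zero _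
          calc _ ≤ (excited k : ℝ) * (excited k + 1) := by gcongr
            _ ≤ _ := by linarith
        linarith
      rw [ev_sub, ev_smul, ev_smul, ev_smul] at a1
      linarith
    have k3 : ev Λ (fun k => (occ k p : ℝ) + occ k (-p)) c =
        |(D p : ℝ)| * ev Λ (fun _ => 1) c + 2 * ev Λ (fun k => (pairs k p : ℝ)) c := by
      rw [← ev_smul, ← ev_smul, ← ev_add]
      exact ev_congr_supp fun k hk => by rw [(hsupp k hk).occ_add_occ hp]; ring
    have k4 : ev Λ (fun k => (larger k p : ℝ) + 1) c =
        (|(D p : ℝ)| + 1) * ev Λ (fun _ => 1) c + ev Λ (fun k => (pairs k p : ℝ)) c := by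
      rw [← ev_smul, ← ev_add]
      exact ev_congr_supp fun k hk => by rw [(hsupp k hk).larger_eq hp]; ring
    have k5 := hpair p hp
    rw [k4] at k2
    rw [k3] at k1 ⊢
    have k6 := mul_bogCoeff (ht p) (hu p)
    have hw3 : (2 * ((N : ℝ) - 1))⁻¹ * ((N : ℝ) - 1) = 1 / 2 := by linarith
    generalize (2 * ((N : ℝ) - 1))⁻¹ = w at *
    set Z := ev Λ (fun _ : Fin N → G => 1) c
    set x := ev Λ (fun k : Fin N → G => (pairs k p : ℝ)) c
    set ν₂ := ev Λ (fun k : Fin N → G => (excited k : ℝ) ^ 2) c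
    set V := ev Λ (fun k => (occ k 0 : ℝ) * (occ k p + occ k (-p)) + occ k (-p)) c
    set X := pairing Λ p c
    set e := dispersion t u p
    set α := bogCoeff t u p
    have k7 : V + 2 * X ≤ ((N : ℝ) - 1) * (|(D p : ℝ)| * Z + 2 * x
        - 2 * (α * ((|(D p : ℝ)| + 1) * Z + x))) + 5 * ν₂ := by linarith
    have k8 := mul_le_mul_of_nonneg_left k7 (mul_nonneg hw.le (hu p))
    have k9 : w * u p * (((N : ℝ) - 1) * (|(D p : ℝ)| * Z + 2 * x
        - 2 * (α * ((|(D p : ℝ)| + 1) * Z + x))) + 5 * ν₂) =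
        1 / 2 * u p * (|(D p : ℝ)| * Z + 2 * x) - (u p * α) * ((|(D p : ℝ)| + 1) * Z + x)
          + w * (u p * (5 * ν₂)) := by
      linear_combination (u p * (|(D p : ℝ)| * Z + 2 * x
        - 2 * (α * ((|(D p : ℝ)| + 1) * Z + x)))) * hw3
    rw [k9, k6] at k8
    linarith
  have hT : ev Λ (kin t) c =
      ∑ p ∈ Λ.erase 0, 1 / 2 * (t p * ev Λ (fun k => (occ k p : ℝ) + occ k (-p)) c) := by
    simp only [← ev_smul]
    rw [← ev_sum]
    refine ev_congr (fun k hk => ?_) c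
    rw [← mul_sum, sum_occ_add_occ_neg hneg hte, kin_eq hk ht0]
    ring
  have hsumM : ∑ p ∈ M, u p * (∑ k ∈ box N Λ, trans p c k ^ 2
      - ev Λ (fun k => (#{i | k i + p ∈ Λ} : ℝ)) c) ≤
      (∑ p ∈ Λ.erase 0, u p *
        (ev Λ (fun k => (occ k 0 : ℝ) * (occ k p + occ k (-p)) + occ k (-p)) c
          + 2 * pairing Λ p c)) + U * ev Λ (fun k : Fin N → G => (excited k : ℝ) ^ 2) c := by
    -- Transfers in `M` outside Λ contribute only to the ⟨n₊²⟩ error; those inside also carry the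
    -- quadratic Hamiltonian.
    have e : Λ.erase 0 = M.filter (· ∈ Λ) := by
      ext p
      simp only [mem_erase, mem_filter]
      exact ⟨fun h => ⟨hM (mem_erase.2 h), h.2⟩, fun h => ⟨fun h' => hM0 (h' ▸ h.1), h.2⟩⟩
    rw [e, sum_filter]
    refine le_trans ?_ (add_le_add_right (mul_le_mul_of_nonneg_right hU hν20) _)
    rw [sum_mul, ← sum_add_distrib]
    refine sum_le_sum fun p hp => ?_
    have hp0 : p ≠ 0 := fun h => hM0 (h ▸ hp)
    by_cases hpΛ : p ∈ Λ
    · rw [if_pos hpΛ, ← mul_add]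
      exact mul_le_mul_of_nonneg_left
        (sum_trans_sq_trial_le hpΛ (hneg p hpΛ) h0 hp0 hsymm hs hπ) (hu p)
    · rw [if_neg hpΛ, zero_add]
      exact mul_le_mul_of_nonneg_left (sum_trans_sq_le_of_notMem hpΛ hneg hp0 hs) (hu p)
  have hall := sum_le_sum hmode
  rw [sum_add_distrib, sum_add_distrib, ← mul_sum, ← hT, ← sum_mul, sum_sub_distrib, ← mul_sum,
    ← mul_sum, ← mul_sum, ← sum_mul] at hall
  rw [upForm]
  generalize (2 * ((N : ℝ) - 1))⁻¹ = w at *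
  set Z := ev Λ (fun _ : Fin N → G => 1) c
  set ν₂ := ev Λ (fun k : Fin N → G => (excited k : ℝ) ^ 2) c
  have f1 := mul_le_mul_of_nonneg_left hsumM hw.le
  have f2 : w * ((∑ p ∈ Λ.erase 0, u p) * (5 * ν₂)) ≤ 1 / N * (U * (5 * ν₂)) :=
    mul_le_mul hw1 (mul_le_mul_of_nonneg_right hUΛ (by positivity))
      (mul_nonneg (sum_nonneg fun p _ => hu p) (by positivity)) (by positivity)
  have f3 : w * (U * ν₂) ≤ 1 / N * (U * ν₂) := by gcongr
  have f4 : 1 / (N : ℝ) * (6 * U * ν₂) ≤ 1 / N * (6 * U * ((2 + 4 * U * (U + 1)) *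
    (1 / 2 * ∑ p ∈ Λ.erase 0, |(D p : ℝ)| + 1) ^ 2 * Z)) := by gcongr
  have f5 : 1 / (N : ℝ) * (6 * U * ((2 + 4 * U * (U + 1)) *
      (1 / 2 * ∑ p ∈ Λ.erase 0, |(D p : ℝ)| + 1) ^ 2 * Z)) =
      6 * U * (2 + 4 * U * (U + 1)) * (1 / 2 * ∑ p ∈ Λ.erase 0, |(D p : ℝ)| + 1) ^ 2 / N * Z := by
    ring
  linarith

theorem exists_config {Λ : Finset G} (f : G → ℕ) (hf : ∑ p ∈ Λ, f p = N) :
    ∃ k : Fin N → G, k ∈ box N Λ ∧ ∀ p ∈ Λ, occ k p = f p := by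
  obtain ⟨l, hl'⟩ : ∃ l : List G, (l : Multiset G) = ∑ p ∈ Λ, Multiset.replicate (f p) p :=
    ⟨_, Multiset.coe_toList _⟩
  have hlen : l.length = N := by
    rw [← Multiset.coe_card, hl', Multiset.card_sum]; simp [hf]
  subst hlen
  have hcount : ∀ q, l.count q = if q ∈ Λ then f q else 0 := by
    intro q
    rw [← Multiset.coe_count, hl', Multiset.count_sum']
    simp [Multiset.count_replicate]
  have hocc : ∀ q, occ l.get q = l.count q := by
    intro q
    have e : (l : Multiset G) = univ.val.map l.get := by rw [Fin.univ_val_map, List.ofFn_get]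
    rw [occ, ← Multiset.coe_count, e, Multiset.count_map, card_def, filter_val]
    simp only [eq_comm]
  refine ⟨l.get, mem_box.2 fun i => ?_, fun p hp => by rw [hocc, hcount, if_pos hp]⟩
  by_contra h
  have h1 := hcount (l.get i)
  rw [if_neg h, List.count_eq_zero] at h1
  exact h1 (List.get_mem l i)

/-- Put max(D_p, 0) particles into each mode p ≠ 0 and the others into the zero mode. The hypothesis
on ∑ |D_p| says that there are enough particles. This configuration has no pairs, so its weight is
positive even where α_p = 0. -/
theorem trial_norm_pos {Λ : Finset G} (h0 : (0 : G) ∈ Λ) (hneg : ∀ p ∈ Λ, -p ∈ Λ)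
    {α : G → ℝ} (hα : ∀ p, 0 ≤ α p) {D : G → ℤ}
    (hD : ∀ p, D (-p) = -D p) (hDN : 1 / 2 * ∑ p ∈ Λ.erase 0, |(D p : ℝ)| ≤ N) :
    0 < ev Λ (fun _ : Fin N → G => 1) (trial Λ α D) := by
  have hsum : (∑ p ∈ Λ.erase 0, |(D p : ℝ)|) = 2 * ∑ p ∈ Λ.erase 0, ((D p).toNat : ℝ) := by
    have e1 : ∑ p ∈ Λ.erase 0, ((-D p).toNat : ℝ) = ∑ p ∈ Λ.erase 0, ((D p).toNat : ℝ) := by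
      refine sum_nbij' (fun p => -p) (fun p => -p) ?_ ?_ ?_ ?_ ?_
      · exact fun p hp => mem_erase.2
          ⟨neg_ne_zero.2 (ne_of_mem_erase hp), hneg p (mem_of_mem_erase hp)⟩
      · exact fun p hp => mem_erase.2
          ⟨neg_ne_zero.2 (ne_of_mem_erase hp), hneg p (mem_of_mem_erase hp)⟩
      · intro p _; simp
      · intro p _; simp
      · intro p _; rw [hD]
    rw [two_mul]
    nth_rw 2 [← e1]
    rw [← sum_add_distrib]
    refine sum_congr rfl fun p _ => ?_
    have : |D p| = (D p).toNat + (-D p).toNat := by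
      rcases le_total 0 (D p) with h | h
      · rw [abs_of_nonneg h]; omega
      · rw [abs_of_nonpos h]; omega
    exact_mod_cast this
  have hle : ∑ p ∈ Λ.erase 0, (D p).toNat ≤ N := by
    rw [hsum] at hDN
    have : ∑ p ∈ Λ.erase 0, ((D p).toNat : ℝ) ≤ N := by linarith
    exact_mod_cast this
  obtain ⟨k, hk, hocc⟩ := exists_config (N := N) (Λ := Λ)
    (fun p => if p = 0 then N - ∑ p ∈ Λ.erase 0, (D p).toNat else (D p).toNat) (by
      rw [← add_sum_erase _ _ h0, if_pos rfl,
        sum_congr rfl fun p hp => if_neg (ne_of_mem_erase hp)]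
      omega)
  have hocc' : ∀ p ∈ Λ.erase 0, occ k p = (D p).toNat := fun p hp => by
    rw [hocc p (mem_of_mem_erase hp), if_neg (ne_of_mem_erase hp)]
  have hmem : ∀ p ∈ Λ.erase 0, -p ∈ Λ.erase 0 := fun p hp =>
    mem_erase.2 ⟨neg_ne_zero.2 (ne_of_mem_erase hp), hneg p (mem_of_mem_erase hp)⟩
  have himb : HasImbalance Λ D k := by
    refine ⟨hk, fun p hp => ?_⟩
    rw [hocc' p hp, hocc' _ (hmem p hp), hD]
    omega
  have hpos : 0 < trial Λ α D k ^ 2 := by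
    rw [trial_sq hα himb, trialWeight]
    refine mul_pos (by positivity) (prod_pos fun p hp => ?_)
    have : pairs k p = 0 := by
      rw [pairs, hocc' p hp, hocc' _ (hmem p hp), hD]
      omega
    rw [this, pow_zero, one_mul]
    positivity
  refine lt_of_lt_of_le hpos ?_
  rw [ev]
  simp only [one_mul]
  exact single_le_sum (f := fun k => trial Λ α D k ^ 2) (fun _ _ => sq_nonneg _) hk

end TrialBound

end BoseGas

namespace BoseGas
open Finset Function

set_option linter.unusedSectionVars false

/-! ### Two-body interaction as momentum transfers, and comparison of the forms. -/

section PairForm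

variable {G : Type} [AddCommGroup G] [DecidableEq G] {N : ℕ}

/-- Moving particle `j` by `p` is a change of variables. Since `c` vanishes outside the box, the
configurations for which the move leaves the box do not matter. -/
theorem sum_mul_update_update {Λ : Finset G} (p : G) {c : (Fin N → G) → ℝ}
    (hs : ∀ k, k ∉ box N Λ → c k = 0) {i j : Fin N} (hij : j ≠ i) :
    ∑ k ∈ box N Λ, c (update k i (k i - p)) * c (update k j (k j - p)) =
      ∑ k ∈ box N Λ, c k * c (update (update k i (k i - p)) j (k j + p)) := by
  have e1 : ∑ k ∈ box N Λ, c (update k i (k i - p)) * c (update k j (k j - p)) =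
      ∑ k ∈ box N Λ with k j - p ∈ Λ, c (update k i (k i - p)) * c (update k j (k j - p)) := by
    rw [sum_filter]
    refine sum_congr rfl fun k _ => ?_
    split_ifs with h
    · rfl
    · rw [hs (update k j (k j - p)), mul_zero]
      intro hk
      exact h (by simpa using mem_box.1 hk j)
  have e2 : ∑ k ∈ box N Λ, c k * c (update (update k i (k i - p)) j (k j + p)) =
      ∑ k ∈ box N Λ with k j + p ∈ Λ,
        c k * c (update (update k i (k i - p)) j (k j + p)) := by
    rw [sum_filter]
    refine sum_congr rfl fun k _ => ?_
    split_ifs with h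
    · rfl
    · rw [hs (update (update k i (k i - p)) j (k j + p)), mul_zero]
      intro hk
      exact h (by simpa using mem_box.1 hk j)
  rw [e1, e2]
  refine sum_nbij' (fun k => update k j (k j - p)) (fun k => update k j (k j + p)) ?_ ?_ ?_ ?_ ?_
  · intro k hk
    rw [mem_filter] at hk ⊢
    exact ⟨update_mem_box hk.1 j hk.2, by simpa using mem_box.1 hk.1 j⟩
  · intro k hk
    rw [mem_filter] at hk ⊢
    exact ⟨update_mem_box hk.1 j hk.2, by simpa using mem_box.1 hk.1 j⟩
  · intro k _; simp
  · intro k _; simp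
  · intro k _
    rw [mul_comm]
    congr 2
    rw [update_comm hij.symm, update_of_ne hij.symm, update_self, update_idem, sub_add_cancel,
      update_eq_self]

/-- The subtracted term is exactly the diagonal i = j of ‖ρ_p c‖². On the box it counts only
particles that can still be moved by `p`, which may be fewer than N. -/
theorem sum_trans_sq_sub {Λ : Finset G} (p : G) {c : (Fin N → G) → ℝ}
    (hs : ∀ k, k ∉ box N Λ → c k = 0) :
    ∑ k ∈ box N Λ, trans p c k ^ 2 - ev Λ (fun k => (#{i | k i + p ∈ Λ} : ℝ)) c =
      ∑ i, ∑ j with j ≠ i, ∑ k ∈ box N Λ,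
        c k * c (update (update k i (k i - p)) j (k j + p)) := by
  have e1 : ∑ k ∈ box N Λ, trans p c k ^ 2 =
      ∑ i, ∑ j, ∑ k ∈ box N Λ, c (update k i (k i - p)) * c (update k j (k j - p)) := by
    simp only [trans, sq, sum_mul_sum]
    rw [sum_comm]
    refine sum_congr rfl fun i _ => ?_
    rw [sum_comm]
  have e2 : ev Λ (fun k => (#{i | k i + p ∈ Λ} : ℝ)) c =
      ∑ i, ∑ k ∈ box N Λ, c (update k i (k i - p)) * c (update k i (k i - p)) := by
    rw [sum_comm]
    have : ∀ k ∈ box N Λ, ∑ i, c (update k i (k i - p)) * c (update k i (k i - p)) =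
        ∑ i with k i - p ∈ Λ, c (update k i (k i - p)) ^ 2 := by
      intro k _
      rw [sum_filter]
      refine sum_congr rfl fun i _ => ?_
      split_ifs with h
      · rw [sq]
      · rw [hs (update k i (k i - p)), mul_zero]
        intro hk
        exact h (by simpa using mem_box.1 hk i)
    rw [sum_congr rfl this, sum_box_update Λ (fun q => q - p ∈ Λ) (fun q => q + p ∈ Λ)
      (fun q => q - p) (fun q => q + p) (fun q hq h => ⟨h, by simpa, by simp⟩)
      (fun q hq h => ⟨h, by simpa, by simp⟩) fun _ k' => c k' ^ 2]
    refine sum_congr rfl fun k _ => ?_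
    rw [sum_const, nsmul_eq_mul]
  rw [e1, e2, ← sum_sub_distrib]
  refine sum_congr rfl fun i _ => ?_
  rw [← add_sum_erase univ _ (mem_univ i), add_sub_cancel_left]
  refine sum_congr (by ext j; simp) fun j hj => sum_mul_update_update p hs ?_
  simpa using hj

/-- Transfers outside Λ contribute non-negative squares and are dropped; the diagonal count is
replaced by N. -/
theorem lowForm_le_upForm {Λ M : Finset G} (hN : 2 ≤ N) (hM : Λ.erase 0 ⊆ M) {t u : G → ℝ}
    (hu : ∀ p, 0 ≤ u p) (c : (Fin N → G) → ℝ) :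
    lowForm t u Λ c - (2 * ((N : ℝ) - 1))⁻¹ * N * (∑ p ∈ M, u p) * ev Λ (fun _ => 1) c ≤
      upForm t u Λ M c := by
  obtain ⟨hw, -, -, -⟩ := weight_bounds hN
  rw [lowForm, upForm]
  have h1 : ∑ p ∈ Λ.erase 0, u p * ∑ k ∈ box N Λ, trans p c k ^ 2 ≤
      ∑ p ∈ M, u p * ∑ k ∈ box N Λ, trans p c k ^ 2 :=
    sum_le_sum_of_subset_of_nonneg hM fun p _ _ =>
      mul_nonneg (hu p) (sum_nonneg fun _ _ => sq_nonneg _)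
  have h2 : ∑ p ∈ M, u p * ev Λ (fun k => (#{i | k i + p ∈ Λ} : ℝ)) c ≤
      N * (∑ p ∈ M, u p) * ev Λ (fun _ => 1) c := by
    rw [mul_comm (N : ℝ), mul_assoc, sum_mul, ← ev_const]
    refine sum_le_sum fun p _ => mul_le_mul_of_nonneg_left (ev_mono (fun k _ => ?_) c) (hu p)
    exact_mod_cast (card_le_univ _).trans_eq (Fintype.card_fin N)
  have h3 : ∑ p ∈ M, u p * (∑ k ∈ box N Λ, trans p c k ^ 2
      - ev Λ (fun k => (#{i | k i + p ∈ Λ} : ℝ)) c) =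
      ∑ p ∈ M, u p * ∑ k ∈ box N Λ, trans p c k ^ 2
        - ∑ p ∈ M, u p * ev Λ (fun k => (#{i | k i + p ∈ Λ} : ℝ)) c := by
    rw [← sum_sub_distrib]; exact sum_congr rfl fun p _ => by ring
  rw [h3]
  nlinarith [mul_le_mul_of_nonneg_left (sub_le_sub h1 h2) hw.le]

theorem box_subset {Λ Λ' : Finset G} (h : Λ ⊆ Λ') : box N Λ ⊆ box N Λ' := fun _ hk =>
  mem_box.2 fun i => h (mem_box.1 hk i)

theorem ev_eq_of_subset {Λ Λ' : Finset G} (h : Λ ⊆ Λ') {c : (Fin N → G) → ℝ}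
    (hs : ∀ k, k ∉ box N Λ → c k = 0) (f : (Fin N → G) → ℝ) : ev Λ' f c = ev Λ f c :=
  (sum_subset (box_subset h) fun k _ hk => by simp [hs k hk]).symm

/-- A larger box makes room for all transfers in `M`. Dropping the diagonal term loses a constant,
which is harmless for crude upper bounds. -/
theorem upForm_le_lowForm {Λ Λ' M : Finset G} (hN : 2 ≤ N) (hΛ : Λ ⊆ Λ') (hM : M ⊆ Λ'.erase 0)
    {t u : G → ℝ} (hu : ∀ p, 0 ≤ u p) {c : (Fin N → G) → ℝ}
    (hs : ∀ k, k ∉ box N Λ → c k = 0) : upForm t u Λ M c ≤ lowForm t u Λ' c := by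
  obtain ⟨hw, -, -, -⟩ := weight_bounds hN
  rw [lowForm, upForm, ev_eq_of_subset hΛ hs]
  refine add_le_add_right (mul_le_mul_of_nonneg_left ?_ hw.le) _
  calc _ ≤ ∑ p ∈ M, u p * ∑ k ∈ box N Λ', trans p c k ^ 2 := by
        refine sum_le_sum fun p _ => mul_le_mul_of_nonneg_left ?_ (hu p)
        have h1 : 0 ≤ ev Λ (fun k => (#{i | k i + p ∈ Λ} : ℝ)) c :=
          ev_nonneg (fun k _ => by positivity) c
        have h2 : ∑ k ∈ box N Λ, trans p c k ^ 2 ≤ ∑ k ∈ box N Λ', trans p c k ^ 2 :=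
          sum_le_sum_of_subset_of_nonneg (box_subset hΛ) fun _ _ _ => sq_nonneg _
        linarith
    _ ≤ _ := sum_le_sum_of_subset_of_nonneg hM fun p _ _ =>
        mul_nonneg (hu p) (sum_nonneg fun _ _ => sq_nonneg _)

end PairForm

end BoseGas

namespace BoseGas
open Finset Function MeasureTheory

set_option linter.unusedSectionVars false

/-! ### Multiplication operators and trigonometric polynomials on the torus. -/

section Torus

variable {ι : Type} [Fintype ι]

theorem coe_planeWaves : ⇑(planeWaves ι) = UnitAddTorus.mFourierLp (d := ι) 2 :=
  UnitAddTorus.coe_mFourierBasis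

theorem planeWaves_ae (k : ι → ℤ) :
    (planeWaves ι k : UnitAddTorus ι → ℂ) =ᵐ[torusMeasure ι] UnitAddTorus.mFourier k := by
  rw [coe_planeWaves]
  exact UnitAddTorus.coeFn_mFourierLp 2 k

theorem planeWaves_repr (Ψ : L2Torus ι) (k : ι → ℤ) :
    (planeWaves ι).repr Ψ k = ∫ x, UnitAddTorus.mFourier (-k) x * Ψ x ∂torusMeasure ι :=
  UnitAddTorus.mFourierBasis_repr Ψ k

theorem memLp_mul_of_bounded {V : UnitAddTorus ι → ℝ} (hV : Measurable V) {B : ℝ}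
    (hB : ∀ x, |V x| ≤ B) (Ψ : L2Torus ι) :
    MemLp (fun x => (V x : ℂ) * Ψ x) 2 (torusMeasure ι) := by
  refine MemLp.of_le_mul (c := B) (Lp.memLp Ψ) ?_ (Filter.Eventually.of_forall fun x => ?_)
  · exact (Complex.measurable_ofReal.comp hV).aestronglyMeasurable.mul
      (Lp.aestronglyMeasurable Ψ)
  · rw [norm_mul, Complex.norm_real, Real.norm_eq_abs]
    exact mul_le_mul_of_nonneg_right (hB x) (norm_nonneg _)

/-- Multiplication by a bounded function, as a bounded operator. -/
noncomputable def boundedMultiplication {V : UnitAddTorus ι → ℝ} (hV : Measurable V) {B : ℝ}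
    (hB : ∀ x, |V x| ≤ B) : L2Torus ι →L[ℂ] L2Torus ι :=
  LinearMap.mkContinuous
    { toFun := fun Ψ => multiplication V ⟨Ψ, memLp_mul_of_bounded hV hB Ψ⟩
      map_add' := fun Ψ Φ => (multiplication V).map_add ⟨Ψ, memLp_mul_of_bounded hV hB Ψ⟩
        ⟨Φ, memLp_mul_of_bounded hV hB Φ⟩
      map_smul' := fun c Ψ =>
        (multiplication V).map_smul c ⟨Ψ, memLp_mul_of_bounded hV hB Ψ⟩ } B <| by
    intro Ψ
    refine Lp.norm_le_mul_norm_of_ae_le_mul ?_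
    filter_upwards [MemLp.coeFn_toLp (memLp_mul_of_bounded hV hB Ψ)] with x hx
    refine (congrArg norm hx).trans_le ?_
    rw [norm_mul, Complex.norm_real, Real.norm_eq_abs]
    exact mul_le_mul_of_nonneg_right (hB x) (norm_nonneg _)

theorem boundedMultiplication_ae {V : UnitAddTorus ι → ℝ} (hV : Measurable V) {B : ℝ}
    (hB : ∀ x, |V x| ≤ B) (Ψ : L2Torus ι) :
    boundedMultiplication hV hB Ψ =ᵐ[torusMeasure ι] fun x => (V x : ℂ) * Ψ x :=
  MemLp.coeFn_toLp (memLp_mul_of_bounded hV hB Ψ)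

theorem inner_boundedMultiplication {V : UnitAddTorus ι → ℝ} (hV : Measurable V) {B : ℝ}
    (hB : ∀ x, |V x| ≤ B) (Ψ : L2Torus ι) :
    (inner ℂ Ψ (boundedMultiplication hV hB Ψ)).re = ∫ x, V x * ‖Ψ x‖ ^ 2 ∂torusMeasure ι := by
  have : inner ℂ Ψ (boundedMultiplication hV hB Ψ) =
      ∫ x, ((V x * ‖Ψ x‖ ^ 2 : ℝ) : ℂ) ∂torusMeasure ι := by
    rw [L2.inner_def]
    refine integral_congr_ae ?_
    filter_upwards [boundedMultiplication_ae hV hB Ψ] with x hx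
    rw [hx, RCLike.inner_apply, mul_assoc, Complex.mul_conj, Complex.normSq_eq_norm_sq]
    push_cast; rfl
  rw [this, integral_complex_ofReal, Complex.ofReal_re]

theorem inner_planeWaves_boundedMultiplication {V : UnitAddTorus ι → ℝ} (hV : Measurable V)
    {B : ℝ} (hB : ∀ x, |V x| ≤ B) (k l : ι → ℤ) :
    inner ℂ (planeWaves ι k) (boundedMultiplication hV hB (planeWaves ι l)) =
      ∫ x, (V x : ℂ) * UnitAddTorus.mFourier (l - k) x ∂torusMeasure ι := by
  rw [L2.inner_def]
  refine integral_congr_ae ?_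
  filter_upwards [boundedMultiplication_ae hV hB (planeWaves ι l), planeWaves_ae k,
    planeWaves_ae l] with x hx hk hl
  rw [hx, RCLike.inner_apply, hk, hl, sub_eq_add_neg, UnitAddTorus.mFourier_add,
    UnitAddTorus.mFourier_neg]
  ring

/-- The trigonometric polynomial with coefficients `c k`, `k ∈ F`. -/
noncomputable def synth (F : Finset (ι → ℤ)) (c : (ι → ℤ) → ℂ) : L2Torus ι :=
  ∑ k ∈ F, c k • planeWaves ι k

theorem repr_synth [DecidableEq ι] (F : Finset (ι → ℤ)) (c : (ι → ℤ) → ℂ) (k : ι → ℤ) :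
    (planeWaves ι).repr (synth F c) k = if k ∈ F then c k else 0 := by
  rw [HilbertBasis.repr_apply_apply, synth, inner_sum]
  simp_rw [inner_smul_right, orthonormal_iff_ite.1 (planeWaves ι).orthonormal]
  simp

theorem norm_synth_sq [DecidableEq ι] (F : Finset (ι → ℤ)) (c : (ι → ℤ) → ℂ) :
    ‖synth F c‖ ^ 2 = ∑ k ∈ F, ‖c k‖ ^ 2 := by
  have h := congrArg Complex.re
    ((planeWaves ι).orthonormal.inner_sum c c F)
  rw [← synth, inner_self_eq_norm_sq_to_K] at h
  have e : (((‖synth F c‖ : ℝ) : ℂ) ^ 2).re = ‖synth F c‖ ^ 2 := by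
    rw [← Complex.ofReal_pow, Complex.ofReal_re]
  rw [← e]
  refine h.trans ?_
  rw [Complex.re_sum]
  refine sum_congr rfl fun k _ => ?_
  rw [mul_comm, Complex.mul_conj, Complex.ofReal_re, Complex.normSq_eq_norm_sq]

theorem synth_mem_multiplierDomain [DecidableEq ι] (m : (ι → ℤ) → ℝ) (F : Finset (ι → ℤ))
    (c : (ι → ℤ) → ℂ) : synth F c ∈ multiplierDomain m := by
  rw [mem_multiplierDomain]
  refine memℓp_gen (summable_of_ne_finset_zero (s := F) fun k hk => ?_)
  simp [repr_synth, hk]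

theorem inner_fourierMultiplier (m : (ι → ℤ) → ℝ) (Ψ : multiplierDomain m) :
    HasSum (fun k => m k * ‖(planeWaves ι).repr (Ψ : L2Torus ι) k‖ ^ 2)
      (inner ℂ (Ψ : L2Torus ι) (fourierMultiplier m Ψ)).re := by
  have h1 : (planeWaves ι).repr (fourierMultiplier m Ψ) = multiplierCoeff m Ψ :=
    LinearIsometryEquiv.apply_symm_apply _ _
  have h2 := lp.hasSum_inner (𝕜 := ℂ) ((planeWaves ι).repr (Ψ : L2Torus ι)) (multiplierCoeff m Ψ)
  rw [← h1, LinearIsometryEquiv.inner_map_map, h1] at h2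
  have h3 := Complex.hasSum_re h2
  refine h3.congr_fun fun k => ?_
  change _ = (inner ℂ _ ((m k : ℂ) * (planeWaves ι).repr (Ψ : L2Torus ι) k)).re
  rw [RCLike.inner_apply, mul_assoc, Complex.mul_conj, Complex.normSq_eq_norm_sq,
    ← Complex.ofReal_mul, Complex.ofReal_re]

/-- Because the Fourier coefficients `W` are real, the real and imaginary parts of `c` decouple.
This is why the finite-dimensional analysis may use real coefficients only. -/
theorem inner_synth_boundedMultiplication {V : UnitAddTorus ι → ℝ} (hV : Measurable V)
    {B : ℝ} (hB : ∀ x, |V x| ≤ B) (F : Finset (ι → ℤ)) (c : (ι → ℤ) → ℂ) (W : (ι → ℤ) → ℝ)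
    (hW : ∀ m, ∫ x, (V x : ℂ) * UnitAddTorus.mFourier m x ∂torusMeasure ι = W m) :
    (inner ℂ (synth F c) (boundedMultiplication hV hB (synth F c))).re =
      ∑ k ∈ F, ∑ l ∈ F, ((c k).re * (c l).re + (c k).im * (c l).im) * W (l - k) := by
  rw [synth, map_sum, sum_inner, Complex.re_sum]
  refine sum_congr rfl fun k _ => ?_
  rw [inner_sum, Complex.re_sum]
  refine sum_congr rfl fun l _ => ?_
  rw [map_smul, inner_smul_left, inner_smul_right, inner_planeWaves_boundedMultiplication, hW]
  simp
  ring

theorem tendsto_synth {Ψ : L2Torus ι} {F : ℕ → Finset (ι → ℤ)} (hF : Monotone F)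
    (hF' : ∀ k, ∃ n, k ∈ F n) :
    Filter.Tendsto (fun n => synth (F n) ((planeWaves ι).repr Ψ)) Filter.atTop (nhds Ψ) :=
  ((planeWaves ι).hasSum_repr Ψ).comp (Filter.tendsto_atTop_finset_of_monotone hF hF')

end Torus

end BoseGas

namespace BoseGas
open Finset Function MeasureTheory

set_option linter.unusedSectionVars false

/-! ### Fourier coefficients of the interaction. -/

section TorusMeasure

variable {ι : Type} [Fintype ι]

instance isNegInvariant_haarAddCircle :
    (AddCircle.haarAddCircle : Measure UnitAddCircle).IsNegInvariant := by
  unfold AddCircle.haarAddCircle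
  infer_instance

theorem mFourier_apply_add (k : ι → ℤ) (x y : UnitAddTorus ι) :
    UnitAddTorus.mFourier k (x + y) = UnitAddTorus.mFourier k x * UnitAddTorus.mFourier k y := by
  simp only [UnitAddTorus.mFourier, ContinuousMap.coe_mk, ← Finset.prod_mul_distrib, Pi.add_apply]
  refine prod_congr rfl fun i _ => ?_
  simp [fourier_apply, smul_add, AddCircle.toCircle_add]

theorem mFourier_apply_neg (k : ι → ℤ) (x : UnitAddTorus ι) :
    UnitAddTorus.mFourier k (-x) = UnitAddTorus.mFourier (-k) x := by
  simp only [UnitAddTorus.mFourier, ContinuousMap.coe_mk, Pi.neg_apply]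
  refine prod_congr rfl fun i _ => ?_
  simp [fourier_apply]

theorem norm_mFourier_apply (k : ι → ℤ) (x : UnitAddTorus ι) :
    ‖UnitAddTorus.mFourier k x‖ = 1 := by
  simp only [UnitAddTorus.mFourier, ContinuousMap.coe_mk, norm_prod, fourier_apply,
    Circle.norm_coe, prod_const_one]

theorem exists_mFourier_ne_one [DecidableEq ι] {k : ι → ℤ} (hk : k ≠ 0) :
    ∃ x, UnitAddTorus.mFourier k x ≠ 1 := by
  obtain ⟨i, hi⟩ := Function.ne_iff.1 hk
  refine ⟨Pi.single i ((1 / 2 / (k i : ℝ) : ℝ) : UnitAddCircle), ?_⟩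
  have : UnitAddTorus.mFourier k (Pi.single i ((1 / 2 / (k i : ℝ) : ℝ) : UnitAddCircle)) =
      fourier (k i) ((1 / 2 / (k i : ℝ) : ℝ) : UnitAddCircle) := by
    simp only [UnitAddTorus.mFourier, ContinuousMap.coe_mk]
    rw [prod_eq_single i]
    · simp
    · intro j _ hj
      simp [Pi.single_eq_of_ne hj]
    · simp
  rw [this]
  have h := fourier_add_half_inv_index (T := 1) hi one_pos 0
  simp only [zero_add, fourier_eval_zero] at h
  rw [h]
  norm_num

variable {N d : ℕ}

/-- The wave vector of a configuration of particle momenta. -/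
def uncfg (k : Fin N → (Fin d → ℤ)) : Fin N × Fin d → ℤ := fun ia => k ia.1 ia.2

theorem mFourier_uncfg (k : Fin N → (Fin d → ℤ)) (x : UnitAddTorus (Fin N × Fin d)) :
    UnitAddTorus.mFourier (uncfg k) x = ∏ i, UnitAddTorus.mFourier (k i) (position x i) := by
  simp only [UnitAddTorus.mFourier, ContinuousMap.coe_mk, uncfg, position]
  exact Fintype.prod_prod_type _

theorem position_add (x y : UnitAddTorus (Fin N × Fin d)) (i : Fin N) :
    position (x + y) i = position x i + position y i := rfl

theorem position_ite (p : Fin N → Prop) [DecidablePred p] (y : UnitAddTorus (Fin d)) (i : Fin N) :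
    position (fun ia : Fin N × Fin d => if p ia.1 then y ia.2 else 0) i = if p i then y else 0 := by
  funext a
  simp only [position]
  split_ifs <;> rfl

theorem mFourier_apply_zero (k : ι → ℤ) : UnitAddTorus.mFourier k (0 : UnitAddTorus ι) = 1 := by
  simp [UnitAddTorus.mFourier]

theorem measurePreserving_position_sub {i j : Fin N} (hij : i ≠ j) :
    MeasurePreserving (fun x : UnitAddTorus (Fin N × Fin d) => position x i - position x j)
      (torusMeasure (Fin N × Fin d)) (torusMeasure (Fin d)) := by
  let f : UnitAddTorus (Fin N × Fin d) →+ UnitAddTorus (Fin d) :=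
    { toFun := fun x => position x i - position x j
      map_zero' := sub_self _
      map_add' := fun x y => by rw [position_add, position_add]; abel }
  refine AddMonoidHom.measurePreserving (f := f) ?_ ?_ ?_
  · change Continuous fun x : UnitAddTorus (Fin N × Fin d) => position x i - position x j
    unfold position
    fun_prop
  · intro y
    refine ⟨fun ia => if ia.1 = i then y ia.2 else 0, ?_⟩
    change position _ i - position _ j = y
    rw [position_ite (fun r => r = i), position_ite (fun r => r = i), if_pos rfl, if_neg hij.symm,
      sub_zero]
  · simp

/-- Translation invariance of the measure shows that the integral equals `z` times itself. -/
theorem integral_eq_zero_of_shift {f : UnitAddTorus ι → ℂ} (y : UnitAddTorus ι)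
    {z : ℂ} (hz : z ≠ 1) (hf : ∀ x, f (x + y) = z * f x) : ∫ x, f x ∂torusMeasure ι = 0 := by
  have h := integral_add_right_eq_self (μ := torusMeasure ι) f y
  simp_rw [hf] at h
  rw [integral_const_mul] at h
  have : (z - 1) * ∫ x, f x ∂torusMeasure ι = 0 := by rw [sub_mul, h]; ring
  exact (mul_eq_zero.1 this).resolve_left (sub_ne_zero.2 hz)

/-- The wave vectors of relative motion of the particles `i` and `j`. -/
def IsRelative (i j : Fin N) (m : Fin N → (Fin d → ℤ)) : Prop :=
  m i + m j = 0 ∧ ∀ r, r ≠ i → r ≠ j → m r = 0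

instance (i j : Fin N) (m : Fin N → (Fin d → ℤ)) : Decidable (IsRelative i j m) := by
  unfold IsRelative; infer_instance

/-- For a relative wave vector the integrand depends on x_i - x_j alone, which is Haar distributed.
Otherwise some translation that keeps x_i - x_j fixed multiplies the plane wave by a phase different
from 1. -/
theorem integral_pair {v : UnitAddTorus (Fin d) → ℝ} (hv : Measurable v)
    (heven : ∀ x, v (-x) = v x) {i j : Fin N} (hij : i ≠ j) (m : Fin N → (Fin d → ℤ)) :
    ∫ x, (v (position x i - position x j) : ℂ) * UnitAddTorus.mFourier (uncfg m) x
      ∂torusMeasure (Fin N × Fin d) = ((if IsRelative i j m then vHat v (m j) else 0 : ℝ) : ℂ) := by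
  split_ifs with h
  · rw [← vHat_eq v heven]
    change _ = ∫ t, UnitAddTorus.mFourier (-(m j)) t • (v t : ℂ) ∂torusMeasure (Fin d)
    rw [← (measurePreserving_position_sub hij).map_eq, integral_map]
    · refine integral_congr_ae (Filter.Eventually.of_forall fun x => ?_)
      simp only [smul_eq_mul]
      rw [mul_comm, sub_eq_add_neg, mFourier_apply_add, mFourier_apply_neg, neg_neg,
        mFourier_uncfg, ← eq_neg_of_add_eq_zero_left h.1]
      congr 1
      rw [← mul_prod_erase _ _ (mem_univ i), ← mul_prod_erase _ _ (a := j), prod_eq_one, mul_one]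
      · intro r hr
        simp only [mem_erase] at hr
        rw [h.2 r hr.2.1 hr.1, UnitAddTorus.mFourier_zero]
        rfl
      · simp [hij.symm]
    · exact (measurePreserving_position_sub hij).measurable.aemeasurable
    · exact (UnitAddTorus.mFourier (-(m j))).continuous.aestronglyMeasurable.smul
        (Complex.measurable_ofReal.comp hv).aestronglyMeasurable
  · rw [Complex.ofReal_zero]
    rw [IsRelative, not_and_or] at h
    have key : ∀ y : UnitAddTorus (Fin N × Fin d), position y i = position y j →
        UnitAddTorus.mFourier (uncfg m) y ≠ 1 → ∫ x, (v (position x i - position x j) : ℂ) *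
          UnitAddTorus.mFourier (uncfg m) x ∂torusMeasure (Fin N × Fin d) = 0 := by
      intro y hy hz
      refine integral_eq_zero_of_shift y hz fun x => ?_
      rw [position_add, position_add, hy, add_sub_add_right_eq_sub, mFourier_apply_add]
      ring
    rcases h with h | h
    · obtain ⟨y, hy⟩ := exists_mFourier_ne_one h
      -- Moving the particles `i` and `j` together detects m_i + m_j; in the other case moving a
      -- single third particle detects its wave vector.
      refine key (fun ia => if ia.1 = i ∨ ia.1 = j then y ia.2 else 0) ?_ ?_
      · rw [position_ite (fun r => r = i ∨ r = j), position_ite (fun r => r = i ∨ r = j)]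
        simp
      · rw [mFourier_uncfg]
        simp_rw [position_ite (fun r => r = i ∨ r = j)]
        rw [← mul_prod_erase _ _ (mem_univ i), ← mul_prod_erase _ _ (a := j), prod_eq_one, mul_one]
        · simpa [UnitAddTorus.mFourier_add] using hy
        · intro r hr
          simp only [mem_erase] at hr
          simp [hr.1, hr.2.1, mFourier_apply_zero]
        · simp [hij.symm]
    · push Not at h
      obtain ⟨r, hri, hrj, hr⟩ := h
      obtain ⟨y, hy⟩ := exists_mFourier_ne_one hr
      refine key (fun ia => if ia.1 = r then y ia.2 else 0) ?_ ?_
      · rw [position_ite (fun s => s = r), position_ite (fun s => s = r)]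
        simp [hri.symm, hrj.symm]
      · rw [mFourier_uncfg]
        simp_rw [position_ite (fun s => s = r)]
        rw [prod_eq_single r]
        · simpa using hy
        · intro s _ hs
          simp [hs, mFourier_apply_zero]
        · simp

theorem vHat_neg {v : UnitAddTorus (Fin d) → ℝ} (heven : ∀ x, v (-x) = v x) (k : Fin d → ℤ) :
    vHat v (-k) = vHat v k := by
  have : UnitAddTorus.mFourierCoeff (fun x => (v x : ℂ)) (-k) =
      UnitAddTorus.mFourierCoeff (fun x => (v x : ℂ)) k := by
    change ∫ t, UnitAddTorus.mFourier (- -k) t • (v t : ℂ) ∂torusMeasure (Fin d)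
      = ∫ t, UnitAddTorus.mFourier (-k) t • (v t : ℂ) ∂torusMeasure (Fin d)
    rw [← integral_neg_eq_self _ (torusMeasure (Fin d))]
    refine integral_congr_ae (Filter.Eventually.of_forall fun t => ?_)
    simp only [heven, mFourier_apply_neg, neg_neg]
  rw [vHat, this, vHat]

/-- The Fourier coefficients of the interaction energy. -/
noncomputable def interactionCoeff (v : UnitAddTorus (Fin d) → ℝ) (m : Fin N → (Fin d → ℤ)) : ℝ :=
  (2 * ((N : ℝ) - 1))⁻¹ * ∑ i, ∑ j with j ≠ i, if IsRelative i j m then vHat v (m j) else 0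

theorem measurable_interaction {v : UnitAddTorus (Fin d) → ℝ} (hv : Measurable v) (N : ℕ) :
    Measurable (interaction v N) := by
  unfold interaction
  refine measurable_const.mul (Finset.measurable_sum _ fun i _ => Finset.measurable_sum _
    fun j _ => hv.comp ?_)
  unfold position
  fun_prop

theorem interaction_nonneg {v : UnitAddTorus (Fin d) → ℝ} (hv : ∀ x, 0 ≤ v x) (hN : 2 ≤ N)
    (x : UnitAddTorus (Fin N × Fin d)) : 0 ≤ interaction v N x := by
  have : (2 : ℝ) ≤ N := by exact_mod_cast hN
  exact mul_nonneg (inv_nonneg.2 (by linarith))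
    (sum_nonneg fun i _ => sum_nonneg fun j _ => hv _)

theorem abs_interaction_le {v : UnitAddTorus (Fin d) → ℝ} (hv : ∀ x, 0 ≤ v x) {B : ℝ}
    (hB : ∀ x, v x ≤ B) (hN : 2 ≤ N) (x : UnitAddTorus (Fin N × Fin d)) :
    |interaction v N x| ≤ ((N : ℝ) - 1)⁻¹ * ∑ i : Fin N, ∑ _j ∈ Finset.Ioi i, B := by
  have : (2 : ℝ) ≤ N := by exact_mod_cast hN
  rw [abs_of_nonneg (interaction_nonneg hv hN x)]
  exact mul_le_mul_of_nonneg_left (sum_le_sum fun i _ => sum_le_sum fun j _ => hB _)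
    (inv_nonneg.2 (by linarith))

theorem sum_Ioi_add_sum_Ioi_comm (f : Fin N → Fin N → ℝ) (hf : ∀ i j, i ≠ j → f i j = f j i) :
    2 * ∑ i, ∑ j ∈ Ioi i, f i j = ∑ i, ∑ j with j ≠ i, f i j := by
  have e1 : ∀ i, ∑ j with j ≠ i, f i j = ∑ j ∈ Ioi i, f i j + ∑ j ∈ Iio i, f i j := by
    intro i
    rw [← sum_union]
    · refine sum_congr ?_ fun _ _ => rfl
      ext j; simp [lt_or_lt_iff_ne, ne_comm]
    · rw [disjoint_left]
      intro j hj hj'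
      simp only [mem_Ioi, mem_Iio] at hj hj'
      exact absurd (hj.trans hj') (lt_irrefl _)
  have e2 : ∑ i, ∑ j ∈ Iio i, f i j = ∑ i, ∑ j ∈ Ioi i, f i j := by
    rw [sum_comm' (t' := univ) (s' := fun j => Ioi j) (by simp)]
    refine sum_congr rfl fun i _ => sum_congr rfl fun j hj => hf _ _ ?_
    exact (mem_Ioi.1 hj).ne'
  simp_rw [e1, sum_add_distrib, e2]
  ring

theorem integral_interaction {v : UnitAddTorus (Fin d) → ℝ} (hv : Measurable v)
    (hv0 : ∀ x, 0 ≤ v x) {B : ℝ} (hB : ∀ x, v x ≤ B)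
    (heven : ∀ x, v (-x) = v x) (m : Fin N → (Fin d → ℤ)) :
    ∫ x, (interaction v N x : ℂ) * UnitAddTorus.mFourier (uncfg m) x
      ∂torusMeasure (Fin N × Fin d) = (interactionCoeff v m : ℂ) := by
  have hint : ∀ i j : Fin N, Integrable (fun x => (v (position x i - position x j) : ℂ) *
      UnitAddTorus.mFourier (uncfg m) x) (torusMeasure (Fin N × Fin d)) := by
    intro i j
    refine Integrable.of_bound (C := B) ?_ (Filter.Eventually.of_forall fun x => ?_)
    · refine AEStronglyMeasurable.mul ?_ (ContinuousMap.continuous _).aestronglyMeasurable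
      refine (Complex.measurable_ofReal.comp (hv.comp ?_)).aestronglyMeasurable
      unfold position
      fun_prop
    · rw [norm_mul, norm_mFourier_apply, mul_one, Complex.norm_real, Real.norm_eq_abs,
        abs_of_nonneg (hv0 _)]
      exact hB _
  simp only [interaction]
  push_cast
  simp_rw [mul_assoc, sum_mul]
  rw [integral_const_mul, integral_finsetSum _ fun i _ => integrable_finsetSum _ fun j _ =>
    hint i j]
  simp_rw [integral_finsetSum _ fun j _ => hint _ j]
  rw [interactionCoeff, ← sum_Ioi_add_sum_Ioi_comm]
  · have : ∀ i : Fin N, ∑ j ∈ Ioi i, ∫ x, (v (position x i - position x j) : ℂ) *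
        UnitAddTorus.mFourier (uncfg m) x ∂torusMeasure (Fin N × Fin d) = ∑ j ∈ Ioi i,
          ((if IsRelative i j m then vHat v (m j) else 0 : ℝ) : ℂ) := fun i =>
      sum_congr rfl fun j hj => integral_pair hv heven (mem_Ioi.1 hj).ne m
    simp_rw [this]
    rw [mul_inv, mul_comm (2 : ℝ)⁻¹, mul_assoc, inv_mul_cancel_left₀ (two_ne_zero)]
    push_cast
    rfl
  · intro i j _
    have : IsRelative i j m ↔ IsRelative j i m := by
      unfold IsRelative
      rw [add_comm]
      exact and_congr_right fun _ => ⟨fun h r a b => h r b a, fun h r a b => h r b a⟩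
    by_cases h : IsRelative i j m
    · rw [if_pos h, if_pos (this.1 h), eq_neg_of_add_eq_zero_left h.1, vHat_neg heven]
    · rw [if_neg h, if_neg (fun h' => h (this.2 h'))]

end TorusMeasure

end BoseGas

namespace BoseGas
open Finset Function MeasureTheory

set_option linter.unusedSectionVars false

/-! ### The energy of a trigonometric polynomial in momentum space. -/

section FullForm

variable {N d : ℕ}

/-- The square of the length of the momentum with wave vector `p`. -/
noncomputable def momentumSq (p : Fin d → ℤ) : ℝ := ‖momentum p‖ ^ 2

/-- The nonzero differences of elements of `Λ`. -/
def differences (Λ : Finset (Fin d → ℤ)) : Finset (Fin d → ℤ) :=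
  ((Λ ×ˢ Λ).image fun q => q.1 - q.2).erase 0

/-- The energy of the trigonometric polynomial with real coefficients `f`. -/
noncomputable def fullForm (v : UnitAddTorus (Fin d) → ℝ) (Λ : Finset (Fin d → ℤ))
    (f : (Fin N → (Fin d → ℤ)) → ℝ) : ℝ :=
  upForm momentumSq (vHat v) Λ (differences Λ) f + N / 2 * vHat v 0 * ev Λ (fun _ => 1) f

/-- A configuration `l` differs from `k` by a relative wave vector exactly when it arises by
transferring the momentum p = l_j - k_j from particle `i` to particle `j`. If both lie in the box,
`p` is zero or in `differences Λ`. -/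
theorem sum_isRelative {Λ : Finset (Fin d → ℤ)} (u : (Fin d → ℤ) → ℝ)
    {f : (Fin N → (Fin d → ℤ)) → ℝ} (hs : ∀ k, k ∉ box N Λ → f k = 0) {i j : Fin N} (hij : j ≠ i)
    {k : Fin N → (Fin d → ℤ)} (hk : k ∈ box N Λ) :
    ∑ l ∈ box N Λ, f l * (if IsRelative i j (l - k) then u ((l - k) j) else 0) =
      ∑ p ∈ insert 0 (differences Λ), u p * f (update (update k i (k i - p)) j (k j + p)) := by
  have e1 : ∑ l ∈ box N Λ, f l * (if IsRelative i j (l - k) then u ((l - k) j) else 0) =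
      ∑ l ∈ box N Λ with IsRelative i j (l - k), u ((l - k) j) * f l := by
    rw [sum_filter]
    refine sum_congr rfl fun l _ => ?_
    split_ifs <;> ring
  have e2 : ∑ p ∈ insert 0 (differences Λ),
      u p * f (update (update k i (k i - p)) j (k j + p)) =
      ∑ p ∈ insert 0 (differences Λ) with update (update k i (k i - p)) j (k j + p) ∈ box N Λ,
        u p * f (update (update k i (k i - p)) j (k j + p)) := by
    rw [sum_filter]
    refine sum_congr rfl fun p _ => ?_
    split_ifs with h
    · rfl
    · rw [hs _ h, mul_zero]
  have key : ∀ l, IsRelative i j (l - k) →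
      update (update k i (k i - (l j - k j))) j (k j + (l j - k j)) = l := by
    intro l hl
    funext r
    by_cases hj : r = j
    · subst hj; simp
    by_cases hi : r = i
    · subst hi
      have := hl.1
      simp only [Pi.sub_apply] at this
      rw [update_of_ne hj, update_self, ← sub_eq_zero, ← neg_eq_zero, ← this]
      abel
    · have := hl.2 r hi hj
      simp only [Pi.sub_apply] at this
      rw [update_of_ne hj, update_of_ne hi]
      exact (sub_eq_zero.1 this).symm
  rw [e1, e2]
  refine sum_nbij' (fun l => l j - k j) (fun p => update (update k i (k i - p)) j (k j + p))
    ?_ ?_ ?_ ?_ ?_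
  · intro l hl
    rw [mem_filter] at hl ⊢
    refine ⟨?_, by rw [key l hl.2]; exact hl.1⟩
    rw [mem_insert, or_iff_not_imp_left]
    intro h
    refine mem_erase.2 ⟨h, mem_image.2 ⟨(l j, k j), ?_, rfl⟩⟩
    exact mem_product.2 ⟨mem_box.1 hl.1 j, mem_box.1 hk j⟩
  · intro p hp
    rw [mem_filter] at hp ⊢
    refine ⟨hp.2, ?_, ?_⟩
    · simp [update_of_ne hij.symm]
    · intro r hi hj
      simp [update_of_ne hj, update_of_ne hi]
  · intro l hl
    exact key l (mem_filter.1 hl).2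
  · intro p _
    simp
  · intro l hl
    rw [key l (mem_filter.1 hl).2]
    rfl

/-- The transfer p = 0 acts as the identity on each of the N(N - 1) ordered pairs and yields the
constant (N/2) v̂(0). The others are rewritten through ρ_p. -/
theorem sum_interactionCoeff {v : UnitAddTorus (Fin d) → ℝ} (hN : 2 ≤ N)
    {Λ : Finset (Fin d → ℤ)} {f : (Fin N → (Fin d → ℤ)) → ℝ}
    (hs : ∀ k, k ∉ box N Λ → f k = 0) :
    ∑ k ∈ box N Λ, ∑ l ∈ box N Λ, f k * f l * interactionCoeff v (l - k) +
      ev Λ (kin momentumSq) f = fullForm v Λ f := by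
  have hN' : (2 : ℝ) ≤ N := by exact_mod_cast hN
  have hd0 : (0 : Fin d → ℤ) ∉ differences Λ := by simp [differences]
  have e1 : ∑ k ∈ box N Λ, ∑ l ∈ box N Λ, f k * f l * interactionCoeff v (l - k) =
      (2 * ((N : ℝ) - 1))⁻¹ * ∑ p ∈ insert 0 (differences Λ), vHat v p *
        ∑ i, ∑ j with j ≠ i, ∑ k ∈ box N Λ,
          f k * f (update (update k i (k i - p)) j (k j + p)) := by
    have h1 : ∀ k ∈ box N Λ, ∑ l ∈ box N Λ, f k * f l * interactionCoeff v (l - k) =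
        (2 * ((N : ℝ) - 1))⁻¹ * ∑ i, ∑ j with j ≠ i, ∑ p ∈ insert 0 (differences Λ),
          vHat v p * (f k * f (update (update k i (k i - p)) j (k j + p))) := by
      intro k hk
      have h2 : ∀ i, ∑ j with j ≠ i, ∑ p ∈ insert 0 (differences Λ),
          vHat v p * (f k * f (update (update k i (k i - p)) j (k j + p))) =
          ∑ j with j ≠ i, ∑ l ∈ box N Λ, f k * (f l *
            (if IsRelative i j (l - k) then vHat v ((l - k) j) else 0)) := by
        intro i
        refine sum_congr rfl fun j hj => ?_
        rw [← mul_sum, sum_isRelative _ hs (mem_filter.1 hj).2 hk, mul_sum]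
        exact sum_congr rfl fun p _ => by ring
      simp_rw [h2, interactionCoeff, mul_sum]
      rw [sum_comm]
      refine sum_congr rfl fun i _ => ?_
      rw [sum_comm]
      refine sum_congr rfl fun j _ => sum_congr rfl fun l _ => ?_
      ring
    rw [sum_congr rfl h1, ← mul_sum]
    congr 1
    simp_rw [mul_sum]
    rw [sum_comm, sum_comm (s := insert 0 (differences Λ))]
    refine sum_congr rfl fun i _ => ?_
    rw [sum_comm, sum_comm (s := insert 0 (differences Λ))]
    refine sum_congr rfl fun j _ => ?_
    rw [sum_comm]
  have e2 : ∑ i : Fin N, ∑ j with j ≠ i, ∑ k ∈ box N Λ,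
      f k * f (update (update k i (k i - 0)) j (k j + 0)) =
      N * ((N : ℝ) - 1) * ev Λ (fun _ => 1) f := by
    have h1 : ∀ i j : Fin N, ∑ k ∈ box N Λ, f k * f (update (update k i (k i - 0)) j (k j + 0)) =
        ev Λ (fun _ => 1) f := by
      intro i j
      refine sum_congr rfl fun k _ => ?_
      simp [sq]
    simp_rw [h1, sum_const, filter_ne', card_erase_of_mem (mem_univ _), card_univ, Fintype.card_fin,
      nsmul_eq_mul, Nat.cast_sub (show 1 ≤ N by omega)]
    rw [sum_const, card_univ, Fintype.card_fin, nsmul_eq_mul]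
    push_cast
    ring
  rw [e1, sum_insert hd0, e2, fullForm, upForm]
  simp_rw [sum_trans_sq_sub _ hs]
  have : (N : ℝ) - 1 ≠ 0 := by linarith
  field_simp
  ring

/-- `momentumSq` of a nonzero wave vector is at least one. -/
theorem one_le_momentumSq {p : Fin d → ℤ} (hp : p ≠ 0) : 1 ≤ momentumSq p := by
  obtain ⟨a, ha⟩ := Function.ne_iff.1 hp
  rw [momentumSq, EuclideanSpace.norm_sq_eq]
  refine le_trans ?_ (single_le_sum (fun b _ => sq_nonneg _) (mem_univ a))
  have h1 : (1 : ℝ) ≤ |(p a : ℝ)| := by exact_mod_cast Int.one_le_abs ha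
  have h3 := Real.pi_gt_three
  simp only [momentum, Real.norm_eq_abs, abs_mul, abs_of_pos Real.pi_pos]
  rw [one_le_sq_iff₀ (by positivity), abs_two]
  nlinarith

theorem momentum_add (p q : Fin d → ℤ) : momentum (p + q) = momentum p + momentum q := by
  ext a; simp [momentum, mul_add]

theorem momentum_zero : momentum (0 : Fin d → ℤ) = 0 := by
  ext a; simp [momentum]

theorem momentum_neg (p : Fin d → ℤ) : momentum (-p) = -momentum p := by
  ext a; simp [momentum]

theorem momentum_injective : Injective (momentum (d := d)) := by
  intro p q h
  funext a
  have := congrArg (fun x : EuclideanSpace ℝ (Fin d) => x a) h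
  simpa [momentum, Real.pi_ne_zero] using this

theorem momentumSq_zero : momentumSq (0 : Fin d → ℤ) = 0 := by
  simp [momentumSq, momentum_zero]

theorem momentumSq_neg (p : Fin d → ℤ) : momentumSq (-p) = momentumSq p := by
  simp [momentumSq, momentum_neg]

theorem momentumSq_nonneg (p : Fin d → ℤ) : 0 ≤ momentumSq p := sq_nonneg _

theorem dispersion_eq (v : UnitAddTorus (Fin d) → ℝ) (p : Fin d → ℤ) :
    dispersion momentumSq (vHat v) p = excitationEnergy v p := by
  rw [dispersion, excitationEnergy, momentumSq]
  congr 2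
  ring

end FullForm
end BoseGas

namespace BoseGas
open Finset Function MeasureTheory

set_option linter.unusedSectionVars false

/-! ### Bosonic symmetry and total momentum in terms of Fourier coefficients. -/

section Bridge

variable {N d : ℕ}

/-- Wave vectors on the `N`-particle torus as configurations of particle momenta. -/
def uncfgEquiv (N d : ℕ) : (Fin N → (Fin d → ℤ)) ≃ (Fin N × Fin d → ℤ) where
  toFun := uncfg
  invFun m i a := m (i, a)
  left_inv _ := rfl
  right_inv _ := rfl

/-- The Fourier coefficient of a wave function at a configuration of particle momenta. -/
noncomputable def coeff (Ψ : L2Torus (Fin N × Fin d)) (k : Fin N → (Fin d → ℤ)) : ℂ :=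
  (planeWaves (Fin N × Fin d)).repr Ψ (uncfg k)

/-- The trigonometric polynomial with coefficients `c k`, `k ∈ box N Λ`. -/
noncomputable def trigPoly (Λ : Finset (Fin d → ℤ)) (c : (Fin N → (Fin d → ℤ)) → ℂ) :
    L2Torus (Fin N × Fin d) :=
  synth ((box N Λ).map (uncfgEquiv N d).toEmbedding) fun m => c ((uncfgEquiv N d).symm m)

theorem coeff_ext {Ψ Φ : L2Torus (Fin N × Fin d)} (h : ∀ k, coeff Ψ k = coeff Φ k) : Ψ = Φ := by
  refine (planeWaves (Fin N × Fin d)).repr.injective (lp.ext (funext fun m => ?_))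
  exact h ((uncfgEquiv N d).symm m)

theorem coeff_trigPoly (Λ : Finset (Fin d → ℤ)) (c : (Fin N → (Fin d → ℤ)) → ℂ)
    (k : Fin N → (Fin d → ℤ)) : coeff (trigPoly Λ c) k = if k ∈ box N Λ then c k else 0 := by
  rw [coeff, trigPoly, repr_synth]
  have : uncfg k ∈ (box N Λ).map (uncfgEquiv N d).toEmbedding ↔ k ∈ box N Λ :=
    mem_map' (uncfgEquiv N d).toEmbedding
  simp only [this]
  rfl

theorem norm_trigPoly_sq (Λ : Finset (Fin d → ℤ)) (c : (Fin N → (Fin d → ℤ)) → ℂ) :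
    ‖trigPoly Λ c‖ ^ 2 =
      ev Λ (fun _ => 1) (fun k => (c k).re) + ev Λ (fun _ => 1) (fun k => (c k).im) := by
  rw [trigPoly, norm_synth_sq, sum_map, ev, ev, ← sum_add_distrib]
  refine sum_congr rfl fun k _ => ?_
  rw [← Complex.normSq_eq_norm_sq, Complex.normSq_apply]
  simp only [Equiv.coe_toEmbedding, Equiv.symm_apply_apply]
  ring

/-- The action of a permutation of the particles on configurations. -/
def permute (σ : Equiv.Perm (Fin N)) (x : UnitAddTorus (Fin N × Fin d)) :
    UnitAddTorus (Fin N × Fin d) := fun ia => x (σ ia.1, ia.2)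

theorem measurePreserving_permute (σ : Equiv.Perm (Fin N)) :
    MeasurePreserving (permute (d := d) σ) (torusMeasure (Fin N × Fin d))
      (torusMeasure (Fin N × Fin d)) := by
  let f : UnitAddTorus (Fin N × Fin d) →+ UnitAddTorus (Fin N × Fin d) :=
    { toFun := permute σ
      map_zero' := rfl
      map_add' := fun x y => rfl }
  refine AddMonoidHom.measurePreserving (f := f) ?_ ?_ ?_
  · change Continuous (permute σ)
    unfold permute
    fun_prop
  · intro y
    refine ⟨permute σ.symm y, ?_⟩
    funext ia
    change y (σ.symm (σ ia.1), ia.2) = y ia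
    rw [Equiv.symm_apply_apply]
  · rfl

theorem mFourier_permute (σ : Equiv.Perm (Fin N)) (k : Fin N → (Fin d → ℤ))
    (x : UnitAddTorus (Fin N × Fin d)) :
    UnitAddTorus.mFourier (uncfg (k ∘ σ)) (permute σ x) = UnitAddTorus.mFourier (uncfg k) x := by
  rw [mFourier_uncfg, mFourier_uncfg]
  exact Equiv.prod_comp σ fun i => UnitAddTorus.mFourier (k i) (position x i)

theorem integral_permute (σ : Equiv.Perm (Fin N)) (k : Fin N → (Fin d → ℤ))
    {f : UnitAddTorus (Fin N × Fin d) → ℂ}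
    (hf : AEStronglyMeasurable f (torusMeasure (Fin N × Fin d))) :
    ∫ x, UnitAddTorus.mFourier (-uncfg k) x * f (permute σ x) ∂torusMeasure (Fin N × Fin d) =
      ∫ x, UnitAddTorus.mFourier (-uncfg (k ∘ σ)) x * f x ∂torusMeasure (Fin N × Fin d) := by
  have h : ∀ x, UnitAddTorus.mFourier (-uncfg k) x =
      UnitAddTorus.mFourier (-uncfg (k ∘ σ)) (permute σ x) := fun x =>
    (mFourier_permute σ (-k) x).symm
  simp_rw [h]
  rw [← integral_map (φ := permute σ)
    (f := fun y => UnitAddTorus.mFourier (-uncfg (k ∘ σ)) y * f y)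
    (measurePreserving_permute σ).measurable.aemeasurable]
  · rw [(measurePreserving_permute σ).map_eq]
  · rw [(measurePreserving_permute σ).map_eq]
    exact (UnitAddTorus.mFourier (-uncfg (k ∘ σ))).continuous.aestronglyMeasurable.mul hf

/-- Permuting the positions in Ψ permutes the particle momenta in its Fourier coefficients, and
these determine Ψ. -/
theorem isBosonic_iff (Ψ : L2Torus (Fin N × Fin d)) : IsBosonic Ψ ↔ IsSymm (coeff Ψ) := by
  refine forall_congr' fun σ => ?_
  let Φ : L2Torus (Fin N × Fin d) := Lp.compMeasurePreserving _ (measurePreserving_permute σ) Ψ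
  have hΦ : Φ =ᵐ[torusMeasure (Fin N × Fin d)] fun x => Ψ (permute σ x) :=
    Lp.coeFn_compMeasurePreserving Ψ (measurePreserving_permute σ)
  have h1 : ∀ k, coeff Φ k = coeff Ψ (k ∘ σ) := by
    intro k
    rw [coeff, coeff, planeWaves_repr, planeWaves_repr,
      ← integral_permute σ k (Lp.aestronglyMeasurable Ψ)]
    refine integral_congr_ae ?_
    filter_upwards [hΦ] with x hx
    rw [hx]
  constructor
  · intro h k
    rw [← h1]
    congr 1
    exact Lp.ext (hΦ.trans h)
  · intro h
    have : Φ = Ψ := coeff_ext fun k => (h1 k).trans (h k)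
    rw [this] at hΦ
    exact hΦ.symm

theorem momentum_sum (k : Fin N → (Fin d → ℤ)) : momentum (∑ i, k i) = ∑ i, momentum (k i) := by
  induction N with
  | zero => simp [momentum_zero]
  | succ n ih => rw [Fin.sum_univ_succ, Fin.sum_univ_succ, momentum_add, ih]

/-- Total momentum is diagonal on plane waves with eigenvalue `momentum (∑ i, k i)`, and `momentum`
is injective. -/
theorem hasTotalMomentum_iff (P : Fin d → ℤ) (Ψ : L2Torus (Fin N × Fin d)) :
    HasTotalMomentum (momentum P) Ψ ↔ ∀ k, ¬ ∑ i, k i = P → coeff Ψ k = 0 := by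
  have hm : ∀ (k : Fin N → (Fin d → ℤ)) (a : Fin d),
      ∑ i, particleMomentum (uncfg k) i a = momentum (∑ i, k i) a := by
    intro k a
    rw [momentum_sum]
    simp [particleMomentum, uncfg]
  constructor
  · intro h k hk
    obtain ⟨a, ha⟩ : ∃ a, momentum (∑ i, k i) a ≠ momentum P a := by
      by_contra! hc
      exact hk (momentum_injective (by ext a; exact hc a))
    obtain ⟨h1, h2⟩ := h a
    have h3 : (planeWaves (Fin N × Fin d)).repr (totalMomentum d N a ⟨Ψ, h1⟩) =
        multiplierCoeff _ ⟨Ψ, h1⟩ := LinearIsometryEquiv.apply_symm_apply _ _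
    have h4 := congrArg (fun c : lp (fun _ : Fin N × Fin d → ℤ => ℂ) 2 => c (uncfg k)) h3
    simp only [h2, map_smul] at h4
    change (momentum P a : ℂ) * coeff Ψ k =
      ((∑ i, particleMomentum (uncfg k) i a : ℝ) : ℂ) * coeff Ψ k at h4
    rw [hm] at h4
    by_contra hc
    exact ha (Complex.ofReal_injective (mul_right_cancel₀ hc h4)).symm
  · intro h a
    have e : ∀ m, ((∑ i, particleMomentum m i a : ℝ) : ℂ) *
        (planeWaves (Fin N × Fin d)).repr Ψ m =
        (momentum P a : ℂ) * (planeWaves (Fin N × Fin d)).repr Ψ m := by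
      intro m
      obtain ⟨k, rfl⟩ := (uncfgEquiv N d).surjective m
      by_cases hk : ∑ i, k i = P
      · change ((∑ i, particleMomentum (uncfg k) i a : ℝ) : ℂ) * _ = _
        rw [hm, hk]
      · have : (planeWaves (Fin N × Fin d)).repr Ψ (uncfgEquiv N d k) = 0 := h k hk
        rw [this, mul_zero, mul_zero]
    have h1 : Ψ ∈ (totalMomentum d N a).domain := by
      refine mem_multiplierDomain.2 ?_
      simp_rw [e]
      exact (lp.memℓp ((planeWaves (Fin N × Fin d)).repr Ψ)).const_smul (momentum P a : ℂ)
    refine ⟨h1, ?_⟩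
    refine (planeWaves (Fin N × Fin d)).repr.injective ?_
    have h3 : (planeWaves (Fin N × Fin d)).repr (totalMomentum d N a ⟨Ψ, h1⟩) =
        multiplierCoeff _ ⟨Ψ, h1⟩ := LinearIsometryEquiv.apply_symm_apply _ _
    rw [h3, map_smul]
    exact lp.ext (funext e)

end Bridge
end BoseGas

namespace BoseGas
open Finset Function MeasureTheory Filter

set_option linter.unusedSectionVars false

/-! ### From finite boxes to the Hamiltonian. -/

section Energies

variable {N d : ℕ}

/-- Bounded measurable even potentials that are non-negative in position and momentum space. -/
structure IsPotential (v : UnitAddTorus (Fin d) → ℝ) (B : ℝ) : Prop where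
  meas : Measurable v
  nonneg : ∀ x, 0 ≤ v x
  bound : ∀ x, v x ≤ B
  even : ∀ x, v (-x) = v x
  type : ∀ k, 0 ≤ vHat v k

/-- The interaction energy as a bounded operator. -/
noncomputable def interactionOp {v : UnitAddTorus (Fin d) → ℝ} {B : ℝ} (hv : IsPotential v B)
    (hN : 2 ≤ N) : L2Torus (Fin N × Fin d) →L[ℂ] L2Torus (Fin N × Fin d) :=
  boundedMultiplication (measurable_interaction hv.meas N)
    (abs_interaction_le hv.nonneg hv.bound hN)

/-- The wave vectors with all components at most `n` in absolute value. -/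
noncomputable def cube (d n : ℕ) : Finset (Fin d → ℤ) := Fintype.piFinset fun _ => Icc (-(n : ℤ)) n

theorem mem_cube {n : ℕ} {p : Fin d → ℤ} : p ∈ cube d n ↔ ∀ a, -(n : ℤ) ≤ p a ∧ p a ≤ n := by
  simp [cube]

theorem zero_mem_cube (d n : ℕ) : 0 ∈ cube d n := by simp [mem_cube]

theorem neg_mem_cube {n : ℕ} {p : Fin d → ℤ} (hp : p ∈ cube d n) : -p ∈ cube d n := by
  rw [mem_cube] at hp ⊢
  intro a
  have := hp a
  simp only [Pi.neg_apply]
  omega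

theorem cube_mono (d : ℕ) : Monotone (cube d) := by
  intro m n h p hp
  rw [mem_cube] at hp ⊢
  intro a
  have := hp a
  omega

theorem exists_mem_cube (p : Fin d → ℤ) : ∃ n, p ∈ cube d n := by
  refine ⟨∑ a, (p a).natAbs, mem_cube.2 fun a => ?_⟩
  have : (p a).natAbs ≤ ∑ b, (p b).natAbs :=
    single_le_sum (f := fun b => (p b).natAbs) (fun b _ => Nat.zero_le _) (mem_univ a)
  omega

theorem exists_subset_cube (Λ : Finset (Fin d → ℤ)) : ∃ n, Λ ⊆ cube d n := by
  choose n hn using exists_mem_cube (d := d)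
  exact ⟨Λ.sup n, fun p hp => cube_mono d (le_sup hp) (hn p)⟩

theorem energy_trigPoly {v : UnitAddTorus (Fin d) → ℝ} {B : ℝ} (hv : IsPotential v B)
    (hN : 2 ≤ N) {Λ : Finset (Fin d → ℤ)} {c : (Fin N → (Fin d → ℤ)) → ℂ}
    (hc : ∀ k, k ∉ box N Λ → c k = 0) :
    ∑ k ∈ box N Λ, kin momentumSq k * ‖c k‖ ^ 2 +
      (inner ℂ (trigPoly Λ c) (interactionOp hv hN (trigPoly Λ c))).re =
      fullForm v Λ (fun k => (c k).re) + fullForm v Λ (fun k => (c k).im) := by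
  rw [trigPoly, interactionOp, inner_synth_boundedMultiplication _ _ _ _
    (fun m => interactionCoeff v ((uncfgEquiv N d).symm m))
    (fun m => integral_interaction hv.meas hv.nonneg hv.bound hv.even ((uncfgEquiv N d).symm m)),
    ← sum_interactionCoeff hN (fun k hk => by rw [hc k hk]; rfl),
    ← sum_interactionCoeff hN (fun k hk => by rw [hc k hk]; rfl)]
  have e1 : ∑ k ∈ box N Λ, kin momentumSq k * ‖c k‖ ^ 2 =
      ev Λ (kin momentumSq) (fun k => (c k).re) + ev Λ (kin momentumSq) (fun k => (c k).im) := by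
    rw [ev, ev, ← sum_add_distrib]
    refine sum_congr rfl fun k _ => ?_
    rw [← Complex.normSq_eq_norm_sq, Complex.normSq_apply]
    ring
  rw [e1, sum_map]
  simp_rw [sum_map, add_mul, sum_add_distrib]
  have e2 : ∀ k l : Fin N → (Fin d → ℤ), (uncfgEquiv N d).symm
      ((uncfgEquiv N d).toEmbedding l - (uncfgEquiv N d).toEmbedding k) = l - k := fun _ _ => rfl
  simp only [e2]
  simp only [Equiv.coe_toEmbedding, Equiv.symm_apply_apply]
  ring

theorem trigPoly_indicator (Λ : Finset (Fin d → ℤ)) (c : (Fin N → (Fin d → ℤ)) → ℂ) :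
    trigPoly Λ (fun k => if k ∈ box N Λ then c k else 0) = trigPoly Λ c :=
  coeff_ext fun k => by
    rw [coeff_trigPoly, coeff_trigPoly]
    split_ifs <;> rfl

theorem tendsto_trigPoly (Ψ : L2Torus (Fin N × Fin d)) :
    Tendsto (fun n => trigPoly (cube d n) (coeff Ψ)) atTop (nhds Ψ) := by
  refine tendsto_synth (F := fun n => (box N (cube d n)).map (uncfgEquiv N d).toEmbedding) ?_ ?_
  · intro m n h
    exact map_subset_map.2 (box_subset (cube_mono d h))
  · intro m
    obtain ⟨k, rfl⟩ := (uncfgEquiv N d).surjective m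
    obtain ⟨n, hn⟩ := exists_subset_cube (univ.image k)
    exact ⟨n, mem_map.2 ⟨k, mem_box.2 fun i => hn (mem_image_of_mem k (mem_univ i)), rfl⟩⟩

/-- Truncate the Fourier series of Ψ. The interaction is bounded, hence continuous, and the kinetic
energy is replaced by `K` before the limit is taken. Membership in the domain of the Hamiltonian is
not assumed, so this also applies to |ψ|. -/
theorem mul_norm_sq_le_of_forms {v : UnitAddTorus (Fin d) → ℝ} {B : ℝ} (hv : IsPotential v B)
    (hN : 2 ≤ N) {S : (Fin N → (Fin d → ℤ)) → Prop} {Ψ : L2Torus (Fin N × Fin d)}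
    (hΨ : IsSymm (coeff Ψ)) (hS : ∀ k, ¬ S k → coeff Ψ k = 0) {E : ℝ}
    (hE : ∀ᶠ n in atTop, ∀ f, Admissible (cube d n) S f →
      E * ev (cube d n) (fun _ => 1) f ≤ fullForm v (cube d n) f) {K : ℝ}
    (hK : ∀ n, ∑ k ∈ box N (cube d n), kin momentumSq k * ‖coeff Ψ k‖ ^ 2 ≤ K) :
    E * ‖Ψ‖ ^ 2 ≤ K + (inner ℂ Ψ (interactionOp hv hN Ψ)).re := by
  have ht := tendsto_trigPoly Ψ
  have h1 : Tendsto (fun n => E * ‖trigPoly (cube d n) (coeff Ψ)‖ ^ 2) atTop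
      (nhds (E * ‖Ψ‖ ^ 2)) := (ht.norm.pow 2).const_mul E
  have h2 : Tendsto (fun n => K + (inner ℂ (trigPoly (cube d n) (coeff Ψ))
      (interactionOp hv hN (trigPoly (cube d n) (coeff Ψ)))).re) atTop
      (nhds (K + (inner ℂ Ψ (interactionOp hv hN Ψ)).re)) :=
    ((Complex.continuous_re.tendsto _).comp
      (ht.inner (((interactionOp hv hN).continuous.tendsto Ψ).comp ht))).const_add K
  refine le_of_tendsto_of_tendsto h1 h2 ?_
  filter_upwards [hE] with n hn
  set c : (Fin N → (Fin d → ℤ)) → ℂ := fun k => if k ∈ box N (cube d n) then coeff Ψ k else 0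
    with hcdef
  have hc : ∀ k, k ∉ box N (cube d n) → c k = 0 := fun k hk => by rw [hcdef]; simp only [if_neg hk]
  have hsymm : ∀ (σ : Equiv.Perm (Fin N)) (k : Fin N → (Fin d → ℤ)), c (k ∘ σ) = c k := by
    intro σ k
    simp only [hcdef, mem_box_comp_perm, hΨ σ k]
  have hsupp : ∀ k, ¬ S k → c k = 0 := by
    intro k hk
    simp only [hcdef, hS k hk, ite_self]
  have h3 := energy_trigPoly hv hN hc
  have hre := hn (fun k => (c k).re) ⟨fun σ k => by simp only [hsymm], fun k hk => by simp [hc k hk],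
    fun k hk => by simp [hsupp k hk]⟩
  have him := hn (fun k => (c k).im) ⟨fun σ k => by simp only [hsymm], fun k hk => by simp [hc k hk],
    fun k hk => by simp [hsupp k hk]⟩
  have h4 := norm_trigPoly_sq (cube d n) c
  rw [hcdef, trigPoly_indicator, ← hcdef] at h3 h4
  have h5 : ∑ k ∈ box N (cube d n), kin momentumSq k * ‖c k‖ ^ 2 ≤ K := by
    refine le_trans (le_of_eq (sum_congr rfl fun k hk => ?_)) (hK n)
    simp only [hcdef, if_pos hk]
  rw [h4]
  linarith

/-- The energy expectation value of a wave function in the domain of the Hamiltonian. -/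
theorem energy_eq {v : UnitAddTorus (Fin d) → ℝ} {B : ℝ} (hv : IsPotential v B)
    (hN : 2 ≤ N) (Ψ : (hamiltonian v N).domain) :
    HasSum (fun k : Fin N → (Fin d → ℤ) =>
        kin momentumSq k * ‖coeff (Ψ : L2Torus (Fin N × Fin d)) k‖ ^ 2)
      ((inner ℂ (Ψ : L2Torus (Fin N × Fin d)) (hamiltonian v N Ψ)).re -
      (inner ℂ (Ψ : L2Torus (Fin N × Fin d)) (interactionOp hv hN Ψ)).re) := by
  have h1 := inner_fourierMultiplier _ (⟨Ψ, Ψ.2.1⟩ : (kinetic d N).domain)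
  have h2 : hamiltonian v N Ψ = kinetic d N ⟨Ψ, Ψ.2.1⟩ + interactionOp hv hN Ψ := rfl
  rw [h2, inner_add_right, Complex.add_re, add_sub_cancel_right]
  exact (Equiv.hasSum_iff (uncfgEquiv N d)).2 h1

theorem trigPoly_mem_domain {v : UnitAddTorus (Fin d) → ℝ} {B : ℝ} (hv : IsPotential v B)
    (hN : 2 ≤ N) (Λ : Finset (Fin d → ℤ)) (c : (Fin N → (Fin d → ℤ)) → ℂ) :
    trigPoly Λ c ∈ (hamiltonian v N).domain :=
  ⟨synth_mem_multiplierDomain _ _ _, memLp_mul_of_bounded (measurable_interaction hv.meas N)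
    (abs_interaction_le hv.nonneg hv.bound hN) _⟩

theorem kin_momentumSq_nonneg (k : Fin N → (Fin d → ℤ)) : 0 ≤ kin momentumSq k :=
  sum_nonneg fun _ _ => momentumSq_nonneg _

theorem inner_interactionOp_nonneg {v : UnitAddTorus (Fin d) → ℝ} {B : ℝ} (hv : IsPotential v B)
    (hN : 2 ≤ N) (Ψ : L2Torus (Fin N × Fin d)) : 0 ≤ (inner ℂ Ψ (interactionOp hv hN Ψ)).re := by
  rw [interactionOp, inner_boundedMultiplication]
  exact integral_nonneg fun x => mul_nonneg (interaction_nonneg hv.nonneg hN x) (sq_nonneg _)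

/-- The sign is visible only in position space, where the energy is a kinetic term plus the integral
of the non-negative interaction against |ψ|². -/
theorem fullForm_nonneg {v : UnitAddTorus (Fin d) → ℝ} {B : ℝ} (hv : IsPotential v B)
    (hN : 2 ≤ N) {Λ : Finset (Fin d → ℤ)} {f : (Fin N → (Fin d → ℤ)) → ℝ}
    (hf : ∀ k, k ∉ box N Λ → f k = 0) : 0 ≤ fullForm v Λ f := by
  have h := energy_trigPoly hv hN (c := fun k => ((f k : ℝ) : ℂ)) (Λ := Λ)
    (fun k hk => by rw [hf k hk, Complex.ofReal_zero])
  simp only [Complex.ofReal_re, Complex.ofReal_im] at h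
  have h0 : fullForm v Λ (fun _ : Fin N → (Fin d → ℤ) => 0) = 0 := by
    rw [← sum_interactionCoeff hN (fun _ _ => rfl)]
    simp [ev]
  rw [h0, add_zero] at h
  rw [← h]
  exact add_nonneg (sum_nonneg fun k _ => mul_nonneg (kin_momentumSq_nonneg k) (sq_nonneg _))
    (inner_interactionOp_nonneg hv hN _)

theorem fullForm_smul {v : UnitAddTorus (Fin d) → ℝ} (hN : 2 ≤ N) {Λ : Finset (Fin d → ℤ)}
    {f : (Fin N → (Fin d → ℤ)) → ℝ} (hf : ∀ k, k ∉ box N Λ → f k = 0) (s : ℝ) :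
    fullForm v Λ (fun k => s * f k) = s ^ 2 * fullForm v Λ f := by
  rw [← sum_interactionCoeff hN hf, ← sum_interactionCoeff hN (fun k hk => by rw [hf k hk, mul_zero]),
    mul_add]
  simp only [ev, mul_sum]
  congr 1
  · exact sum_congr rfl fun k _ => sum_congr rfl fun l _ => by ring
  · exact sum_congr rfl fun k _ => by ring

/-- The energies of the wave functions with Fourier coefficients supported in `S`. -/
def sectorEnergies (v : UnitAddTorus (Fin d) → ℝ) (N : ℕ) (S : (Fin N → (Fin d → ℤ)) → Prop) :
    Set ℝ :=
  energies v N fun Ψ => ∀ k, ¬ S k → coeff Ψ k = 0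

theorem nonneg_of_mem_sectorEnergies {v : UnitAddTorus (Fin d) → ℝ} {B : ℝ}
    (hv : IsPotential v B) (hN : 2 ≤ N) {S : (Fin N → (Fin d → ℤ)) → Prop} {e : ℝ}
    (he : e ∈ sectorEnergies v N S) : 0 ≤ e := by
  obtain ⟨Ψ, -, -, -, rfl⟩ := he
  have h := energy_eq hv hN Ψ
  have h1 := h.nonneg fun k => mul_nonneg (kin_momentumSq_nonneg k) (sq_nonneg _)
  linarith [inner_interactionOp_nonneg hv hN (Ψ : L2Torus (Fin N × Fin d))]

theorem bddBelow_sectorEnergies {v : UnitAddTorus (Fin d) → ℝ} {B : ℝ}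
    (hv : IsPotential v B) (hN : 2 ≤ N) (S : (Fin N → (Fin d → ℤ)) → Prop) :
    BddBelow (sectorEnergies v N S) :=
  ⟨0, fun _ he => nonneg_of_mem_sectorEnergies hv hN he⟩

theorem fullForm_mem_sectorEnergies {v : UnitAddTorus (Fin d) → ℝ} {B : ℝ}
    (hv : IsPotential v B) (hN : 2 ≤ N) {S : (Fin N → (Fin d → ℤ)) → Prop}
    {Λ : Finset (Fin d → ℤ)} {f : (Fin N → (Fin d → ℤ)) → ℝ} (hf : Admissible Λ S f)
    (hn : ev Λ (fun _ => 1) f = 1) : fullForm v Λ f ∈ sectorEnergies v N S := by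
  set c : (Fin N → (Fin d → ℤ)) → ℂ := fun k => ((f k : ℝ) : ℂ) with hcdef
  have hc : ∀ k, k ∉ box N Λ → c k = 0 := fun k hk => by
    simp only [hcdef, hf.box k hk, Complex.ofReal_zero]
  have hco : ∀ k, coeff (trigPoly Λ c) k = c k := by
    intro k
    rw [coeff_trigPoly]
    split_ifs with h
    · rfl
    · exact (hc k h).symm
  have h0 : fullForm v Λ (fun _ : Fin N → (Fin d → ℤ) => 0) = 0 := by
    rw [← sum_interactionCoeff hN (fun _ _ => rfl)]
    simp [ev]
  refine ⟨⟨trigPoly Λ c, trigPoly_mem_domain hv hN Λ c⟩, ?_, ?_, ?_, ?_⟩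
  · rw [isBosonic_iff]
    intro σ k
    rw [hco, hco]
    simp only [hcdef, hf.symm σ k]
  · intro k hk
    rw [hco]
    simp only [hcdef, hf.supp k hk, Complex.ofReal_zero]
  · have h := norm_trigPoly_sq Λ c
    simp only [hcdef, Complex.ofReal_re, Complex.ofReal_im, hn] at h
    have h1 : ev Λ (fun _ => 1) (fun _ : Fin N → (Fin d → ℤ) => (0 : ℝ)) = 0 := by simp [ev]
    rw [h1, add_zero] at h
    exact (pow_eq_one_iff_of_nonneg (norm_nonneg _) two_ne_zero).1 h
  · have h1 := energy_eq hv hN ⟨trigPoly Λ c, trigPoly_mem_domain hv hN Λ c⟩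
    have h2 := energy_trigPoly hv hN hc
    have h3 := h1.unique (hasSum_sum_of_ne_finset_zero (s := box N Λ) fun k hk => by
      simp only [hco, hc k hk]; simp)
    simp only [hco] at h3
    simp only [hcdef, Complex.ofReal_re, Complex.ofReal_im] at h2 h3 ⊢
    rw [h0] at h2
    linarith

theorem sInf_sectorEnergies_mul_le {v : UnitAddTorus (Fin d) → ℝ} {B : ℝ}
    (hv : IsPotential v B) (hN : 2 ≤ N) {S : (Fin N → (Fin d → ℤ)) → Prop}
    {Λ : Finset (Fin d → ℤ)} {f : (Fin N → (Fin d → ℤ)) → ℝ} (hf : Admissible Λ S f) :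
    sInf (sectorEnergies v N S) * ev Λ (fun _ => 1) f ≤ fullForm v Λ f := by
  have h0 : 0 ≤ ev Λ (fun _ => 1) f := ev_nonneg (fun _ _ => zero_le_one) f
  rcases h0.eq_or_lt with h | h
  · rw [← h, mul_zero]
    exact fullForm_nonneg hv hN hf.box
  · set s := (√(ev Λ (fun _ => 1) f))⁻¹ with hs
    have hs2 : s ^ 2 * ev Λ (fun _ => 1) f = 1 := by
      rw [hs, inv_pow, Real.sq_sqrt h0, inv_mul_cancel₀ h.ne']
    have h1 : fullForm v Λ (fun k => s * f k) ∈ sectorEnergies v N S :=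
      fullForm_mem_sectorEnergies hv hN ⟨fun σ k => by simp only [hf.symm σ k],
        fun k hk => by rw [hf.box k hk, mul_zero], fun k hk => by rw [hf.supp k hk, mul_zero]⟩
        (by rw [ev_one_smul, hs2])
    have h2 := csInf_le (bddBelow_sectorEnergies hv hN S) h1
    rw [fullForm_smul hN hf.box] at h2
    calc _ ≤ s ^ 2 * fullForm v Λ f * ev Λ (fun _ => 1) f := mul_le_mul_of_nonneg_right h2 h0
      _ = _ := by linear_combination fullForm v Λ f * hs2

/-- The kinetic energy of Ψ is a sum of non-negative terms, so it bounds its own finite truncations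
and can play the role of `K`. -/
theorem le_sInf_sectorEnergies {v : UnitAddTorus (Fin d) → ℝ} {B : ℝ}
    (hv : IsPotential v B) (hN : 2 ≤ N) {S : (Fin N → (Fin d → ℤ)) → Prop}
    (hne : (sectorEnergies v N S).Nonempty) {E : ℝ}
    (hE : ∀ᶠ n in atTop, ∀ f, Admissible (cube d n) S f →
      E * ev (cube d n) (fun _ => 1) f ≤ fullForm v (cube d n) f) :
    E ≤ sInf (sectorEnergies v N S) := by
  refine le_csInf hne ?_
  rintro e ⟨Ψ, hb, hS, hn, rfl⟩
  have h := energy_eq hv hN Ψ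
  have h1 := mul_norm_sq_le_of_forms hv hN ((isBosonic_iff _).1 hb) hS hE (fun n =>
    sum_le_hasSum (box N (cube d n))
      (fun k _ => mul_nonneg (kin_momentumSq_nonneg k) (sq_nonneg _)) h)
  rw [hn] at h1
  linarith

theorem groundEnergy_eq (v : UnitAddTorus (Fin d) → ℝ) (N : ℕ) :
    groundEnergy v N = sInf (sectorEnergies v N fun _ => True) := by
  rw [groundEnergy, sectorEnergies]
  congr 2
  funext Ψ
  simp

theorem sectorEnergy_eq (v : UnitAddTorus (Fin d) → ℝ) (N : ℕ) (P : Fin d → ℤ) :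
    sectorEnergy v N (momentum P) = sInf (sectorEnergies v N fun k => ∑ i, k i = P) := by
  rw [sectorEnergy, sectorEnergies]
  congr 2
  funext Ψ
  exact propext (hasTotalMomentum_iff P Ψ)

end Energies
end BoseGas

namespace BoseGas
open Finset Function MeasureTheory Filter

set_option linter.unusedSectionVars false

/-! ### Contractions do not increase the kinetic energy. -/

section Diamagnetic

variable {ι : Type} [Fintype ι]

/-- The Fourier coefficients of a continuous function. -/
noncomputable def fourierInt (h : C(UnitAddTorus ι, ℂ)) (m : ι → ℤ) : ℂ :=
  ∫ x, UnitAddTorus.mFourier (-m) x * h x ∂torusMeasure ι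

/-- A continuous function as an element of `L²`. -/
noncomputable def toL2 (h : C(UnitAddTorus ι, ℂ)) : L2Torus ι :=
  ContinuousMap.toLp (E := ℂ) 2 (torusMeasure ι) ℂ h

theorem toL2_ae (h : C(UnitAddTorus ι, ℂ)) : toL2 h =ᵐ[torusMeasure ι] h :=
  ContinuousMap.coeFn_toLp (torusMeasure ι) h

theorem repr_toL2 (h : C(UnitAddTorus ι, ℂ)) (m : ι → ℤ) :
    (planeWaves ι).repr (toL2 h) m = fourierInt h m := by
  rw [planeWaves_repr, fourierInt]
  refine integral_congr_ae ?_
  filter_upwards [toL2_ae h] with x hx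
  rw [hx]

theorem hasSum_fourierInt_sq (h : C(UnitAddTorus ι, ℂ)) :
    HasSum (fun m => ‖fourierInt h m‖ ^ 2) (∫ x, ‖h x‖ ^ 2 ∂torusMeasure ι) := by
  have h1 := UnitAddTorus.hasSum_sq_mFourierCoeff (toL2 h)
  have h2 : ∫ x, ‖h x‖ ^ 2 ∂torusMeasure ι = ∫ x, ‖toL2 h x‖ ^ 2 ∂torusMeasure ι := by
    refine integral_congr_ae ?_
    filter_upwards [toL2_ae h] with x hx
    rw [hx]
  rw [h2]
  refine h1.congr_fun fun m => ?_
  rw [← repr_toL2, planeWaves_repr]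
  rfl

/-- The difference of a function and its translate. -/
noncomputable def increment (h : C(UnitAddTorus ι, ℂ)) (y : UnitAddTorus ι) : C(UnitAddTorus ι, ℂ) where
  toFun x := h (x + y) - h x
  continuous_toFun := by fun_prop

theorem fourierInt_increment (h : C(UnitAddTorus ι, ℂ)) (y : UnitAddTorus ι) (m : ι → ℤ) :
    fourierInt (increment h y) m = (UnitAddTorus.mFourier m y - 1) * fourierInt h m := by
  have hint : ∀ f : C(UnitAddTorus ι, ℂ), Integrable f (torusMeasure ι) := fun f =>
    f.continuous.integrable_of_hasCompactSupport (HasCompactSupport.of_compactSpace _)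
  have h1 : ∫ x, UnitAddTorus.mFourier (-m) x * h (x + y) ∂torusMeasure ι =
      UnitAddTorus.mFourier m y * fourierInt h m := by
    rw [fourierInt, ← integral_add_right_eq_self (fun x => UnitAddTorus.mFourier (-m) x * h x) y,
      ← integral_const_mul]
    refine integral_congr_ae (Eventually.of_forall fun x => ?_)
    simp only
    rw [mFourier_apply_add, UnitAddTorus.mFourier_neg (x := y)]
    have : UnitAddTorus.mFourier m y * (starRingEnd ℂ) (UnitAddTorus.mFourier m y) = 1 := by
      rw [Complex.mul_conj, Complex.normSq_eq_norm_sq, norm_mFourier_apply]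
      norm_num
    linear_combination -UnitAddTorus.mFourier (-m) x * h (x + y) * this
  rw [sub_mul, one_mul, ← h1, fourierInt, fourierInt, ← integral_sub]
  · refine integral_congr_ae (Eventually.of_forall fun x => ?_)
    simp only [increment, ContinuousMap.coe_mk]
    ring
  · exact hint (UnitAddTorus.mFourier (-m) * h.comp ⟨fun x => x + y, by fun_prop⟩)
  · exact hint (UnitAddTorus.mFourier (-m) * h)

/-- By Parseval, the L² norm of an increment weighs the Fourier coefficients with |e^{2πi m·y} -
1|². The pointwise contraction of increments thus passes to Fourier space. -/
theorem sum_increment_le {g h : C(UnitAddTorus ι, ℂ)} (hgh : ∀ x y, ‖g x - g y‖ ≤ ‖h x - h y‖)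
    (F : Finset (ι → ℤ)) {F' : Finset (ι → ℤ)} (hF' : ∀ m, m ∉ F' → fourierInt h m = 0)
    (y : UnitAddTorus ι) :
    ∑ m ∈ F, ‖UnitAddTorus.mFourier m y - 1‖ ^ 2 * ‖fourierInt g m‖ ^ 2 ≤
      ∑ m ∈ F', ‖UnitAddTorus.mFourier m y - 1‖ ^ 2 * ‖fourierInt h m‖ ^ 2 := by
  have h1 := hasSum_fourierInt_sq (increment g y)
  have h2 := hasSum_fourierInt_sq (increment h y)
  simp only [fourierInt_increment, norm_mul, mul_pow] at h1 h2
  have hint : ∀ f : C(UnitAddTorus ι, ℂ), Integrable (fun x => ‖f x‖ ^ 2) (torusMeasure ι) :=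
    fun f => (f.continuous.norm.pow 2).integrable_of_hasCompactSupport
      (HasCompactSupport.of_compactSpace _)
  calc _ ≤ ∫ x, ‖increment g y x‖ ^ 2 ∂torusMeasure ι :=
        sum_le_hasSum F (fun m _ => by positivity) h1
    _ ≤ ∫ x, ‖increment h y x‖ ^ 2 ∂torusMeasure ι := by
        refine integral_mono (hint _) (hint _) fun x => ?_
        exact pow_le_pow_left₀ (norm_nonneg _) (hgh _ _) 2
    _ = _ := h2.unique (hasSum_sum_of_ne_finset_zero fun m hm => by simp [hF' m hm])

theorem mFourier_single_coe [DecidableEq ι] (m : ι → ℤ) (j : ι) (s : ℝ) :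
    UnitAddTorus.mFourier m (Pi.single j (s : UnitAddCircle)) =
      Complex.exp (2 * Real.pi * Complex.I * m j * s) := by
  simp only [UnitAddTorus.mFourier, ContinuousMap.coe_mk]
  rw [prod_eq_single j]
  · rw [Pi.single_eq_same, fourier_coe_apply]
    simp
  · intro i _ hi
    simp [Pi.single_eq_of_ne hi]
  · simp

theorem tendsto_increment [DecidableEq ι] (m : ι → ℤ) (j : ι) :
    Tendsto (fun s : ℝ => ‖UnitAddTorus.mFourier m (Pi.single j (s : UnitAddCircle)) - 1‖ ^ 2
      / s ^ 2) (nhdsWithin 0 {0}ᶜ) (nhds ((2 * Real.pi * m j) ^ 2)) := by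
  have h1 : HasDerivAt (fun s : ℝ => Complex.exp (2 * Real.pi * Complex.I * m j * s))
      (2 * Real.pi * Complex.I * m j) 0 := by
    have h2 : HasDerivAt (fun s : ℝ => 2 * Real.pi * Complex.I * m j * (s : ℂ))
        (2 * Real.pi * Complex.I * m j) 0 := by
      simpa using (Complex.ofRealCLM.hasDerivAt (x := (0 : ℝ))).const_mul
        (2 * Real.pi * Complex.I * m j)
    simpa using h2.cexp
  have h3 := (hasDerivAt_iff_tendsto_slope.1 h1).norm.pow 2
  have e : ‖(2 * Real.pi * Complex.I * m j : ℂ)‖ ^ 2 = (2 * Real.pi * m j) ^ 2 := by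
    simp only [norm_mul, Complex.norm_I, mul_one, Complex.norm_real, Complex.norm_intCast,
      Complex.norm_ofNat, Real.norm_eq_abs, mul_pow, sq_abs]
  rw [e] at h3
  refine h3.congr fun s => ?_
  rw [slope_def_module, mFourier_single_coe]
  simp [mul_pow, div_eq_inv_mul]

/-- Taking a contraction of the values of a function does not increase its kinetic energy. -/
theorem sum_sq_fourierInt_le [DecidableEq ι] {g h : C(UnitAddTorus ι, ℂ)}
    (hgh : ∀ x y, ‖g x - g y‖ ≤ ‖h x - h y‖)
    (F : Finset (ι → ℤ)) {F' : Finset (ι → ℤ)} (hF' : ∀ m, m ∉ F' → fourierInt h m = 0) (j : ι) :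
    ∑ m ∈ F, (2 * Real.pi * m j) ^ 2 * ‖fourierInt g m‖ ^ 2 ≤
      ∑ m ∈ F', (2 * Real.pi * m j) ^ 2 * ‖fourierInt h m‖ ^ 2 := by
  -- Dividing increments in direction `j` by s² and letting s → 0 recovers the kinetic weights,
  -- without any derivative of `g`, which need not be differentiable.
  have key : ∀ (f : C(UnitAddTorus ι, ℂ)) (A : Finset (ι → ℤ)),
      Tendsto (fun s : ℝ => ∑ m ∈ A, ‖UnitAddTorus.mFourier m (Pi.single j (s : UnitAddCircle)) - 1‖
        ^ 2 / s ^ 2 * ‖fourierInt f m‖ ^ 2) (nhdsWithin 0 {0}ᶜ)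
        (nhds (∑ m ∈ A, (2 * Real.pi * m j) ^ 2 * ‖fourierInt f m‖ ^ 2)) := fun f A =>
    tendsto_finsetSum _ fun m _ => (tendsto_increment m j).mul_const _
  refine le_of_tendsto_of_tendsto' (key g F) (key h F') fun s => ?_
  have h1 := sum_increment_le hgh F hF' (Pi.single j (s : UnitAddCircle))
  simp_rw [div_mul_eq_mul_div, ← sum_div]
  exact div_le_div_of_nonneg_right h1 (sq_nonneg s)

end Diamagnetic
end BoseGas

namespace BoseGas
open Finset Function MeasureTheory Filter

set_option linter.unusedSectionVars false

/-! ### The ground state energy is attained in the zero momentum sector. -/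

section ZeroMomentum

variable {N d : ℕ}

theorem interactionCoeff_eq_zero (v : UnitAddTorus (Fin d) → ℝ) {m : Fin N → (Fin d → ℤ)}
    (hm : ∑ i, m i ≠ 0) : interactionCoeff v m = 0 := by
  rw [interactionCoeff, sum_eq_zero, mul_zero]
  intro i _
  refine sum_eq_zero fun j hj => if_neg fun h => hm ?_
  have hji := (mem_filter.1 hj).2
  rw [← add_sum_erase _ _ (mem_univ i), ← add_sum_erase _ _ (a := j), sum_eq_zero, add_zero, h.1]
  · intro r hr
    simp only [mem_erase] at hr
    exact h.2 r hr.2.1 hr.1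
  · simp [hji]

/-- The component of total momentum `P`. -/
def component (P : Fin d → ℤ) (f : (Fin N → (Fin d → ℤ)) → ℝ) (k : Fin N → (Fin d → ℤ)) : ℝ :=
  if ∑ i, k i = P then f k else 0

theorem sum_component_mul (f : (Fin N → (Fin d → ℤ)) → ℝ) {A : Finset (Fin d → ℤ)}
    {k : Fin N → (Fin d → ℤ)} (hk : ∑ i, k i ∈ A) (l : Fin N → (Fin d → ℤ))
    (hkl : ∑ i, l i = ∑ i, k i) : ∑ P ∈ A, component P f k * component P f l = f k * f l := by
  simp only [component, hkl]
  rw [sum_eq_single_of_mem _ hk]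
  · simp
  · intro P _ hP
    simp [hP.symm]

/-- The interaction conserves total momentum (`interactionCoeff_eq_zero`), so different sectors do
not interact. -/
theorem fullForm_eq_sum_component {v : UnitAddTorus (Fin d) → ℝ} (hN : 2 ≤ N)
    {Λ : Finset (Fin d → ℤ)} {f : (Fin N → (Fin d → ℤ)) → ℝ} (hf : ∀ k, k ∉ box N Λ → f k = 0) :
    fullForm v Λ f = ∑ P ∈ (box N Λ).image (fun k => ∑ i, k i), fullForm v Λ (component P f) := by
  have hc : ∀ P k, k ∉ box N Λ → component P f k = 0 := fun P k hk => by
    rw [component, hf k hk, ite_self]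
  simp_rw [← sum_interactionCoeff hN hf, ← sum_interactionCoeff hN (hc _)]
  rw [sum_add_distrib]
  refine congrArg₂ _ ?_ ?_
  · symm
    rw [sum_comm]
    refine sum_congr rfl fun k hk => ?_
    rw [sum_comm]
    refine sum_congr rfl fun l _ => ?_
    rw [← sum_mul]
    by_cases h : ∑ i, l i = ∑ i, k i
    · rw [sum_component_mul f (mem_image_of_mem _ hk) l h]
    · rw [interactionCoeff_eq_zero, mul_zero, mul_zero]
      simpa [sum_sub_distrib, sub_eq_zero] using h
  · simp only [ev]
    symm
    rw [sum_comm]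
    refine sum_congr rfl fun k hk => ?_
    rw [← mul_sum]
    congr 1
    simp only [sq]
    rw [sum_component_mul f (mem_image_of_mem _ hk) k rfl]

theorem ev_one_eq_sum_component {Λ : Finset (Fin d → ℤ)} (f : (Fin N → (Fin d → ℤ)) → ℝ) :
    ev Λ (fun _ => 1) f =
      ∑ P ∈ (box N Λ).image (fun k => ∑ i, k i), ev Λ (fun _ => 1) (component P f) := by
  simp only [ev]
  rw [sum_comm]
  refine sum_congr rfl fun k hk => ?_
  rw [← mul_sum]
  congr 1
  simp only [sq]
  rw [sum_component_mul f (mem_image_of_mem _ hk) k rfl]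

theorem admissible_component {Λ : Finset (Fin d → ℤ)} {f : (Fin N → (Fin d → ℤ)) → ℝ}
    (hf : Admissible Λ (fun _ => True) f) (P : Fin d → ℤ) :
    Admissible Λ (fun k => ∑ i, k i = P) (component P f) where
  symm σ k := by
    simp only [component, hf.symm σ k, comp_apply, Equiv.sum_comp σ k]
  box k hk := by rw [component, hf.box k hk, ite_self]
  supp k hk := if_neg hk

/-- The trigonometric polynomial with real coefficients `f` as a continuous function. -/
noncomputable def trigFun (Λ : Finset (Fin d → ℤ)) (f : (Fin N → (Fin d → ℤ)) → ℝ) :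
    C(UnitAddTorus (Fin N × Fin d), ℂ) :=
  ∑ k ∈ box N Λ, (f k : ℂ) • UnitAddTorus.mFourier (uncfg k)

theorem toL2_trigFun (Λ : Finset (Fin d → ℤ)) (f : (Fin N → (Fin d → ℤ)) → ℝ) :
    toL2 (trigFun Λ f) = trigPoly Λ (fun k => (f k : ℂ)) := by
  rw [toL2, trigFun, map_sum, trigPoly, synth, sum_map]
  refine sum_congr rfl fun k _ => ?_
  rw [map_smul, coe_planeWaves]
  rfl

/-- The absolute value of a continuous function. -/
noncomputable def absFun {ι : Type} (h : C(UnitAddTorus ι, ℂ)) : C(UnitAddTorus ι, ℂ) where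
  toFun x := (‖h x‖ : ℂ)
  continuous_toFun := by fun_prop

theorem mFourier_uncfg_diagonal (k : Fin N → (Fin d → ℤ)) (y : UnitAddTorus (Fin d)) :
    UnitAddTorus.mFourier (uncfg k) (fun ia => y ia.2) = UnitAddTorus.mFourier (∑ i, k i) y := by
  rw [mFourier_uncfg]
  change ∏ i, UnitAddTorus.mFourier (k i) y = _
  induction N with
  | zero => simp [UnitAddTorus.mFourier_zero]
  | succ n ih => rw [Fin.prod_univ_succ, Fin.sum_univ_succ, UnitAddTorus.mFourier_add, ih]

/-- Replace the wave function ψ by |ψ|. Norm and interaction energy are unchanged, the kinetic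
energy does not increase, symmetry is kept, and the total momentum becomes zero. -/
theorem fullForm_ge_of_momentum {v : UnitAddTorus (Fin d) → ℝ} {B : ℝ} (hv : IsPotential v B)
    (hN : 2 ≤ N) {Λ : Finset (Fin d → ℤ)} {P : Fin d → ℤ} {f : (Fin N → (Fin d → ℤ)) → ℝ}
    (hf : Admissible Λ (fun k => ∑ i, k i = P) f) :
    sInf (sectorEnergies v N fun k => ∑ i, k i = 0) * ev Λ (fun _ => 1) f ≤ fullForm v Λ f := by
  set c : (Fin N → (Fin d → ℤ)) → ℂ := fun k => (f k : ℂ) with hcdef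
  have hc : ∀ k, k ∉ box N Λ → c k = 0 := fun k hk => by
    simp only [hcdef, hf.box k hk, Complex.ofReal_zero]
  have hco : ∀ k, coeff (trigPoly Λ c) k = c k := by
    intro k
    rw [coeff_trigPoly]
    split_ifs with h
    · rfl
    · exact (hc k h).symm
  set ψ := trigFun Λ f
  set g := absFun ψ
  have hψ : toL2 ψ = trigPoly Λ c := toL2_trigFun Λ f
  have hψae : trigPoly Λ c =ᵐ[torusMeasure (Fin N × Fin d)] ψ := by rw [← hψ]; exact toL2_ae ψ
  have hgae := toL2_ae g
  have hg : ∀ x, g x = (‖ψ x‖ : ℂ) := fun _ => rfl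
  have hnorm : ‖toL2 g‖ = ‖trigPoly Λ c‖ := by
    rw [Lp.norm_def, Lp.norm_def]
    congr 1
    refine eLpNorm_congr_norm_ae ?_
    filter_upwards [hψae, hgae] with x h1 h2
    rw [h1, h2, hg, Complex.norm_real, norm_norm]
  have hint : (inner ℂ (toL2 g) (interactionOp hv hN (toL2 g))).re =
      (inner ℂ (trigPoly Λ c) (interactionOp hv hN (trigPoly Λ c))).re := by
    rw [interactionOp, inner_boundedMultiplication, inner_boundedMultiplication]
    refine integral_congr_ae ?_
    filter_upwards [hψae, hgae] with x h1 h2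
    rw [h1, h2, hg, Complex.norm_real, norm_norm]
  have hsymm : IsSymm (coeff (toL2 g)) := by
    have hb : IsBosonic (trigPoly Λ c) := by
      rw [isBosonic_iff]
      intro σ k
      rw [hco, hco]
      simp only [hcdef, hf.symm σ k]
    rw [← isBosonic_iff]
    intro σ
    have h1 := (measurePreserving_permute (d := d) σ).quasiMeasurePreserving.ae_eq_comp hψae
    have h2 := (measurePreserving_permute (d := d) σ).quasiMeasurePreserving.ae_eq_comp hgae
    filter_upwards [h1, h2, hb σ, hψae, hgae] with x a1 a2 a3 a4 a5
    simp only [comp_apply] at a1 a2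
    change toL2 g (permute σ x) = _
    change trigPoly Λ c (permute σ x) = _ at a3
    rw [a2, a5, hg, hg, ← a1, a3, a4]
  -- Under a common translation of all particles ψ acquires only a phase, so |ψ| is invariant.
  have hzero : ∀ k, ¬ ∑ i, k i = 0 → coeff (toL2 g) k = 0 := by
    intro k hk
    rw [coeff, repr_toL2, fourierInt]
    obtain ⟨y, hy⟩ := exists_mFourier_ne_one (k := -∑ i, k i) (neg_ne_zero.2 hk)
    refine integral_eq_zero_of_shift (fun ia => y ia.2) hy fun x => ?_
    have h1 : UnitAddTorus.mFourier (-uncfg k) (fun ia : Fin N × Fin d => y ia.2) =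
        UnitAddTorus.mFourier (-∑ i, k i) y := by
      have := mFourier_uncfg_diagonal (-k) y
      simp only [Pi.neg_apply, sum_neg_distrib] at this
      exact this
    have h2 : ψ (x + fun ia => y ia.2) = UnitAddTorus.mFourier P y * ψ x := by
      simp only [ψ, trigFun, ContinuousMap.sum_apply, ContinuousMap.smul_apply, smul_eq_mul, mul_sum]
      refine sum_congr rfl fun l _ => ?_
      by_cases hl : ∑ i, l i = P
      · rw [mFourier_apply_add, mFourier_uncfg_diagonal, hl]
        ring
      · rw [hf.supp l hl]
        simp
    rw [hg, hg, h2, norm_mul, norm_mFourier_apply, one_mul, mFourier_apply_add, h1]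
    ring
  -- The modulus is a contraction of ℂ; the kinetic comparison is applied in each coordinate
  -- direction separately.
  have hkin : ∀ n, ∑ k ∈ box N (cube d n), kin momentumSq k * ‖coeff (toL2 g) k‖ ^ 2 ≤
      ∑ k ∈ box N Λ, kin momentumSq k * ‖c k‖ ^ 2 := by
    intro n
    have e : ∀ k : Fin N → (Fin d → ℤ), kin momentumSq k =
        ∑ ia : Fin N × Fin d, (2 * Real.pi * uncfg k ia) ^ 2 := by
      intro k
      rw [Fintype.sum_prod_type, kin]
      refine sum_congr rfl fun i _ => ?_
      rw [momentumSq, EuclideanSpace.norm_sq_eq]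
      refine sum_congr rfl fun a _ => ?_
      simp only [momentum, Real.norm_eq_abs, sq_abs]
      rfl
    have hF' : ∀ m, m ∉ (box N Λ).map (uncfgEquiv N d).toEmbedding → fourierInt ψ m = 0 := by
      intro m hm
      obtain ⟨k, rfl⟩ := (uncfgEquiv N d).surjective m
      rw [← repr_toL2, hψ]
      refine (hco k).trans (hc k fun hk => hm ?_)
      exact mem_map.2 ⟨k, hk, rfl⟩
    have h1 := sum_le_sum fun (ia : Fin N × Fin d) (_ : ia ∈ univ) =>
      sum_sq_fourierInt_le (g := g) (h := ψ) (fun x y => by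
        rw [hg, hg, ← Complex.ofReal_sub, Complex.norm_real]
        exact abs_norm_sub_norm_le _ _)
        ((box N (cube d n)).map (uncfgEquiv N d).toEmbedding) hF' ia
    simp only [← repr_toL2, hψ, sum_map] at h1
    simp_rw [e, sum_mul, ← hco]
    rw [sum_comm (s := box N (cube d n)), sum_comm (s := box N Λ)]
    exact h1
  have h1 := mul_norm_sq_le_of_forms hv hN hsymm hzero (E := sInf (sectorEnergies v N fun k =>
    ∑ i, k i = 0)) (Eventually.of_forall fun n f hf => sInf_sectorEnergies_mul_le hv hN hf) hkin
  rw [hnorm, hint, energy_trigPoly hv hN hc, norm_trigPoly_sq] at h1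
  have h0 : fullForm v Λ (fun _ : Fin N → (Fin d → ℤ) => 0) = 0 := by
    rw [← sum_interactionCoeff hN (fun _ _ => rfl)]
    simp [ev]
  have h0' : ev Λ (fun _ => 1) (fun _ : Fin N → (Fin d → ℤ) => (0 : ℝ)) = 0 := by simp [ev]
  simpa only [hcdef, Complex.ofReal_re, Complex.ofReal_im, h0, h0', add_zero] using h1

theorem groundEnergy_le_sectorEnergy {v : UnitAddTorus (Fin d) → ℝ} {B : ℝ}
    (hv : IsPotential v B) (hN : 2 ≤ N) (P : Fin d → ℤ)
    (hne : (sectorEnergies v N fun k => ∑ i, k i = P).Nonempty) :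
    groundEnergy v N ≤ sectorEnergy v N (momentum P) := by
  rw [groundEnergy_eq, sectorEnergy_eq]
  refine csInf_le_csInf (bddBelow_sectorEnergies hv hN _) hne ?_
  rintro e ⟨Ψ, h1, -, h2, h3⟩
  exact ⟨Ψ, h1, by simp, h2, h3⟩

/-- The ground state has zero total momentum. -/
theorem sectorEnergy_zero {v : UnitAddTorus (Fin d) → ℝ} {B : ℝ} (hv : IsPotential v B)
    (hN : 2 ≤ N) (hne : (sectorEnergies v N fun k => ∑ i, k i = 0).Nonempty) :
    sectorEnergy v N (momentum 0) = groundEnergy v N := by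
  refine le_antisymm ?_ (groundEnergy_le_sectorEnergy hv hN 0 hne)
  rw [groundEnergy_eq, sectorEnergy_eq]
  refine le_sInf_sectorEnergies hv hN ?_ (Eventually.of_forall fun n f hf => ?_)
  · obtain ⟨e, Ψ, h1, -, h2, h3⟩ := hne
    exact ⟨e, Ψ, h1, by simp, h2, h3⟩
  · rw [fullForm_eq_sum_component hN hf.box, ev_one_eq_sum_component, mul_sum]
    exact sum_le_sum fun P _ => fullForm_ge_of_momentum hv hN (admissible_component hf P)

end ZeroMomentum
end BoseGas

namespace BoseGas
open Finset Function MeasureTheory Filter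

set_option linter.unusedSectionVars false

/-! ### Summability of v̂. -/

section Summability

variable {d : ℕ}

theorem card_cube (d n : ℕ) : #(cube d n) = (2 * n + 1) ^ d := by
  simp only [cube, Fintype.card_piFinset, Int.card_Icc, prod_const, card_univ, Fintype.card_fin]
  congr 1
  omega

theorem norm_boundedMultiplication_le {ι : Type} [Fintype ι] {V : UnitAddTorus ι → ℝ}
    (hV : Measurable V) {B : ℝ} (hB : ∀ x, |V x| ≤ B) (Ψ : L2Torus ι) :
    ‖boundedMultiplication hV hB Ψ‖ ≤ B * ‖Ψ‖ := by
  refine Lp.norm_le_mul_norm_of_ae_le_mul ?_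
  filter_upwards [boundedMultiplication_ae hV hB Ψ] with x hx
  rw [hx, norm_mul, Complex.norm_real, Real.norm_eq_abs]
  exact mul_le_mul_of_nonneg_right (hB x) (norm_nonneg _)

theorem integral_mul_mFourier {v : UnitAddTorus (Fin d) → ℝ} (heven : ∀ x, v (-x) = v x)
    (m : Fin d → ℤ) :
    ∫ x, (v x : ℂ) * UnitAddTorus.mFourier m x ∂torusMeasure (Fin d) = (vHat v m : ℂ) := by
  rw [← vHat_neg heven, ← vHat_eq v heven]
  change _ = ∫ t, UnitAddTorus.mFourier (- -m) t • (v t : ℂ) ∂torusMeasure (Fin d)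
  refine integral_congr_ae (Eventually.of_forall fun x => ?_)
  simp only [neg_neg, smul_eq_mul, mul_comm]

/-- Test multiplication by v on the polynomial with all coefficients one on the cube of radius 2L.
Its expectation is at most B times the number of coefficients. On the other hand each `p` in the
cube of radius L occurs as a difference at least (2L + 1)^d times, and v̂ ≥ 0 allows the other terms
to be dropped. -/
theorem sum_vHat_cube_le {v : UnitAddTorus (Fin d) → ℝ} {B : ℝ} (hv : IsPotential v B) (L : ℕ) :
    ∑ p ∈ cube d L, vHat v p ≤ B * 2 ^ d := by
  have hB : ∀ x, |v x| ≤ B := fun x => by rw [abs_of_nonneg (hv.nonneg x)]; exact hv.bound x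
  have hB0 : 0 ≤ B := (hv.nonneg 0).trans (hv.bound 0)
  have h1 := inner_synth_boundedMultiplication hv.meas hB (cube d (2 * L)) (fun _ => 1) (vHat v)
    (integral_mul_mFourier hv.even)
  have h2 : (inner ℂ (synth (cube d (2 * L)) fun _ => 1)
      (boundedMultiplication hv.meas hB (synth (cube d (2 * L)) fun _ => 1))).re ≤
      B * (2 * (2 * L : ℕ) + 1) ^ d := by
    refine (Complex.re_le_norm _).trans ((norm_inner_le_norm _ _).trans ?_)
    have h3 := norm_synth_sq (cube d (2 * L)) (fun _ => (1 : ℂ))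
    simp only [norm_one, one_pow, sum_const, card_cube, nsmul_eq_mul, mul_one] at h3
    push_cast at h3 ⊢
    rw [← h3]
    have h4 := norm_boundedMultiplication_le hv.meas hB (synth (cube d (2 * L)) fun _ => 1)
    nlinarith [mul_le_mul_of_nonneg_left h4 (norm_nonneg (synth (cube d (2 * L)) fun _ => (1 : ℂ)))]
  have h3 : (2 * (L : ℝ) + 1) ^ d * ∑ p ∈ cube d L, vHat v p ≤
      ∑ k ∈ cube d (2 * L), ∑ l ∈ cube d (2 * L), vHat v (l - k) := by
    have e : (2 * (L : ℝ) + 1) ^ d * ∑ p ∈ cube d L, vHat v p =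
        ∑ k ∈ cube d L, ∑ p ∈ cube d L, vHat v p := by
      rw [sum_const, card_cube, nsmul_eq_mul]
      push_cast
      rfl
    rw [e]
    refine (sum_le_sum fun k hk => ?_).trans (sum_le_sum_of_subset_of_nonneg
      (cube_mono d (show L ≤ 2 * L by omega)) fun k _ _ => sum_nonneg fun l _ => hv.type _)
    have e2 : ∑ p ∈ cube d L, vHat v p = ∑ l ∈ (cube d L).image (fun p => p + k), vHat v (l - k) := by
      rw [sum_image (fun _ _ _ _ h => add_right_cancel h)]
      simp
    rw [e2]
    refine sum_le_sum_of_subset_of_nonneg ?_ fun l _ _ => hv.type _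
    intro l hl
    obtain ⟨p, hp, rfl⟩ := mem_image.1 hl
    rw [mem_cube] at hk hp ⊢
    intro a
    have h4 := hk a
    have h5 := hp a
    simp only [Pi.add_apply]
    omega
  simp only [Complex.one_re, Complex.one_im, mul_one, mul_zero, add_zero, one_mul] at h1
  rw [h1] at h2
  have h4 := h3.trans h2
  -- The ratio of the two cube sizes is the origin of the factor 2^d.
  have h5 : (2 * ((2 * L : ℕ) : ℝ) + 1) ^ d ≤ 2 ^ d * (2 * (L : ℝ) + 1) ^ d := by
    rw [← mul_pow]
    refine pow_le_pow_left₀ (by positivity) ?_ d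
    push_cast
    linarith
  have h6 : (2 * (L : ℝ) + 1) ^ d * ∑ p ∈ cube d L, vHat v p ≤
      (2 * (L : ℝ) + 1) ^ d * (B * 2 ^ d) := by
    refine h4.trans ((mul_le_mul_of_nonneg_left h5 hB0).trans (le_of_eq (by ring)))
  exact le_of_mul_le_mul_left h6 (by positivity)

theorem sum_vHat_le {v : UnitAddTorus (Fin d) → ℝ} {B : ℝ} (hv : IsPotential v B)
    (Λ : Finset (Fin d → ℤ)) : ∑ p ∈ Λ, vHat v p ≤ B * 2 ^ d := by
  obtain ⟨n, hn⟩ := exists_subset_cube Λ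
  exact (sum_le_sum_of_subset_of_nonneg hn fun p _ _ => hv.type p).trans (sum_vHat_cube_le hv n)

theorem summable_vHat {v : UnitAddTorus (Fin d) → ℝ} {B : ℝ} (hv : IsPotential v B) :
    Summable (vHat v) :=
  summable_of_sum_le hv.type (sum_vHat_le hv)

end Summability
end BoseGas

namespace BoseGas
open Finset Function MeasureTheory Filter

set_option linter.unusedSectionVars false

/-! ### Minimal Bogoliubov energies and the critical speed. -/

section BogoliubovSpectrum

variable {d : ℕ}

theorem momentum_nsmul (j : ℕ) (p : Fin d → ℤ) : momentum (j • p) = (j : ℝ) • momentum p := by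
  ext a
  simp [momentum]
  ring

theorem momentum_finset_sum {α : Type} (A : Finset α) (f : α → (Fin d → ℤ)) :
    momentum (∑ i ∈ A, f i) = ∑ i ∈ A, momentum (f i) := by
  classical
  induction A using Finset.induction_on with
  | empty => simp [momentum_zero]
  | insert a s ha ih => rw [sum_insert ha, sum_insert ha, momentum_add, ih]

theorem sum_mem_bogoliubovEnergies (v : UnitAddTorus (Fin d) → ℝ) {A : Finset (Fin d → ℤ)}
    (hA : 0 ∉ A) (n : (Fin d → ℤ) → ℕ) :
    ∑ p ∈ A, excitationEnergy v p * n p ∈ bogoliubovEnergies v (momentum (∑ p ∈ A, n p • p)) := by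
  have h0 : ∀ p : A, (p : Fin d → ℤ) ≠ 0 := fun p h => hA (h ▸ p.2)
  refine ⟨∑ p ∈ A.attach, Finsupp.single ⟨p.1, h0 p⟩ (n p), ?_, ?_⟩
  · rw [← Finsupp.sum_finsetSum_index (by simp) (by intros; push_cast; rw [add_smul])]
    simp_rw [Finsupp.sum_single_index (h := fun (k : {k : Fin d → ℤ // k ≠ 0}) (j : ℕ) =>
      (j : ℝ) • momentum k.1) (by simp)]
    rw [sum_attach A (fun p => (n p : ℝ) • momentum p), momentum_finset_sum]
    exact sum_congr rfl fun p _ => (momentum_nsmul _ _).symm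
  · rw [← Finsupp.sum_finsetSum_index (by simp) (by intros; push_cast; rw [mul_add])]
    simp_rw [Finsupp.sum_single_index (h := fun (k : {k : Fin d → ℤ // k ≠ 0}) (j : ℕ) =>
      excitationEnergy v k.1 * (j : ℝ)) (by simp)]
    rw [sum_attach A (fun p => excitationEnergy v p * (n p : ℝ))]

theorem exists_of_mem_bogoliubovEnergies {v : UnitAddTorus (Fin d) → ℝ} {P : Fin d → ℤ} {E : ℝ}
    (h : E ∈ bogoliubovEnergies v (momentum P)) :
    ∃ (A : Finset (Fin d → ℤ)) (n : (Fin d → ℤ) → ℕ), 0 ∉ A ∧ (∀ p, p ∉ A → n p = 0) ∧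
      ∑ p ∈ A, n p • p = P ∧ E = ∑ p ∈ A, excitationEnergy v p * n p := by
  obtain ⟨n, hP, rfl⟩ := h
  obtain ⟨n', hn, hn0⟩ : ∃ n' : (Fin d → ℤ) → ℕ, (∀ p : {k : Fin d → ℤ // k ≠ 0}, n' p.1 = n p) ∧
      ∀ p, p ∉ n.support.map (Embedding.subtype _) → n' p = 0 := by
    refine ⟨fun p => if h : p ≠ 0 then n ⟨p, h⟩ else 0, fun p => dif_pos p.2, fun p hp => ?_⟩
    by_cases h : p ≠ 0
    · refine (dif_pos h).trans ?_
      by_contra hc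
      exact hp (mem_map.2 ⟨⟨p, h⟩, Finsupp.mem_support_iff.2 hc, rfl⟩)
    · exact dif_neg h
  refine ⟨n.support.map (Embedding.subtype _), n', by simp, hn0, ?_, ?_⟩
  · refine momentum_injective ?_
    rw [← hP, momentum_finset_sum, sum_map, Finsupp.sum]
    refine sum_congr rfl fun p _ => ?_
    rw [momentum_nsmul]
    exact congrArg (fun j : ℕ => (j : ℝ) • momentum p.1) (hn p)
  · rw [sum_map, Finsupp.sum]
    exact sum_congr rfl fun p _ =>
      congrArg (fun j : ℕ => excitationEnergy v p.1 * (j : ℝ)) (hn p).symm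

theorem abs_le_norm_momentum (p : Fin d → ℤ) (a : Fin d) : |(p a : ℝ)| ≤ ‖momentum p‖ := by
  have h := PiLp.norm_apply_le (momentum p) a
  refine le_trans ?_ h
  simp only [momentum, Real.norm_eq_abs, abs_mul, abs_of_pos Real.pi_pos, abs_two]
  nlinarith [Real.pi_gt_three, abs_nonneg (p a : ℝ)]

theorem norm_momentum_le (p : Fin d → ℤ) : ‖momentum p‖ ≤ 2 * Real.pi * ∑ a, |(p a : ℝ)| := by
  have h0 : 0 ≤ 2 * Real.pi * ∑ a, |(p a : ℝ)| :=
    mul_nonneg (by positivity) (sum_nonneg fun a _ => abs_nonneg _)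
  rw [← sq_le_sq₀ (norm_nonneg _) h0, EuclideanSpace.norm_sq_eq, mul_pow]
  calc _ = (2 * Real.pi) ^ 2 * ∑ a, |(p a : ℝ)| ^ 2 := by
        rw [mul_sum]
        refine sum_congr rfl fun a _ => ?_
        simp only [momentum, Real.norm_eq_abs, sq_abs]
        ring
    _ ≤ _ := mul_le_mul_of_nonneg_left (sum_sq_le_sq_sum_of_nonneg fun a _ => abs_nonneg _)
        (by positivity)

theorem mem_cube_of_norm_le {p : Fin d → ℤ} {A : ℝ} (h : ‖momentum p‖ ≤ A) :
    p ∈ cube d ⌈A⌉₊ := by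
  rw [mem_cube]
  intro a
  have h1 := (abs_le_norm_momentum p a).trans (h.trans (Nat.le_ceil A))
  have h2 : |p a| ≤ (⌈A⌉₊ : ℤ) := by exact_mod_cast h1
  exact abs_le.1 h2

theorem norm_momentum_eq_sqrt (p : Fin d → ℤ) : ‖momentum p‖ = √(momentumSq p) := by
  rw [momentumSq, Real.sqrt_sq (norm_nonneg _)]

theorem one_le_norm_momentum {p : Fin d → ℤ} (hp : p ≠ 0) : 1 ≤ ‖momentum p‖ := by
  rw [norm_momentum_eq_sqrt]
  exact Real.one_le_sqrt.2 (one_le_momentumSq hp)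

theorem excitationEnergy_nonneg (v : UnitAddTorus (Fin d) → ℝ) (p : Fin d → ℤ) :
    0 ≤ excitationEnergy v p := Real.sqrt_nonneg _

theorem excitationEnergy_eq (v : UnitAddTorus (Fin d) → ℝ) (p : Fin d → ℤ) :
    excitationEnergy v p = ‖momentum p‖ * √(2 * vHat v p + ‖momentum p‖ ^ 2) := by
  rw [excitationEnergy, ← Real.sqrt_sq (norm_nonneg (momentum p)), ← Real.sqrt_mul (sq_nonneg _),
    Real.sqrt_sq (norm_nonneg (momentum p))]
  congr 1
  ring

theorem excitationEnergy_neg {v : UnitAddTorus (Fin d) → ℝ} (heven : ∀ x, v (-x) = v x)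
    (p : Fin d → ℤ) : excitationEnergy v (-p) = excitationEnergy v p := by
  rw [excitationEnergy, excitationEnergy, momentum_neg, norm_neg, vHat_neg heven]

theorem norm_le_excitationEnergy {v : UnitAddTorus (Fin d) → ℝ} {B : ℝ} (hv : IsPotential v B)
    (p : Fin d → ℤ) : ‖momentum p‖ ≤ excitationEnergy v p := by
  by_cases hp : p = 0
  · rw [hp, momentum_zero, norm_zero]
    exact excitationEnergy_nonneg v 0
  · rw [excitationEnergy_eq]
    refine le_mul_of_one_le_right (norm_nonneg _) (Real.one_le_sqrt.2 ?_)
    have := hv.type p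
    have h1 := one_le_momentumSq hp
    rw [momentumSq] at h1
    linarith

/-- Since e_p ≥ |p| and e_p ≥ 1 for p ≠ 0, a bound on the energy bounds both the occupied momenta
and the occupation numbers. -/
theorem bogoliubovEnergies_sublevel_finite {v : UnitAddTorus (Fin d) → ℝ} {B : ℝ}
    (hv : IsPotential v B) (P : EuclideanSpace ℝ (Fin d)) (E : ℝ) :
    (bogoliubovEnergies v P ∩ Set.Iic E).Finite := by
  classical
  let s : Finset {k : Fin d → ℤ // k ≠ 0} := (cube d ⌈E⌉₊).subtype _
  let T : Finset ({k : Fin d → ℤ // k ≠ 0} →₀ ℕ) := s.finsupp fun _ => range (⌈E⌉₊ + 1)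
  refine ((T.finite_toSet).image fun n => n.sum fun k j => excitationEnergy v k.1 * (j : ℝ)).subset ?_
  rintro e ⟨⟨n, -, rfl⟩, hle⟩
  refine ⟨n, ?_, rfl⟩
  rw [Set.mem_Iic] at hle
  have h1 : ∀ k ∈ n.support, excitationEnergy v k.1 * (n k : ℝ) ≤ E := fun k hk =>
    (single_le_sum (f := fun k => excitationEnergy v k.1 * (n k : ℝ)) (fun k _ =>
      mul_nonneg (excitationEnergy_nonneg v _) (Nat.cast_nonneg _)) hk).trans hle
  have h2 : ∀ k ∈ n.support, (1 : ℝ) ≤ n k := fun k hk => by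
    exact_mod_cast Nat.one_le_iff_ne_zero.2 (Finsupp.mem_support_iff.1 hk)
  have h3 : ∀ k : {k : Fin d → ℤ // k ≠ 0}, 1 ≤ excitationEnergy v k.1 := fun k =>
    (one_le_norm_momentum k.2).trans (norm_le_excitationEnergy hv _)
  rw [mem_coe, mem_finsupp_iff]
  refine ⟨fun k hk => ?_, fun k _ => ?_⟩
  · rw [mem_subtype]
    refine mem_cube_of_norm_le ((norm_le_excitationEnergy hv _).trans ?_)
    nlinarith [h1 k hk, h2 k hk, h3 k]
  · rw [mem_range, Nat.lt_succ_iff]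
    by_cases hk : k ∈ n.support
    · have : (n k : ℝ) ≤ E := by nlinarith [h1 k hk, h2 k hk, h3 k]
      exact_mod_cast this.trans (Nat.le_ceil E)
    · rw [Finsupp.notMem_support_iff.1 hk]
      exact Nat.zero_le _

theorem exists_isLeast_of_sublevel_finite {X : Set ℝ} (hne : X.Nonempty)
    (hfin : ∀ E, (X ∩ Set.Iic E).Finite) : ∃ m, IsLeast X m := by
  obtain ⟨E, hE⟩ := hne
  obtain ⟨m, hm, hmin⟩ := Set.exists_min_image _ id (hfin E) ⟨E, hE, le_refl E⟩
  refine ⟨m, hm.1, fun e he => ?_⟩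
  rcases le_total e E with h | h
  · exact hmin e ⟨he, h⟩
  · exact le_trans hm.2 h

theorem excitationEnergy_le {v : UnitAddTorus (Fin d) → ℝ} {B : ℝ} (hv : IsPotential v B)
    (p : Fin d → ℤ) : excitationEnergy v p ≤ momentumSq p + vHat v p := by
  rw [← dispersion_eq]
  exact dispersion_le (momentumSq_nonneg p) (hv.type p)

/-- Build P from |P_a| shortest lattice momenta in each coordinate direction; every quantum has
bounded energy. -/
theorem exists_bogoliubovEnergy_le {v : UnitAddTorus (Fin d) → ℝ} {B : ℝ}
    (hv : IsPotential v B) (P : Fin d → ℤ) :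
    ∃ E ∈ bogoliubovEnergies v (momentum P),
      E ≤ d * ((2 * Real.pi) ^ 2 + B * 2 ^ d) * ‖momentum P‖ := by
  -- Directions with P a = 0 give the zero vector, which may occur several times and is erased from
  -- `A`.
  let e : Fin d → (Fin d → ℤ) := fun a => Pi.single a (P a).sign
  let A : Finset (Fin d → ℤ) := (univ.image e).erase 0
  let n : (Fin d → ℤ) → ℕ := fun p => ∑ a with e a = p, (P a).natAbs
  have hA : (0 : Fin d → ℤ) ∉ A := by simp [A]
  have hzero : ∀ a, e a = 0 → P a = 0 := by
    intro a h
    have := congrFun h a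
    simpa [e] using this
  have hn : ∀ {M : Type} [AddCommMonoid M] (F : (Fin d → ℤ) → ℕ → M)
      (_ : ∀ p, F p 0 = 0) (_ : ∀ p i j, F p (i + j) = F p i + F p j),
      ∑ p ∈ A, F p (n p) = ∑ a, F (e a) (P a).natAbs := by
    intro M _ F hF0 hF
    have h1 : ∀ p, F p (n p) = ∑ a with e a = p, F (e a) (P a).natAbs := by
      intro p
      have : F p (n p) = ∑ a with e a = p, F p (P a).natAbs :=
        map_sum ({ toFun := F p, map_zero' := hF0 p, map_add' := hF p } : ℕ →+ M) _ _
      rw [this]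
      refine sum_congr rfl fun a ha => ?_
      rw [(mem_filter.1 ha).2]
    simp_rw [h1]
    rw [sum_erase, sum_fiberwise_of_maps_to (fun a _ => mem_image_of_mem e (mem_univ a))]
    refine sum_eq_zero fun a ha => ?_
    rw [hzero a (mem_filter.1 ha).2, Int.natAbs_zero, hF0]
  have hmem := sum_mem_bogoliubovEnergies v hA n
  rw [hn (fun p j => j • p) (fun p => zero_smul _ _) (fun p i j => add_smul _ _ _),
    hn (fun p j => excitationEnergy v p * (j : ℝ)) (by simp) (by intros; push_cast; ring)] at hmem
  have hP : ∑ a, (P a).natAbs • e a = P := by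
    funext b
    rw [Finset.sum_apply, sum_eq_single b]
    · simp only [e, Pi.smul_apply, Pi.single_eq_same, nsmul_eq_mul]
      rw [mul_comm]
      exact Int.sign_mul_natAbs (P b)
    · intro a _ ha
      simp [e, Pi.single_eq_of_ne ha.symm]
    · simp
  rw [hP] at hmem
  refine ⟨_, hmem, ?_⟩
  have hB0 : 0 ≤ B := (hv.nonneg 0).trans (hv.bound 0)
  have h1 : ∀ a ∈ (univ : Finset (Fin d)), excitationEnergy v (e a) * ((P a).natAbs : ℝ) ≤
      ((2 * Real.pi) ^ 2 + B * 2 ^ d) * ‖momentum P‖ := by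
    intro a _
    have h2 : ((P a).natAbs : ℝ) ≤ ‖momentum P‖ := by
      refine le_trans (le_of_eq ?_) (abs_le_norm_momentum P a)
      rw [Nat.cast_natAbs, Int.cast_abs]
    have h3 : excitationEnergy v (e a) ≤ (2 * Real.pi) ^ 2 + B * 2 ^ d := by
      refine (excitationEnergy_le hv _).trans (add_le_add ?_ ?_)
      · rw [momentumSq]
        refine pow_le_pow_left₀ (norm_nonneg _) ((norm_momentum_le _).trans ?_) 2
        refine mul_le_of_le_one_right (by positivity) ?_
        rw [sum_eq_single a]
        · simp only [e, Pi.single_eq_same]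
          rcases Int.sign_trichotomy (P a) with h | h | h <;> simp [h]
        · intro b _ hb
          simp [e, Pi.single_eq_of_ne hb]
        · simp
      · simpa using sum_vHat_le hv {e a}
    exact mul_le_mul h3 h2 (Nat.cast_nonneg _) (by positivity)
  refine (sum_le_sum h1).trans (le_of_eq ?_)
  simp
  ring

theorem exists_isLeast_bogoliubovEnergies {v : UnitAddTorus (Fin d) → ℝ} {B : ℝ}
    (hv : IsPotential v B) (P : Fin d → ℤ) :
    ∃ m, IsLeast (bogoliubovEnergies v (momentum P)) m := by
  obtain ⟨E, hE, -⟩ := exists_bogoliubovEnergy_le hv P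
  exact exists_isLeast_of_sublevel_finite ⟨E, hE⟩ (bogoliubovEnergies_sublevel_finite hv _)

theorem exists_isLeast_criticalSpeeds (hd : 1 ≤ d) {v : UnitAddTorus (Fin d) → ℝ} {B : ℝ}
    (hv : IsPotential v B) : ∃ s, IsLeast (criticalSpeeds v) s := by
  refine exists_isLeast_of_sublevel_finite ?_ fun E => ?_
  · refine ⟨_, fun _ => 1, ?_, rfl⟩
    intro h
    have := congrFun h ⟨0, hd⟩
    simp at this
  · refine (((cube d ⌈E⌉₊).finite_toSet).image
      fun k => √(2 * vHat v k + ‖momentum k‖ ^ 2)).subset ?_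
    rintro e ⟨⟨k, -, rfl⟩, hle⟩
    refine ⟨k, mem_cube_of_norm_le (le_trans ?_ hle), rfl⟩
    exact Real.le_sqrt_of_sq_le (by linarith [hv.type k])

theorem one_le_criticalSpeed {v : UnitAddTorus (Fin d) → ℝ} {B : ℝ} (hv : IsPotential v B)
    {s : ℝ} (hs : s ∈ criticalSpeeds v) : 1 ≤ s := by
  obtain ⟨k, hk, rfl⟩ := hs
  have h1 := one_le_momentumSq hk
  rw [momentumSq] at h1
  exact Real.one_le_sqrt.2 (by linarith [hv.type k])

/-- Triangle inequality for P = ∑ n_p p, combined with e_p = |p| √(2 v̂(p) + |p|²) ≥ s |p|. -/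
theorem criticalSpeed_mul_le {v : UnitAddTorus (Fin d) → ℝ} {B : ℝ} (hv : IsPotential v B)
    {s : ℝ} (hs : IsLeast (criticalSpeeds v) s) {P : Fin d → ℤ} {E : ℝ}
    (hE : E ∈ bogoliubovEnergies v (momentum P)) : ‖momentum P‖ * s ≤ E := by
  have hs0 : 0 ≤ s := zero_le_one.trans (one_le_criticalSpeed hv hs.1)
  obtain ⟨A, n, hA, -, rfl, rfl⟩ := exists_of_mem_bogoliubovEnergies hE
  rw [momentum_finset_sum]
  calc _ ≤ (∑ p ∈ A, ‖momentum (n p • p)‖) * s :=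
        mul_le_mul_of_nonneg_right (norm_sum_le _ _) hs0
    _ ≤ _ := by
        rw [sum_mul]
        refine sum_le_sum fun p hp => ?_
        rw [momentum_nsmul, norm_smul, Real.norm_natCast, excitationEnergy_eq]
        have h1 := hs.2 ⟨p, fun h => hA (h ▸ hp), rfl⟩
        calc _ = (‖momentum p‖ * s) * (n p : ℝ) := by ring
          _ ≤ _ := mul_le_mul_of_nonneg_right (mul_le_mul_of_nonneg_left h1 (norm_nonneg _))
            (Nat.cast_nonneg _)

end BogoliubovSpectrum
end BoseGas

namespace BoseGas
open Finset Function MeasureTheory Filter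

set_option linter.unusedSectionVars false

/-! ### Imbalances as quasi-particle numbers. -/

section Imbalance

variable {N d : ℕ}

theorem ne_neg_of_ne_zero {p : Fin d → ℤ} (hp : p ≠ 0) : p ≠ -p := by
  intro h
  refine hp (funext fun a => ?_)
  have := congrFun h a
  simp only [Pi.neg_apply] at this
  simp only [Pi.zero_apply]
  omega

theorem sum_erase_zero_neg {M : Type} [AddCommMonoid M] {Λ : Finset (Fin d → ℤ)}
    (hneg : ∀ p ∈ Λ, -p ∈ Λ) (f : (Fin d → ℤ) → M) :
    ∑ p ∈ Λ.erase 0, f (-p) = ∑ p ∈ Λ.erase 0, f p := by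
  have h : ∀ p ∈ Λ.erase 0, -p ∈ Λ.erase 0 := fun p hp =>
    mem_erase.2 ⟨neg_ne_zero.2 (ne_of_mem_erase hp), hneg p (mem_of_mem_erase hp)⟩
  exact sum_nbij' (fun p => -p) (fun p => -p) h h (fun _ _ => neg_neg _) (fun _ _ => neg_neg _)
    fun _ _ => rfl

theorem sum_imbalance_smul {Λ : Finset (Fin d → ℤ)} (hneg : ∀ p ∈ Λ, -p ∈ Λ)
    (n : (Fin d → ℤ) → ℕ) :
    ∑ p ∈ Λ.erase 0, ((n p : ℤ) - n (-p)) • p = 2 • ∑ p ∈ Λ.erase 0, n p • p := by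
  simp_rw [sub_smul, sum_sub_distrib, natCast_zsmul]
  have := sum_erase_zero_neg hneg fun p => n (-p) • p
  simp only [neg_neg, smul_neg, sum_neg_distrib] at this
  rw [← this, sub_neg_eq_add, two_smul]

/-- The positive parts at `p` and `-p` differ by D_p. Doubling avoids a choice of one mode from each
pair ±p; the factor two is cancelled by `two_nsmul_injective`. -/
theorem sum_toNat_smul {Λ : Finset (Fin d → ℤ)} (hneg : ∀ p ∈ Λ, -p ∈ Λ) {D : (Fin d → ℤ) → ℤ}
    (hD : ∀ p, D (-p) = -D p) :
    2 • ∑ p ∈ Λ.erase 0, (D p).toNat • p = ∑ p ∈ Λ.erase 0, D p • p := by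
  rw [← sum_imbalance_smul hneg]
  refine sum_congr rfl fun p _ => ?_
  rw [hD, Int.toNat_sub_toNat_neg]

theorem sum_mul_abs {Λ : Finset (Fin d → ℤ)} (hneg : ∀ p ∈ Λ, -p ∈ Λ) {D : (Fin d → ℤ) → ℤ}
    (hD : ∀ p, D (-p) = -D p) {e : (Fin d → ℤ) → ℝ} (he : ∀ p, e (-p) = e p) :
    1 / 2 * ∑ p ∈ Λ.erase 0, e p * |(D p : ℝ)| = ∑ p ∈ Λ.erase 0, e p * ((D p).toNat : ℝ) := by
  have h1 := sum_erase_zero_neg hneg fun p => e p * ((D p).toNat : ℝ)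
  have h2 : ∑ p ∈ Λ.erase 0, e p * |(D p : ℝ)| = ∑ p ∈ Λ.erase 0, e p * ((D p).toNat : ℝ) +
      ∑ p ∈ Λ.erase 0, e (-p) * ((D (-p)).toNat : ℝ) := by
    rw [← sum_add_distrib]
    refine sum_congr rfl fun p _ => ?_
    rw [he, hD, ← mul_add]
    congr 1
    have : |D p| = ((D p).toNat : ℤ) + ((-D p).toNat : ℤ) := by
      rcases abs_cases (D p) with h | h <;> omega
    exact_mod_cast congrArg (Int.cast : ℤ → ℝ) this
  rw [h2, h1]
  ring

theorem sum_eq_sum_occ_smul {Λ : Finset (Fin d → ℤ)} {k : Fin N → (Fin d → ℤ)}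
    (hk : k ∈ box N Λ) : ∑ i, k i = ∑ p ∈ Λ.erase 0, occ k p • p := by
  rw [sum_erase Λ (f := fun p => occ k p • p) (a := 0) (smul_zero _),
    ← sum_fiberwise_of_maps_to (s := univ) (t := Λ) (g := k) fun i _ => mem_box.1 hk i]
  refine sum_congr rfl fun p _ => ?_
  rw [sum_congr rfl (g := fun _ => p) (by intro i hi; rw [(mem_filter.1 hi).2]), sum_const, occ]

theorem two_nsmul_injective {p q : Fin d → ℤ} (h : 2 • p = 2 • q) : p = q := by
  funext a
  have := congrFun h a
  simp only [Pi.smul_apply, nsmul_eq_mul] at this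
  push_cast at this
  omega

/-- The excitation energy of the particle number imbalance of a configuration is at least the
minimal excitation energy at its total momentum. -/
theorem le_imbalance_energy {v : UnitAddTorus (Fin d) → ℝ} {B : ℝ} (hv : IsPotential v B)
    {Λ : Finset (Fin d → ℤ)} (hneg : ∀ p ∈ Λ, -p ∈ Λ) {k : Fin N → (Fin d → ℤ)}
    (hk : k ∈ box N Λ) {m : ℝ} (hm : m ∈ lowerBounds (bogoliubovEnergies v (momentum (∑ i, k i)))) :
    m ≤ 1 / 2 * ∑ p ∈ Λ.erase 0,
      dispersion momentumSq (vHat v) p * |(occ k p : ℝ) - occ k (-p)| := by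
  have hD : ∀ p, (occ k (-p) : ℤ) - occ k (- -p) = -((occ k p : ℤ) - occ k (-p)) := by
    intro p; rw [neg_neg]; ring
  have h1 := sum_mul_abs hneg (D := fun p => (occ k p : ℤ) - occ k (-p)) hD
    (e := excitationEnergy v) (excitationEnergy_neg hv.even)
  have h2 := sum_toNat_smul hneg (D := fun p => (occ k p : ℤ) - occ k (-p)) hD
  rw [sum_imbalance_smul hneg, ← sum_eq_sum_occ_smul hk] at h2
  -- Cancelling n_p against n_{-p} does not change the total momentum, so the positive parts of the
  -- imbalances compete in the minimum defining m(P).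
  have h3 := sum_mem_bogoliubovEnergies v (A := Λ.erase 0) (by simp)
    (fun p => ((occ k p : ℤ) - occ k (-p)).toNat)
  rw [two_nsmul_injective h2, ← h1] at h3
  refine (hm h3).trans (le_of_eq ?_)
  congr 1
  refine sum_congr rfl fun p _ => ?_
  rw [dispersion_eq]
  push_cast
  rfl

theorem sum_eq_of_hasImbalance {Λ : Finset (Fin d → ℤ)} (hneg : ∀ p ∈ Λ, -p ∈ Λ)
    {n : (Fin d → ℤ) → ℕ} {k : Fin N → (Fin d → ℤ)}
    (hk : HasImbalance Λ (fun p => (n p : ℤ) - n (-p)) k) :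
    ∑ i, k i = ∑ p ∈ Λ.erase 0, n p • p := by
  refine two_nsmul_injective ?_
  rw [sum_eq_sum_occ_smul hk.1, ← sum_imbalance_smul hneg, ← sum_imbalance_smul hneg]
  exact sum_congr rfl fun p hp => by rw [hk.2 p hp]

/-- From |n_p - n_{-p}| ≤ n_p + n_{-p}: cancelling opposite quasi-particles only lowers the energy.
-/
theorem half_sum_abs_le {Λ : Finset (Fin d → ℤ)} (hneg : ∀ p ∈ Λ, -p ∈ Λ)
    (n : (Fin d → ℤ) → ℕ) {e : (Fin d → ℤ) → ℝ} (he : ∀ p, e (-p) = e p) (he0 : ∀ p, 0 ≤ e p) :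
    1 / 2 * ∑ p ∈ Λ.erase 0, e p * |(((n p : ℤ) - n (-p) : ℤ) : ℝ)| ≤
      ∑ p ∈ Λ.erase 0, e p * (n p : ℝ) := by
  have h1 := sum_erase_zero_neg hneg fun p => e p * (n p : ℝ)
  have h2 : ∑ p ∈ Λ.erase 0, e p * |(((n p : ℤ) - n (-p) : ℤ) : ℝ)| ≤
      ∑ p ∈ Λ.erase 0, (e p * (n p : ℝ) + e (-p) * (n (-p) : ℝ)) := by
    refine sum_le_sum fun p _ => ?_
    rw [he, ← mul_add]
    refine mul_le_mul_of_nonneg_left ?_ (he0 p)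
    push_cast
    rw [abs_le]
    constructor <;> linarith [(Nat.cast_nonneg (n p) : (0 : ℝ) ≤ n p),
      (Nat.cast_nonneg (n (-p)) : (0 : ℝ) ≤ n (-p))]
  rw [sum_add_distrib, h1] at h2
  linarith

end Imbalance

/-! ### Upper bound on the sector energies. -/

section Upper

variable {N d : ℕ}

/-- The terms of the ground state energy shift of the quadratic Hamiltonian. -/
noncomputable def shiftTerm (v : UnitAddTorus (Fin d) → ℝ) (p : Fin d → ℤ) : ℝ :=
  if p = 0 then 0 else momentumSq p + vHat v p - excitationEnergy v p

/-- The ground state energy shift of the quadratic Hamiltonian, up to the sign. -/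
noncomputable def shift (v : UnitAddTorus (Fin d) → ℝ) : ℝ := 1 / 2 * ∑' p, shiftTerm v p

theorem shiftTerm_nonneg {v : UnitAddTorus (Fin d) → ℝ} {B : ℝ} (hv : IsPotential v B)
    (p : Fin d → ℤ) : 0 ≤ shiftTerm v p := by
  rw [shiftTerm]
  split_ifs
  · exact le_rfl
  · linarith [excitationEnergy_le hv p]

theorem momentumSq_le_excitationEnergy {v : UnitAddTorus (Fin d) → ℝ} {B : ℝ}
    (hv : IsPotential v B) (p : Fin d → ℤ) : momentumSq p ≤ excitationEnergy v p := by
  refine Real.le_sqrt_of_sq_le ?_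
  have := hv.type p
  have := mul_nonneg (sq_nonneg ‖momentum p‖) this
  rw [momentumSq]
  nlinarith

theorem shiftTerm_le {v : UnitAddTorus (Fin d) → ℝ} {B : ℝ} (hv : IsPotential v B)
    (p : Fin d → ℤ) : shiftTerm v p ≤ vHat v p := by
  rw [shiftTerm]
  split_ifs
  · exact hv.type p
  · linarith [momentumSq_le_excitationEnergy hv p]

theorem summable_shiftTerm {v : UnitAddTorus (Fin d) → ℝ} {B : ℝ} (hv : IsPotential v B) :
    Summable (shiftTerm v) :=
  (summable_vHat hv).of_nonneg_of_le (shiftTerm_nonneg hv) (shiftTerm_le hv)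

theorem shift_nonneg {v : UnitAddTorus (Fin d) → ℝ} {B : ℝ} (hv : IsPotential v B) :
    0 ≤ shift v :=
  mul_nonneg (by norm_num) (tsum_nonneg (shiftTerm_nonneg hv))

theorem sum_erase_shift (v : UnitAddTorus (Fin d) → ℝ) (Λ : Finset (Fin d → ℤ)) :
    ∑ p ∈ Λ.erase 0, (momentumSq p + vHat v p - dispersion momentumSq (vHat v) p) =
      ∑ p ∈ Λ, shiftTerm v p := by
  rw [← sum_erase Λ (f := shiftTerm v) (a := 0) (if_pos rfl)]
  refine sum_congr rfl fun p hp => ?_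
  rw [shiftTerm, if_neg (ne_of_mem_erase hp), dispersion_eq]

theorem tendsto_sum_cube {f : (Fin d → ℤ) → ℝ} (hf : Summable f) :
    Tendsto (fun n => ∑ p ∈ cube d n, f p) atTop (nhds (∑' p, f p)) :=
  hf.hasSum.comp (tendsto_atTop_finset_of_monotone (cube_mono d) exists_mem_cube)

theorem erase_zero_subset_differences {Λ : Finset (Fin d → ℤ)} (h0 : 0 ∈ Λ) :
    Λ.erase 0 ⊆ differences Λ := by
  intro p hp
  refine mem_erase.2 ⟨ne_of_mem_erase hp, mem_image.2 ⟨(p, 0), ?_, sub_zero p⟩⟩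
  exact mem_product.2 ⟨mem_of_mem_erase hp, h0⟩

theorem zero_notMem_differences (Λ : Finset (Fin d → ℤ)) : 0 ∉ differences Λ := by
  simp [differences]

theorem one_le_excitationEnergy {v : UnitAddTorus (Fin d) → ℝ} {B : ℝ}
    (hv : IsPotential v B) {p : Fin d → ℤ} (hp : p ≠ 0) : 1 ≤ excitationEnergy v p :=
  (one_le_momentumSq hp).trans (momentumSq_le_excitationEnergy hv p)

theorem nonneg_of_mem_bogoliubovEnergies {v : UnitAddTorus (Fin d) → ℝ} {P : Fin d → ℤ} {m : ℝ}
    (hm : m ∈ bogoliubovEnergies v (momentum P)) : 0 ≤ m := by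
  obtain ⟨A, n, -, -, -, rfl⟩ := exists_of_mem_bogoliubovEnergies hm
  exact sum_nonneg fun p _ => mul_nonneg (excitationEnergy_nonneg v p) (Nat.cast_nonneg _)

/-- The upper bound on the energy of a momentum sector from the trial state. -/
theorem sectorEnergy_le {v : UnitAddTorus (Fin d) → ℝ} {B : ℝ} (hv : IsPotential v B)
    (hN : 2 ≤ N) {P : Fin d → ℤ} {m : ℝ} (hm : m ∈ bogoliubovEnergies v (momentum P))
    (hmN : m ≤ N) {U : ℝ} (hU : ∀ Λ : Finset (Fin d → ℤ), ∑ p ∈ Λ, vHat v p ≤ U) :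
    sectorEnergy v N (momentum P) ≤ N / 2 * vHat v 0 - shift v + m +
      6 * U * (2 + 4 * U * (U + 1)) * (m + 1) ^ 2 / N := by
  have hm0 := nonneg_of_mem_bogoliubovEnergies hm
  have hU0 : 0 ≤ U := by simpa using hU ∅
  obtain ⟨A, n, hA, hnA, hP, hmE⟩ := exists_of_mem_bogoliubovEnergies hm
  have hmain : ∀ᶠ L in atTop, sectorEnergy v N (momentum P) ≤ N / 2 * vHat v 0
      - 1 / 2 * ∑ p ∈ cube d L, shiftTerm v p + m +
      6 * U * (2 + 4 * U * (U + 1)) * (m + 1) ^ 2 / N := by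
    obtain ⟨L₀, hL₀⟩ := exists_subset_cube A
    filter_upwards [eventually_ge_atTop L₀] with L hL
    set Λ := cube d L
    have hAΛ : A ⊆ Λ.erase 0 := fun p hp =>
      mem_erase.2 ⟨fun h => hA (h ▸ hp), cube_mono d hL (hL₀ hp)⟩
    have h0 : (0 : Fin d → ℤ) ∈ Λ := zero_mem_cube d L
    have hneg : ∀ p ∈ Λ, -p ∈ Λ := fun p hp => neg_mem_cube hp
    have hsum : ∀ {M : Type} [AddCommMonoid M] (F : (Fin d → ℤ) → ℕ → M) (_ : ∀ p, F p 0 = 0),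
        ∑ p ∈ Λ.erase 0, F p (n p) = ∑ p ∈ A, F p (n p) := fun F hF =>
      (sum_subset hAΛ fun p _ hp => by rw [hnA p hp, hF]).symm
    set D : (Fin d → ℤ) → ℤ := fun p => (n p : ℤ) - n (-p) with hDdef
    have hD : ∀ p, D (-p) = -D p := fun p => by simp only [hDdef, neg_neg]; ring
    have hDm : 1 / 2 * ∑ p ∈ Λ.erase 0, dispersion momentumSq (vHat v) p * |(D p : ℝ)| ≤ m := by
      simp_rw [dispersion_eq]
      refine (half_sum_abs_le hneg n (excitationEnergy_neg hv.even)
        (excitationEnergy_nonneg v)).trans (le_of_eq ?_)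
      rw [hmE, hsum (fun p j => excitationEnergy v p * (j : ℝ)) (by simp)]
    -- Each quasi-particle costs at least 1. With m ≤ N there are thus enough particles for the
    -- trial state to be nonzero.
    have hDn : 1 / 2 * ∑ p ∈ Λ.erase 0, |(D p : ℝ)| ≤ m := by
      refine le_trans (mul_le_mul_of_nonneg_left (sum_le_sum fun p hp => ?_) (by norm_num)) hDm
      rw [dispersion_eq]
      exact le_mul_of_one_le_left (abs_nonneg _) (one_le_excitationEnergy hv (ne_of_mem_erase hp))
    have hα : ∀ p, 0 ≤ bogCoeff momentumSq (vHat v) p := fun p =>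
      bogCoeff_nonneg (momentumSq_nonneg p) (hv.type p)
    set f := trial (N := N) Λ (bogCoeff momentumSq (vHat v)) D
    have hpos : 0 < ev Λ (fun _ : Fin N → (Fin d → ℤ) => 1) f :=
      trial_norm_pos h0 hneg hα hD (hDn.trans hmN)
    have hf : Admissible Λ (fun k => ∑ i, k i = P) f := by
      refine ⟨isSymm_trial _ _ _, fun k hk => ?_, fun k hk => ?_⟩
      · by_contra hc
        exact hk (hasImbalance_of_trial_ne_zero hc).1
      · by_contra hc
        refine hk ((sum_eq_of_hasImbalance hneg (hasImbalance_of_trial_ne_zero hc)).trans ?_)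
        rw [hsum (fun p j => j • p) (fun p => zero_smul _ _), hP]
    have h1 := sInf_sectorEnergies_mul_le hv hN hf
    rw [← sectorEnergy_eq] at h1
    have h2 := trial_energy hN h0 hneg (erase_zero_subset_differences h0)
      (zero_notMem_differences Λ) (fun p hp => ne_neg_of_ne_zero hp) momentumSq_zero
      (fun p hp => one_le_momentumSq hp) momentumSq_neg hv.type (vHat_neg hv.even)
      (hU (differences Λ)) D
    rw [sum_erase_shift] at h2
    have h3 : sectorEnergy v N (momentum P) * ev Λ (fun _ => 1) f ≤
        (1 / 2 * ∑ p ∈ Λ.erase 0, dispersion momentumSq (vHat v) p * |(D p : ℝ)|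
        - 1 / 2 * ∑ p ∈ Λ, shiftTerm v p
        + 6 * U * (2 + 4 * U * (U + 1)) * (1 / 2 * ∑ p ∈ Λ.erase 0, |(D p : ℝ)| + 1) ^ 2 / N
        + N / 2 * vHat v 0) * ev Λ (fun _ : Fin N → (Fin d → ℤ) => 1) f := by
      rw [add_mul]
      refine h1.trans ?_
      rw [fullForm]
      exact add_le_add_left h2 _
    have h4 := le_of_mul_le_mul_right h3 hpos
    have h5 : 6 * U * (2 + 4 * U * (U + 1)) * (1 / 2 * ∑ p ∈ Λ.erase 0, |(D p : ℝ)| + 1) ^ 2 / N ≤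
        6 * U * (2 + 4 * U * (U + 1)) * (m + 1) ^ 2 / N := by
      refine div_le_div_of_nonneg_right (mul_le_mul_of_nonneg_left ?_ (by positivity))
        (Nat.cast_nonneg _)
      refine pow_le_pow_left₀ ?_ (by linarith) 2
      have : 0 ≤ ∑ p ∈ Λ.erase 0, |(D p : ℝ)| := sum_nonneg fun p _ => abs_nonneg _
      positivity
    linarith
  have hlim : Tendsto (fun L => N / 2 * vHat v 0
      - 1 / 2 * ∑ p ∈ cube d L, shiftTerm v p + m +
      6 * U * (2 + 4 * U * (U + 1)) * (m + 1) ^ 2 / N) atTop (nhds (N / 2 * vHat v 0 - shift v + m +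
      6 * U * (2 + 4 * U * (U + 1)) * (m + 1) ^ 2 / N)) :=
    ((((tendsto_sum_cube (summable_shiftTerm hv)).const_mul (1 / 2)).const_sub _).add_const
      m).add_const _
  exact ge_of_tendsto hlim hmain

end Upper
end BoseGas

namespace BoseGas
open Finset Function MeasureTheory Filter

set_option linter.unusedSectionVars false

/-! ### Crude states with evenly distributed momentum. -/

section CrudeState

variable {N d : ℕ}

theorem exists_balanced_nat (hN : 0 < N) (n : ℕ) :
    ∃ q : Fin N → ℕ, ∑ i, q i = n ∧ ∀ i, (q i : ℝ) ≤ n / N + 1 := by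
  refine ⟨fun i => n / N + if (i : ℕ) < n % N then 1 else 0, ?_, fun i => ?_⟩
  · rw [sum_add_distrib, sum_const, card_univ, Fintype.card_fin, smul_eq_mul, sum_boole]
    have h : #{i : Fin N | (i : ℕ) < n % N} = n % N := by
      rw [Fin.card_filter_val_lt]
      exact min_eq_right (Nat.mod_lt n hN).le
    rw [h]
    exact Nat.div_add_mod n N
  · push_cast
    refine add_le_add Nat.cast_div_le ?_
    split_ifs <;> simp

/-- All parts have the sign of `n` and modulus at most |n|/N + 1; the sum of squares is at most this
maximum times |n|. For |n| = O(N) it is therefore linear in |n|. -/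
theorem exists_balanced_int (hN : 0 < N) (n : ℤ) :
    ∃ q : Fin N → ℤ, ∑ i, q i = n ∧ ∑ i, (q i : ℝ) ^ 2 ≤ (|(n : ℝ)| / N + 1) * |(n : ℝ)| := by
  obtain ⟨q, hq, hle⟩ := exists_balanced_nat hN n.natAbs
  have hn : ((n.natAbs : ℕ) : ℝ) = |(n : ℝ)| := by rw [Nat.cast_natAbs, Int.cast_abs]
  rw [hn] at hle
  refine ⟨fun i => n.sign * q i, ?_, ?_⟩
  · rw [← mul_sum, ← Nat.cast_sum, hq, Int.sign_mul_natAbs]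
  · have h1 : ∀ i, ((n.sign * q i : ℤ) : ℝ) ^ 2 ≤ (|(n : ℝ)| / N + 1) * (q i : ℝ) := by
      intro i
      have h2 : ((n.sign : ℤ) : ℝ) ^ 2 ≤ 1 := by
        rcases Int.sign_trichotomy n with h | h | h <;> simp [h]
      push_cast
      rw [mul_pow]
      have h3 := hle i
      have h4 : (0 : ℝ) ≤ q i := Nat.cast_nonneg _
      calc _ ≤ 1 * (q i : ℝ) ^ 2 := mul_le_mul_of_nonneg_right h2 (sq_nonneg _)
        _ = q i * q i := by ring
        _ ≤ _ := mul_le_mul_of_nonneg_right h3 h4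
    refine (sum_le_sum fun i _ => h1 i).trans (le_of_eq ?_)
    rw [← mul_sum, ← Nat.cast_sum, hq, hn]

/-- A configuration of given total momentum in which the momentum is evenly distributed. -/
theorem exists_balanced_config (hN : 0 < N) (P : Fin d → ℤ) {K : ℝ}
    (hP : ‖momentum P‖ ≤ K * N) :
    ∃ k : Fin N → (Fin d → ℤ), ∑ i, k i = P ∧
      kin momentumSq k ≤ (2 * Real.pi) ^ 2 * d * (K + 1) * ‖momentum P‖ := by
  choose q hq hle using fun a => exists_balanced_int hN (P a)
  refine ⟨fun i a => q a i, ?_, ?_⟩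
  · funext a
    rw [Finset.sum_apply, hq]
  · have hN' : (0 : ℝ) < N := by exact_mod_cast hN
    have e : kin momentumSq (fun i a => q a i) =
        (2 * Real.pi) ^ 2 * ∑ a, ∑ i, (q a i : ℝ) ^ 2 := by
      rw [sum_comm, mul_sum, kin]
      refine sum_congr rfl fun i _ => ?_
      rw [momentumSq, EuclideanSpace.norm_sq_eq, mul_sum]
      refine sum_congr rfl fun a _ => ?_
      simp only [momentum, Real.norm_eq_abs, sq_abs]
      ring
    have h1 : ∀ a ∈ (univ : Finset (Fin d)), ∑ i, (q a i : ℝ) ^ 2 ≤ (K + 1) * ‖momentum P‖ := by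
      intro a _
      have h2 := abs_le_norm_momentum P a
      refine (hle a).trans (mul_le_mul ?_ h2 (abs_nonneg _) ?_)
      · have : |(P a : ℝ)| / N ≤ K := by
          rw [div_le_iff₀ hN']
          exact h2.trans hP
        linarith
      · have : 0 ≤ K := nonneg_of_mul_nonneg_left ((norm_nonneg _).trans hP) hN'
        linarith
    rw [e]
    refine (mul_le_mul_of_nonneg_left (sum_le_sum h1) (by positivity)).trans (le_of_eq ?_)
    simp
    ring

/-- The symmetrised plane wave of a configuration. -/
theorem exists_symmetrised {Λ : Finset (Fin d → ℤ)} {k₀ : Fin N → (Fin d → ℤ)}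
    (hk₀ : k₀ ∈ box N Λ) (t : (Fin d → ℤ) → ℝ) :
    ∃ c : (Fin N → (Fin d → ℤ)) → ℝ,
      Admissible Λ (fun k => ∑ i, k i = ∑ i, k₀ i) c ∧ ev Λ (fun _ => 1) c = 1 ∧
      ev Λ (kin t) c = kin t k₀ := by
  -- The indicator of the permutation orbit of `k₀`, on which kinetic energy and total momentum are
  -- constant.
  set b : (Fin N → (Fin d → ℤ)) → ℝ := fun k =>
    if ∃ σ : Equiv.Perm (Fin N), k = k₀ ∘ σ then 1 else 0 with hb
  have hb1 : ∀ k, b k ≠ 0 → ∃ σ : Equiv.Perm (Fin N), k = k₀ ∘ σ := by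
    intro k hk
    by_contra h
    exact hk (if_neg h)
  have hbsymm : IsSymm b := by
    intro σ k
    have : (∃ τ : Equiv.Perm (Fin N), k ∘ σ = k₀ ∘ τ) ↔ ∃ τ : Equiv.Perm (Fin N), k = k₀ ∘ τ := by
      constructor
      · rintro ⟨τ, h⟩
        refine ⟨σ.symm.trans τ, ?_⟩
        funext i
        have := congrFun h (σ.symm i)
        simpa using this
      · rintro ⟨τ, rfl⟩
        exact ⟨σ.trans τ, rfl⟩
    simp only [hb, this]
  have hbbox : ∀ k, k ∉ box N Λ → b k = 0 := by
    intro k hk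
    by_contra h
    obtain ⟨σ, rfl⟩ := hb1 k h
    exact hk (mem_box.2 fun i => mem_box.1 hk₀ (σ i))
  have hbsupp : ∀ k, ¬ ∑ i, k i = ∑ i, k₀ i → b k = 0 := by
    intro k hk
    by_contra h
    obtain ⟨σ, rfl⟩ := hb1 k h
    exact hk (Equiv.sum_comp σ k₀)
  have hbk : ev Λ (kin t) b = kin t k₀ * ev Λ (fun _ => 1) b := by
    rw [← ev_const]
    refine ev_congr_supp fun k hk => ?_
    obtain ⟨σ, rfl⟩ := hb1 k hk
    exact Equiv.sum_comp σ fun i => t (k₀ i)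
  have hpos : 0 < ev Λ (fun _ => 1) b := by
    refine sum_pos' (fun k _ => by positivity) ⟨k₀, hk₀, ?_⟩
    have : b k₀ = 1 := if_pos ⟨1, rfl⟩
    simp [this]
  set s := (√(ev Λ (fun _ => 1) b))⁻¹ with hs
  have hs2 : s ^ 2 * ev Λ (fun _ => 1) b = 1 := by
    rw [hs, inv_pow, Real.sq_sqrt hpos.le, inv_mul_cancel₀ hpos.ne']
  have hevs : ev Λ (kin t) (fun k => s * b k) = s ^ 2 * ev Λ (kin t) b := by
    simp only [ev, mul_sum]
    exact sum_congr rfl fun k _ => by ring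
  refine ⟨fun k => s * b k, ⟨fun σ k => by simp only [hbsymm σ k],
    fun k hk => by rw [hbbox k hk, mul_zero], fun k hk => by rw [hbsupp k hk, mul_zero]⟩,
    by rw [ev_one_smul, hs2], ?_⟩
  rw [hevs, hbk]
  linear_combination kin t k₀ * hs2

theorem lowForm_le_of_kin {v : UnitAddTorus (Fin d) → ℝ} {B : ℝ} (hv : IsPotential v B)
    (hN : 2 ≤ N) {U : ℝ} (hU : ∀ Λ : Finset (Fin d → ℤ), ∑ p ∈ Λ, vHat v p ≤ U) {L : ℕ}
    {c : (Fin N → (Fin d → ℤ)) → ℝ} (hc : IsSymm c) (hs : ∀ k, k ∉ box N (cube d L) → c k = 0)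
    (hn : ev (cube d L) (fun _ => 1) c = 1) :
    lowForm momentumSq (vHat v) (cube d L) c ≤
      (1 + 9 * U) * ev (cube d L) (kin momentumSq) c + 3 * U :=
  lowForm_le hN (zero_mem_cube d L) (fun _ hp => neg_mem_cube hp) momentumSq_zero
    (fun _ hp => one_le_momentumSq hp) hv.type (hU _) hc hs hn

/-- The energy of the symmetrised plane wave is compared with `lowForm` on a box that also contains
all momentum differences, where the kinetic energy controls it. -/
theorem exists_sectorEnergy_le {v : UnitAddTorus (Fin d) → ℝ} {B : ℝ} (hv : IsPotential v B)
    (hN : 2 ≤ N) {U : ℝ} (hU : ∀ Λ : Finset (Fin d → ℤ), ∑ p ∈ Λ, vHat v p ≤ U)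
    (k₀ : Fin N → (Fin d → ℤ)) :
    ∃ e ∈ sectorEnergies v N (fun k => ∑ i, k i = ∑ i, k₀ i),
      e ≤ N / 2 * vHat v 0 + (1 + 9 * U) * kin momentumSq k₀ + 3 * U := by
  obtain ⟨L, hL⟩ := exists_subset_cube (univ.image k₀)
  have hk₀ : k₀ ∈ box N (cube d L) := mem_box.2 fun i => hL (mem_image_of_mem _ (mem_univ i))
  obtain ⟨c, hc, hn, hkin⟩ := exists_symmetrised hk₀ momentumSq
  refine ⟨_, fullForm_mem_sectorEnergies hv hN hc hn, ?_⟩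
  obtain ⟨L', hL'⟩ := exists_subset_cube (cube d L ∪ differences (cube d L))
  have hΛ : cube d L ⊆ cube d L' := subset_union_left.trans hL'
  have hM : differences (cube d L) ⊆ (cube d L').erase 0 := fun p hp =>
    mem_erase.2 ⟨fun h => zero_notMem_differences _ (h ▸ hp), hL' (mem_union_right _ hp)⟩
  have h1 := upForm_le_lowForm hN hΛ hM (t := momentumSq) hv.type hc.box
  have hs' : ∀ k, k ∉ box N (cube d L') → c k = 0 := fun k hk =>
    hc.box k fun h => hk (box_subset hΛ h)
  have h2 := lowForm_le_of_kin hv hN hU hc.symm hs' (by rw [ev_eq_of_subset hΛ hc.box, hn])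
  rw [ev_eq_of_subset hΛ hc.box, hkin] at h2
  rw [fullForm, hn, mul_one]
  linarith

end CrudeState

/-! ### Lower bound on the sector energies. -/

section Lower

variable {N d : ℕ}

/-- The lower bound on the energy of a momentum sector. -/
theorem le_sectorEnergy {v : UnitAddTorus (Fin d) → ℝ} {B : ℝ} (hv : IsPotential v B)
    (hN : 2 ≤ N) {U : ℝ} (hU : ∀ Λ : Finset (Fin d → ℤ), ∑ p ∈ Λ, vHat v p ≤ U)
    (k₀ : Fin N → (Fin d → ℤ)) {m : ℝ}
    (hm : m ∈ lowerBounds (bogoliubovEnergies v (momentum (∑ i, k₀ i)))) {ξ κ : ℝ}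
    (hξ : 1 ≤ ξ) (hκ : 1 ≤ κ) (hξκ : ξ ≤ κ * N)
    (hle : (1 + 9 * U) * kin momentumSq k₀ + 3 * U ≤ ξ) :
    N / 2 * vHat v 0 - shift v + m
        - (κ * (2 + 4 * U + 2 * U * (1 + 10 * U)) + 6 * U + U * (1 + 10 * U)) * (ξ * √(ξ / N)) ≤
      sectorEnergy v N (momentum (∑ i, k₀ i)) := by
  -- `lowForm` keeps only transfers in the cube, whereas the subtracted constant involves all
  -- differences. The mismatch is a tail of the summable v̂ and falls below ε for large cubes.
  refine le_of_forall_pos_le_add fun ε hε => ?_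
  rw [← sub_le_iff_le_add, sectorEnergy_eq]
  obtain ⟨e, he, -⟩ := exists_sectorEnergy_le hv hN hU k₀
  refine le_sInf_sectorEnergies hv hN ⟨e, he⟩ ?_
  obtain ⟨hw, -, -, -⟩ := weight_bounds hN
  set w := (2 * ((N : ℝ) - 1))⁻¹
  have hN' : (0 : ℝ) ≤ N := Nat.cast_nonneg _
  have hlim : Tendsto (fun L => w * N * (∑' p, vHat v p - ∑ p ∈ cube d L, vHat v p)) atTop
      (nhds (w * N * (∑' p, vHat v p - ∑' p, vHat v p))) :=
    ((tendsto_sum_cube (summable_vHat hv)).const_sub _).const_mul _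
  rw [sub_self, mul_zero] at hlim
  obtain ⟨L₀, hL₀⟩ := exists_subset_cube (univ.image k₀)
  filter_upwards [eventually_ge_atTop L₀, hlim.eventually_lt_const hε] with L hL htail f hf
  set Λ := cube d L
  have hk₀ : k₀ ∈ box N Λ :=
    mem_box.2 fun i => cube_mono d hL (hL₀ (mem_image_of_mem _ (mem_univ i)))
  obtain ⟨c, hc, hn, hkin⟩ := exists_symmetrised hk₀ momentumSq
  have h0 : (0 : Fin d → ℤ) ∈ Λ := zero_mem_cube d L
  have hneg : ∀ p ∈ Λ, -p ∈ Λ := fun _ hp => neg_mem_cube hp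
  have hlow := lowForm_le_of_kin hv hN hU hc.symm hc.box hn
  rw [hkin] at hlow
  have h1 := lower_bound hN h0 hneg (fun _ hp => ne_neg_of_ne_zero hp) momentumSq_zero
    (fun _ hp => one_le_momentumSq hp) momentumSq_neg hv.type (hU (Λ.erase 0))
    (fun k hk hS => le_imbalance_energy hv hneg hk (by rw [hS]; exact hm)) hc hn hξ hκ hξκ
    (hlow.trans hle) hf
  have h2 := lowForm_le_upForm hN (erase_zero_subset_differences h0) (t := momentumSq) hv.type f
  rw [sum_erase_shift] at h1
  have h3 : 1 / 2 * ∑ p ∈ Λ, shiftTerm v p ≤ shift v :=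
    mul_le_mul_of_nonneg_left ((summable_shiftTerm hv).sum_le_tsum _ fun p _ =>
      shiftTerm_nonneg hv p) (by norm_num)
  have h4 : ∑ p ∈ differences Λ, vHat v p - ∑ p ∈ Λ.erase 0, vHat v p ≤
      ∑' p, vHat v p - ∑ p ∈ Λ, vHat v p := by
    have h5 := (summable_vHat hv).sum_le_tsum (insert 0 (differences Λ)) fun p _ => hv.type p
    rw [sum_insert (zero_notMem_differences Λ)] at h5
    have h6 := add_sum_erase Λ (vHat v) h0
    linarith
  have h5 : w * N * (∑ p ∈ differences Λ, vHat v p - ∑ p ∈ Λ.erase 0, vHat v p) ≤ ε :=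
    (mul_le_mul_of_nonneg_left h4 (by positivity)).trans htail.le
  have hev : 0 ≤ ev Λ (fun _ => 1) f := ev_nonneg (fun _ _ => zero_le_one) f
  rw [fullForm]
  calc _ ≤ ((m - 1 / 2 * ∑ p ∈ Λ, shiftTerm v p + w * N * ∑ p ∈ Λ.erase 0, vHat v p
        - (κ * (2 + 4 * U + 2 * U * (1 + 10 * U)) + 6 * U + U * (1 + 10 * U)) * (ξ * √(ξ / N)))
        - w * N * (∑ p ∈ differences Λ, vHat v p) + N / 2 * vHat v 0) * ev Λ (fun _ => 1) f := by
        refine mul_le_mul_of_nonneg_right ?_ hev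
        linarith
    _ ≤ _ := by
        rw [add_mul, sub_mul]
        linarith

end Lower
end BoseGas

namespace BoseGas
open Finset Function MeasureTheory Filter

set_option linter.unusedSectionVars false

/-! ### Combination of the bounds and elimination of the common constant. -/

section Gap

variable {N d : ℕ}

/-- The balanced configuration permits ξ = C₂(|P| + 1). Then κ = C₂(K + 1) satisfies ξ ≤ κN, because
|P| ≤ KN and N ≥ 1. -/
theorem exists_lower_constant {v : UnitAddTorus (Fin d) → ℝ} {B : ℝ} (hv : IsPotential v B)
    {K : ℝ} (hK : 0 ≤ K) : ∃ C : ℝ, 0 ≤ C ∧ ∀ N : ℕ, 2 ≤ N → ∀ (P : Fin d → ℤ) (m : ℝ),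
      IsLeast (bogoliubovEnergies v (momentum P)) m → ‖momentum P‖ ≤ K * N →
      N / 2 * vHat v 0 - shift v + m - C * ((‖momentum P‖ + 1) * √((‖momentum P‖ + 1) / N)) ≤
        sectorEnergy v N (momentum P) := by
  set U := B * 2 ^ d
  have hU : ∀ Λ : Finset (Fin d → ℤ), ∑ p ∈ Λ, vHat v p ≤ U := sum_vHat_le hv
  have hU0 : 0 ≤ U := by simpa using hU ∅
  set C₁ := (2 * Real.pi) ^ 2 * d * (K + 1)
  have hC₁ : 0 ≤ C₁ := by positivity
  set C₂ := (1 + 9 * U) * C₁ + 3 * U + 1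
  have hC₂ : 1 ≤ C₂ := by
    have : 0 ≤ (1 + 9 * U) * C₁ + 3 * U := by positivity
    linarith
  set κ := C₂ * (K + 1)
  have hκ : 1 ≤ κ := one_le_mul_of_one_le_of_one_le hC₂ (by linarith)
  refine ⟨(κ * (2 + 4 * U + 2 * U * (1 + 10 * U)) + 6 * U + U * (1 + 10 * U)) * (C₂ * √C₂),
    by positivity, ?_⟩
  intro N hN P m hm hP
  have hN' : (2 : ℝ) ≤ N := by exact_mod_cast hN
  set p := ‖momentum P‖
  have hp : 0 ≤ p := norm_nonneg _
  obtain ⟨k₀, rfl, hkin⟩ := exists_balanced_config (by omega) P hP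
  have h1 := le_sectorEnergy hv hN hU k₀ hm.2 (ξ := C₂ * (p + 1)) (κ := κ)
    (one_le_mul_of_one_le_of_one_le hC₂ (by linarith)) hκ
    (by
      rw [mul_assoc]
      refine mul_le_mul_of_nonneg_left ?_ (by linarith)
      linarith)
    (by
      have h2 := mul_le_mul_of_nonneg_left hkin (show 0 ≤ 1 + 9 * U by linarith)
      calc _ ≤ (1 + 9 * U) * (C₁ * p) + 3 * U := by linarith
        _ ≤ _ := by
          have h3 : 0 ≤ (1 + 9 * U) * C₁ := by positivity
          have h4 : 0 ≤ (3 * U + 1) * p := by positivity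
          simp only [C₂]
          linarith)
  have e : C₂ * (p + 1) * √(C₂ * (p + 1) / N) = C₂ * √C₂ * ((p + 1) * √((p + 1) / N)) := by
    rw [mul_div_assoc, Real.sqrt_mul (by linarith)]
    ring
  rw [e] at h1
  linarith

theorem exists_crude_constant {v : UnitAddTorus (Fin d) → ℝ} {B : ℝ} (hv : IsPotential v B)
    {K : ℝ} (hK : 0 ≤ K) : ∃ C : ℝ, 0 ≤ C ∧ ∀ N : ℕ, 2 ≤ N → ∀ P : Fin d → ℤ,
      ‖momentum P‖ ≤ K * N →
      sectorEnergy v N (momentum P) ≤ N / 2 * vHat v 0 + C * (‖momentum P‖ + 1) := by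
  set U := B * 2 ^ d
  have hU : ∀ Λ : Finset (Fin d → ℤ), ∑ p ∈ Λ, vHat v p ≤ U := sum_vHat_le hv
  have hU0 : 0 ≤ U := by simpa using hU ∅
  set C₁ := (2 * Real.pi) ^ 2 * d * (K + 1)
  have hC₁ : 0 ≤ C₁ := by positivity
  refine ⟨(1 + 9 * U) * C₁ + 3 * U, by positivity, fun N hN P hP => ?_⟩
  obtain ⟨k₀, rfl, hkin⟩ := exists_balanced_config (by omega) P hP
  obtain ⟨e, he, hle⟩ := exists_sectorEnergy_le hv hN hU k₀
  rw [sectorEnergy_eq]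
  refine (csInf_le (bddBelow_sectorEnergies hv hN _) he).trans (hle.trans ?_)
  have hp := norm_nonneg (momentum (∑ i, k₀ i))
  have h2 := mul_le_mul_of_nonneg_left hkin (show 0 ≤ 1 + 9 * U by linarith)
  have h3 : 0 ≤ (1 + 9 * U) * C₁ := by positivity
  have h4 : 0 ≤ 3 * U * ‖momentum (∑ i, k₀ i)‖ := by positivity
  simp only [C₁] at h3 ⊢
  linarith

theorem nonempty_sector {v : UnitAddTorus (Fin d) → ℝ} {B : ℝ} (hv : IsPotential v B)
    (hN : 2 ≤ N) (P : Fin d → ℤ) : (sectorEnergies v N fun k => ∑ i, k i = P).Nonempty := by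
  have hN' : (0 : ℝ) < N := by exact_mod_cast (show 0 < N by omega)
  obtain ⟨k₀, rfl, -⟩ := exists_balanced_config (N := N) (by omega) P (K := ‖momentum P‖ / N)
    (by rw [div_mul_cancel₀ _ hN'.ne'])
  obtain ⟨e, he, -⟩ := exists_sectorEnergy_le hv hN (sum_vHat_le hv) k₀
  exact ⟨e, he⟩

theorem isLeast_bogoliubovEnergies_zero (v : UnitAddTorus (Fin d) → ℝ) :
    IsLeast (bogoliubovEnergies v (momentum 0)) 0 := by
  refine ⟨?_, fun e he => nonneg_of_mem_bogoliubovEnergies he⟩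
  simpa using sum_mem_bogoliubovEnergies v (A := ∅) (by simp) fun _ => 0

theorem sqrt_div_mul_bounds {p n : ℝ} (hp : 1 ≤ p) (hn : 1 ≤ n) :
    1 / n ≤ √(1 / n) ∧ √(1 / n) ≤ p * √(p / n) ∧
      (p + 1) * √((p + 1) / n) ≤ 4 * (p * √(p / n)) := by
  have hn0 : 0 < n := by linarith
  have h1 : √(1 / n) ≤ √(p / n) := Real.sqrt_le_sqrt (div_le_div_of_nonneg_right hp hn0.le)
  refine ⟨?_, ?_, ?_⟩
  · have h2 : 1 / n ≤ 1 := (div_le_one hn0).2 hn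
    have h3 : 0 ≤ 1 / n := by positivity
    exact Real.le_sqrt_of_sq_le (by nlinarith)
  · exact h1.trans (le_mul_of_one_le_left (Real.sqrt_nonneg _) hp)
  · have h2 : √((p + 1) / n) ≤ 2 * √(p / n) := by
      rw [show (2 : ℝ) = √4 by rw [show (4 : ℝ) = 2 ^ 2 by norm_num, Real.sqrt_sq (by norm_num)],
        ← Real.sqrt_mul (by norm_num)]
      refine Real.sqrt_le_sqrt ?_
      rw [← mul_div_assoc]
      exact div_le_div_of_nonneg_right (by linarith) hn0.le
    calc _ ≤ (2 * p) * (2 * √(p / n)) :=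
          mul_le_mul (by linarith) h2 (Real.sqrt_nonneg _) (by linarith)
      _ = _ := by ring

/-- The excitation spectrum in the momentum sectors. -/
theorem exists_gap_constant {v : UnitAddTorus (Fin d) → ℝ} {B : ℝ} (hv : IsPotential v B)
    {K : ℝ} (hK : 0 ≤ K) : ∃ C : ℝ, 0 ≤ C ∧ ∀ N : ℕ, 2 ≤ N → ∀ (P : Fin d → ℤ) (m : ℝ),
      IsLeast (bogoliubovEnergies v (momentum P)) m → ‖momentum P‖ ≤ K * N →
      |sectorEnergy v N (momentum P) - groundEnergy v N - m| ≤
        C * (‖momentum P‖ * √(‖momentum P‖ / N)) := by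
  obtain ⟨C₁, hC₁, hlow⟩ := exists_lower_constant hv hK
  obtain ⟨C₂, hC₂, hcrude⟩ := exists_crude_constant hv hK
  set U := B * 2 ^ d
  have hU : ∀ Λ : Finset (Fin d → ℤ), ∑ p ∈ Λ, vHat v p ≤ U := sum_vHat_le hv
  have hU0 : 0 ≤ U := by simpa using hU ∅
  set C₃ := 6 * U * (2 + 4 * U * (U + 1))
  have hC₃ : 0 ≤ C₃ := by positivity
  set D := d * ((2 * Real.pi) ^ 2 + U) + 1
  have hD : 1 ≤ D := by
    have : 0 ≤ d * ((2 * Real.pi) ^ 2 + U) := by positivity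
    linarith
  have hshift := shift_nonneg hv
  refine ⟨4 * C₁ + C₃ + C₃ * (D + 1) ^ 2 + C₁ + (2 * C₂ + shift v + C₁) * √D, by positivity, ?_⟩
  intro N hN P m hm hP
  have hN' : (2 : ℝ) ≤ N := by exact_mod_cast hN
  have hG : sectorEnergy v N (momentum 0) = groundEnergy v N :=
    sectorEnergy_zero hv hN (nonempty_sector hv hN 0)
  -- At P = 0 the right side vanishes, so the equality of E_0(N) with the zero sector energy is
  -- needed exactly. For P ≠ 0 one has |P| ≥ 1 and |P| + 1 may be replaced by |P|.
  by_cases hP0 : P = 0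
  · subst hP0
    have : m = 0 := hm.unique (isLeast_bogoliubovEnergies_zero v)
    rw [hG, this, momentum_zero, norm_zero]
    simp
  have hp : 1 ≤ ‖momentum P‖ := one_le_norm_momentum hP0
  have hL := hlow N hN P m hm hP
  have hL0 := hlow N hN 0 0 (isLeast_bogoliubovEnergies_zero v)
    (by rw [momentum_zero, norm_zero]; positivity)
  have hU0' := sectorEnergy_le hv hN (isLeast_bogoliubovEnergies_zero v).1 (Nat.cast_nonneg N) hU
  have hm0 := nonneg_of_mem_bogoliubovEnergies hm.1
  have hmD : m ≤ D * ‖momentum P‖ := by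
    obtain ⟨E, hE, hle⟩ := exists_bogoliubovEnergy_le hv P
    have h1 := (hm.2 hE).trans hle
    have h2 : d * ((2 * Real.pi) ^ 2 + U) * ‖momentum P‖ ≤ D * ‖momentum P‖ :=
      mul_le_mul_of_nonneg_right (by simp only [D]; linarith) (norm_nonneg _)
    exact h1.trans h2
  rw [hG] at hL0 hU0'
  rw [momentum_zero, norm_zero, zero_add, one_mul, add_zero] at hL0
  rw [zero_add, one_pow, mul_one, add_zero] at hU0'
  have hcr := hcrude N hN P hP
  have hmain : m ≤ N → sectorEnergy v N (momentum P) ≤ N / 2 * vHat v 0 - shift v + m +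
      C₃ * (m + 1) ^ 2 / N := fun h => sectorEnergy_le hv hN hm.1 h hU
  generalize sectorEnergy v N (momentum P) = EP at *
  generalize groundEnergy v N = EG at *
  generalize N / 2 * vHat v 0 = M at *
  generalize shift v = σ at *
  generalize ‖momentum P‖ = p at *
  obtain ⟨hb1, hb2, hb3⟩ := sqrt_div_mul_bounds hp (show (1 : ℝ) ≤ N by linarith)
  set x := p * √(p / N) with hx
  have hx0 : 0 ≤ x := by positivity
  have hN0 : (0 : ℝ) < N := by linarith
  -- Lower bound at P minus the trial upper bound at zero momentum; the common constant drops out.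
  have hlo : -(4 * C₁ + C₃) * x ≤ EP - EG - m := by
    have h1 : C₁ * ((p + 1) * √((p + 1) / N)) ≤ C₁ * (4 * x) := mul_le_mul_of_nonneg_left hb3 hC₁
    have h2 : C₃ / N ≤ C₃ * x := by
      rw [div_eq_mul_one_div]
      exact mul_le_mul_of_nonneg_left (hb1.trans hb2) hC₃
    linarith
  have h3 : C₁ * √(1 / N) ≤ C₁ * x := mul_le_mul_of_nonneg_left hb2 hC₁
  have hup : EP - EG - m ≤ (C₃ * (D + 1) ^ 2 + C₁ + (2 * C₂ + σ + C₁) * √D) * x := by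
    have hA : 0 ≤ C₃ * (D + 1) ^ 2 * x := by positivity
    have hB : 0 ≤ (2 * C₂ + σ + C₁) * √D * x := by positivity
    -- The trial state requires m ≤ N, which D|P| ≤ N guarantees. Otherwise |P| ≤ √D · |P|^{3/2}
    -- N^{-1/2}, so the crude bound of order |P| suffices.
    rcases le_or_gt (D * p) N with h | h
    · have h4 := hmain (hmD.trans h)
      have h5 : C₃ * (m + 1) ^ 2 / N ≤ C₃ * (D + 1) ^ 2 * x := by
        suffices h5' : (m + 1) ^ 2 / N ≤ (D + 1) ^ 2 * x by
          calc C₃ * (m + 1) ^ 2 / N = C₃ * ((m + 1) ^ 2 / N) := by ring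
            _ ≤ C₃ * ((D + 1) ^ 2 * x) := mul_le_mul_of_nonneg_left h5' hC₃
            _ = _ := by ring
        have h6 : (m + 1) ^ 2 ≤ ((D + 1) * p) ^ 2 := pow_le_pow_left₀ (by linarith) (by linarith) 2
        have h7 : p ^ 2 / N ≤ x := by
          have h8 : p / N ≤ √(p / N) := by
            have h9 : p / N ≤ 1 := (div_le_one hN0).2 (by nlinarith)
            have h10 : 0 ≤ p / N := by positivity
            exact Real.le_sqrt_of_sq_le (by nlinarith)
          calc p ^ 2 / N = p * (p / N) := by ring
            _ ≤ _ := mul_le_mul_of_nonneg_left h8 (by linarith)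
        calc (m + 1) ^ 2 / N ≤ ((D + 1) * p) ^ 2 / N := div_le_div_of_nonneg_right h6 hN0.le
          _ = (D + 1) ^ 2 * (p ^ 2 / N) := by ring
          _ ≤ _ := mul_le_mul_of_nonneg_left h7 (by positivity)
      linarith
    · have h4 : p ≤ √D * x := by
        have h5 : 1 ≤ √D * √(p / N) := by
          rw [← Real.sqrt_mul (by linarith), Real.one_le_sqrt, ← mul_div_assoc, one_le_div hN0]
          exact h.le
        calc p = p * 1 := (mul_one p).symm
          _ ≤ p * (√D * √(p / N)) := mul_le_mul_of_nonneg_left h5 (by linarith)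
          _ = _ := by ring
      have h5 : √(1 / N) ≤ 1 := by
        rw [Real.sqrt_le_iff, one_pow, div_le_one hN0]
        exact ⟨zero_le_one, by linarith⟩
      have h6 : C₁ * √(1 / N) ≤ C₁ := mul_le_of_le_one_right hC₁ h5
      have h7 : EP - EG - m ≤ (2 * C₂ + σ + C₁) * p := by
        have h8 : C₂ ≤ C₂ * p := le_mul_of_one_le_right hC₂ hp
        have h9 : σ ≤ σ * p := le_mul_of_one_le_right hshift hp
        have h10 : C₁ ≤ C₁ * p := le_mul_of_one_le_right hC₁ hp
        linarith
      have h8 : (2 * C₂ + σ + C₁) * p ≤ (2 * C₂ + σ + C₁) * (√D * x) :=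
        mul_le_mul_of_nonneg_left h4 (by positivity)
      have h9 : 0 ≤ C₁ * x := by positivity
      linarith
  rw [abs_le]
  have hA : 0 ≤ (C₃ * (D + 1) ^ 2 + C₁ + (2 * C₂ + σ + C₁) * √D) * x := by positivity
  have hB : 0 ≤ (4 * C₁ + C₃) * x := by positivity
  constructor <;> linarith

theorem rpow_mul_rpow_eq {p n : ℝ} (hp : 0 ≤ p) (hn : 0 ≤ n) :
    p ^ (3 / 2 : ℝ) * n ^ (-(1 / 2) : ℝ) = p * √(p / n) := by
  rw [Real.rpow_neg hn, ← Real.sqrt_eq_rpow, Real.sqrt_div hp, ← div_eq_mul_inv, ← mul_div_assoc,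
    show (3 / 2 : ℝ) = 1 + 1 / 2 by norm_num, Real.rpow_add_of_nonneg hp zero_le_one (by norm_num),
    Real.rpow_one, Real.sqrt_eq_rpow p]

end Gap
end BoseGas

theorem mainTheorem2 {d : ℕ} (hd : 1 ≤ d) (v : UnitAddTorus (Fin d) → ℝ)
    (hv_meas : Measurable v) (hv_bdd : ∃ M : ℝ, ∀ x, v x ≤ M) (hv_nonneg : ∀ x, 0 ≤ v x)
    (hv_even : ∀ x, v (-x) = v x) (hv_type : ∀ k, 0 ≤ BoseGas.vHat v k) :
    (∃ m : (Fin d → ℤ) → ℝ,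
      (∀ k, IsLeast (BoseGas.bogoliubovEnergies v (BoseGas.momentum k)) (m k)) ∧
      ∀ K : ℝ, ∃ C : ℝ, ∀ N : ℕ, 2 ≤ N → ∀ k : Fin d → ℤ, ‖BoseGas.momentum k‖ ≤ K * N →
        |BoseGas.sectorEnergy v N (BoseGas.momentum k) - BoseGas.groundEnergy v N - m k|
          ≤ C * ‖BoseGas.momentum k‖ ^ (3 / 2 : ℝ) * (N : ℝ) ^ (-(1 / 2) : ℝ)) ∧
    (∃ s : ℝ, IsLeast (BoseGas.criticalSpeeds v) s ∧
      ∃ C : ℝ, ∀ N : ℕ, 2 ≤ N → ∀ k : Fin d → ℤ,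
        ‖BoseGas.momentum k‖ * s
            - C * ‖BoseGas.momentum k‖ ^ (3 / 2 : ℝ) * (N : ℝ) ^ (-(1 / 2) : ℝ)
          ≤ BoseGas.sectorEnergy v N (BoseGas.momentum k) - BoseGas.groundEnergy v N) ∧
    (∃ c₁ c₂ δ : ℝ, 0 < c₁ ∧ 0 < δ ∧ ∀ N : ℕ, 2 ≤ N → ∀ k : Fin d → ℤ,
      ‖BoseGas.momentum k‖ ≤ δ * N →
        c₁ * ‖BoseGas.momentum k‖
            ≤ BoseGas.sectorEnergy v N (BoseGas.momentum k) - BoseGas.groundEnergy v N ∧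
        BoseGas.sectorEnergy v N (BoseGas.momentum k) - BoseGas.groundEnergy v N
            ≤ c₂ * ‖BoseGas.momentum k‖) := by
  obtain ⟨B, hB⟩ := hv_bdd
  have hv : BoseGas.IsPotential v B := ⟨hv_meas, hv_nonneg, hB, hv_even, hv_type⟩
  choose m hm using BoseGas.exists_isLeast_bogoliubovEnergies hv
  obtain ⟨s, hs⟩ := BoseGas.exists_isLeast_criticalSpeeds hd hv
  have hs1 := BoseGas.one_le_criticalSpeed hv hs.1
  have hx : ∀ (C : ℝ) (N : ℕ) (k : Fin d → ℤ),
      C * ‖BoseGas.momentum k‖ ^ (3 / 2 : ℝ) * (N : ℝ) ^ (-(1 / 2) : ℝ) =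
        C * (‖BoseGas.momentum k‖ * √(‖BoseGas.momentum k‖ / N)) := fun C N k => by
    rw [mul_assoc, BoseGas.rpow_mul_rpow_eq (norm_nonneg _) (Nat.cast_nonneg _)]
  have hlow : ∃ C : ℝ, 0 ≤ C ∧ ∀ N : ℕ, 2 ≤ N → ∀ k : Fin d → ℤ,
      ‖BoseGas.momentum k‖ * s - C * (‖BoseGas.momentum k‖ * √(‖BoseGas.momentum k‖ / N)) ≤
        BoseGas.sectorEnergy v N (BoseGas.momentum k) - BoseGas.groundEnergy v N := by
    obtain ⟨C, hC, h⟩ := BoseGas.exists_gap_constant hv (zero_le_one (α := ℝ))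
    -- The additional `s` handles |P| > N: there s |P|^{3/2} N^{-1/2} ≥ s |P|, and it remains to
    -- know that the gap is non-negative.
    refine ⟨C + s, by linarith, fun N hN k => ?_⟩
    have hN0 : (0 : ℝ) < N := by exact_mod_cast (show 0 < N by omega)
    have hp := norm_nonneg (BoseGas.momentum k)
    have hxn : 0 ≤ ‖BoseGas.momentum k‖ * √(‖BoseGas.momentum k‖ / N) := by positivity
    rcases le_or_gt ‖BoseGas.momentum k‖ (1 * N) with hk | hk
    · have h1 := (abs_le.1 (h N hN k (m k) (hm k) hk)).1
      have h2 := BoseGas.criticalSpeed_mul_le hv hs (hm k).1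
      have h3 := mul_nonneg (zero_le_one.trans hs1) hxn
      linarith
    · have h1 := BoseGas.groundEnergy_le_sectorEnergy hv hN k (BoseGas.nonempty_sector hv hN k)
      have h2 : 1 ≤ √(‖BoseGas.momentum k‖ / N) := by
        rw [Real.one_le_sqrt, one_le_div hN0]
        linarith
      have h3 : s * ‖BoseGas.momentum k‖ ≤
          s * (‖BoseGas.momentum k‖ * √(‖BoseGas.momentum k‖ / N)) :=
        mul_le_mul_of_nonneg_left (le_mul_of_one_le_right hp h2) (by linarith)
      have h4 := mul_nonneg hC hxn
      linarith
  refine ⟨⟨m, hm, fun K => ?_⟩, ⟨s, hs, ?_⟩, ?_⟩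
  · obtain ⟨C, -, h⟩ := BoseGas.exists_gap_constant hv (le_max_right K 0)
    refine ⟨C, fun N hN k hk => ?_⟩
    rw [hx]
    exact h N hN k (m k) (hm k)
      (hk.trans (mul_le_mul_of_nonneg_right (le_max_left K 0) (Nat.cast_nonneg N)))
  · obtain ⟨C, -, h⟩ := hlow
    refine ⟨C, fun N hN k => ?_⟩
    rw [hx]
    exact h N hN k
  · obtain ⟨C, hC, h⟩ := hlow
    obtain ⟨C', hC', h'⟩ := BoseGas.exists_gap_constant hv (zero_le_one (α := ℝ))
    -- This δ makes C √(|P|/N) ≤ 1/2; since s ≥ 1, at least half of |P| survives. As δ ≤ 1, the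
    -- two-sided bound with K = 1 and m(P) = O(|P|) give the upper estimate.
    refine ⟨1 / 2, d * ((2 * Real.pi) ^ 2 + B * 2 ^ d) + C', (1 / (2 * (C + 1))) ^ 2, by norm_num,
      by positivity, fun N hN k hk => ?_⟩
    have hN0 : (0 : ℝ) < N := by exact_mod_cast (show 0 < N by omega)
    have hp := norm_nonneg (BoseGas.momentum k)
    have hδ : 1 / (2 * (C + 1)) ≤ 1 := (div_le_one (by positivity)).2 (by linarith)
    have hr : √(‖BoseGas.momentum k‖ / N) ≤ 1 / (2 * (C + 1)) := by
      rw [Real.sqrt_le_left (by positivity), div_le_iff₀ hN0]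
      exact hk
    constructor
    · refine le_trans ?_ (h N hN k)
      have h1 : C * √(‖BoseGas.momentum k‖ / N) ≤ 1 / 2 := by
        refine (mul_le_mul_of_nonneg_left hr hC).trans ?_
        rw [mul_one_div, div_le_iff₀ (by positivity)]
        linarith
      have h2 := mul_le_mul_of_nonneg_left h1 hp
      have h3 := mul_le_mul_of_nonneg_left hs1 hp
      linarith
    · have hk1 : ‖BoseGas.momentum k‖ ≤ 1 * N :=
        hk.trans (mul_le_mul_of_nonneg_right (pow_le_one₀ (by positivity) hδ) hN0.le)
      have h1 := (abs_le.1 (h' N hN k (m k) (hm k) hk1)).2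
      obtain ⟨E, hE, hle⟩ := BoseGas.exists_bogoliubovEnergy_le hv k
      have h2 := ((hm k).2 hE).trans hle
      have h3 : C' * (‖BoseGas.momentum k‖ * √(‖BoseGas.momentum k‖ / N)) ≤
          C' * ‖BoseGas.momentum k‖ :=
        mul_le_mul_of_nonneg_left (mul_le_of_le_one_right hp (hr.trans hδ)) hC'
      linarith
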